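/- Let $\mathbb F$ be a field and $n\ge 0$. Let $H_n(0)$ be the $\mathbb F$-algebra generated by $\pi_1,\dots,\pi_{n-1}$ with relations $\pi_i^2=\pi_i$, $\pi_i\pi_{i+1}\pi_i=\pi_{i+1}\pi_i\pi_{i+1}$, and $\pi_i\pi_j=\pi_j\pi_i$ for $|i-j|>1$; put $\overline\pi_i=\pi_i-1$. For $w\in\mathfrak S_n$ with reduced expression $w=s_{i_1}\cdots s_{i_r}$, $s_i=(i,i+1)$, let $\pi_w=\pi_{i_1}\cdots\pi_{i_r}$ and $\overline\pi_w=\overline\pi_{i_1}\cdots\overline\pi_{i_r}$. For sets $I,J$ of generators $s_i$, let $w_0(I)$ be the longest element of the parabolic subgroup generated by $I$, and let $\mathcal P_{I,J}^S=H_n(0)\,\overline\pi_{w_0(I)}\pi_{w_0(J\setminus I)}$ and $\mathcal P_I^S=H_n(0)\,\overline\pi_{w_0(I)}\pi_{w_0(I^c)}$. For a composition $\alpha=(\alpha_1,\dots,\alpha_\ell)$ of $n$ write $\alpha\models n$ and $D(\alpha)=\{\alpha_1,\alpha_1+\alpha_2,\dots,\alpha_1+\cdots+\alpha_{\ell-1}\}$,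 and identify $\alpha$ with its ribbon diagram, whose rows from bottom to top have lengths $\alpha_1,\dots,\alpha_\ell$, each row starting in the column where the row below it ends. For compositions put $\alpha\cdot\beta=(\alpha_1,\dots,\alpha_\ell,\beta_1,\dots,\beta_m)$ and $\alpha\rhd\beta=(\alpha_1,\dots,\alpha_{\ell-1},\alpha_\ell+\beta_1,\beta_2,\dots,\beta_m)$. A generalized ribbon $\alpha=\alpha^1\oplus\cdots\oplus\alpha^k$ of size $n$ is a skew diagram with connected components the ribbons $\alpha^i\models n_i\ge1$, $n_1+\cdots+n_k=n$, with $\alpha^{i+1}$ strictly to the northeast of $\alpha^i$. Let $[\alpha^1]=\{\alpha^1\}$ and $[\alpha]=\{\beta\cdot\alpha^k,\ \beta\rhd\alpha^k:\beta\in[\alpha^1\oplus\cdots\oplus\alpha^{k-1}]\}$. A standard tableau of shape $\alpha$ is a filling of its boxes with $1,\dots,n$, each used once, with rows increasing from left to right and columns increasing from top to bottom. Let $\mathbf P_\alpha$ be the $\mathbb F$-vector space with basis the standard tableaux $\tau$ of shape $\alpha$, with $$\overline\pi_i(\tau)=\begin{cases}-\tau,& i\text{ is in a higher row of }\tau\text{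 than }i+1,\\ 0,& i\text{ is in the same row of }\tau\text{ as }i+1,\\ s_i(\tau),& i\text{ is in a lower row of }\tau\text{ than }i+1,\end{cases}\qquad(*)$$ where $s_i(\tau)$ is obtained from $\tau$ by exchanging $i$ and $i+1$. **Theorem.** (i) If $\alpha\models n$, then $\mathbf P_\alpha\cong\mathcal P_I^S$ as $H_n(0)$-modules, where $I=\{s_i:i\in D(\alpha)\}$; it is a projective indecomposable $H_n(0)$-module. (ii) Let $\alpha=\alpha^1\oplus\cdots\oplus\alpha^k$ be a generalized ribbon of size $n$ with components $\alpha^i\models n_i$, and let $$I=\{s_i:i\in D(\alpha^1\rhd\cdots\rhd\alpha^k)\},\qquad J=\{s_j:j\in D(1^{n_1}\rhd\cdots\rhd1^{n_k})\}.$$ Then $\mathbf P_\alpha$ is a well-defined $H_n(0)$-module by $(*)$, it is isomorphic to $\mathcal P_{I,J}^S$, and $$\mathbf P_\alpha\;\cong\;\left(\mathbf P_{\alpha^1}\otimes\cdots\otimes\mathbf P_{\alpha^k}\right)\uparrow_{H_{n_1,\dots,n_k}(0)}^{H_n(0)}\;\cong\;\bigoplus_{\beta\in[\alpha]}\mathbf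 P_\beta$$ as $H_n(0)$-modules, where $H_{n_1,\dots,n_k}(0)\cong H_{n_1}(0)\otimes\cdots\otimes H_{n_k}(0)$ is the parabolic subalgebra of $H_n(0)$ generated by the $\overline\pi_i$ with $i\notin\{n_1,n_1+n_2,\dots,n_1+\cdots+n_{k-1}\}$, and $N\uparrow_A^B=B\otimes_AN$. -/

import Mathlib

open scoped TensorProduct DirectSum

noncomputable section

namespace HeckeTableaux

/-! ### The 0-Hecke algebra of type A

Boxes, entries and generators are numbered from `0`: the entries `1, …, n` are the elements
`0, …, n - 1` of `Fin n`, and the generator with index `i + 1` is indexed by `i : Fin (n - 1)`. -/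

/-- The letter `i` of the pair `i`, `i + 1`. -/
def lo {n : ℕ} (i : Fin (n - 1)) : Fin n := ⟨i, by omega⟩

/-- The letter `i + 1` of the pair `i`, `i + 1`. -/
def hi {n : ℕ} (i : Fin (n - 1)) : Fin n := ⟨i + 1, by omega⟩

/-- The adjacent transposition exchanging `i` and `i + 1`. -/
def adj {n : ℕ} (i : Fin (n - 1)) : Equiv.Perm (Fin n) := Equiv.swap (lo i) (hi i)

/-- Defining relations of the 0-Hecke algebra of the symmetric group on `n` letters. -/
inductive ZeroHeckeRel (F : Type*) [Field F] (n : ℕ) :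
    FreeAlgebra F (Fin (n - 1)) → FreeAlgebra F (Fin (n - 1)) → Prop
  | quad (i : Fin (n - 1)) :
      ZeroHeckeRel F n (FreeAlgebra.ι F i * FreeAlgebra.ι F i) (FreeAlgebra.ι F i)
  | braid (i j : Fin (n - 1)) (h : (i : ℕ) + 1 = j) :
      ZeroHeckeRel F n (FreeAlgebra.ι F i * FreeAlgebra.ι F j * FreeAlgebra.ι F i)
        (FreeAlgebra.ι F j * FreeAlgebra.ι F i * FreeAlgebra.ι F j)
  | comm (i j : Fin (n - 1)) (h : (i : ℕ) + 1 < j) :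
      ZeroHeckeRel F n (FreeAlgebra.ι F i * FreeAlgebra.ι F j)
        (FreeAlgebra.ι F j * FreeAlgebra.ι F i)

/-- The 0-Hecke algebra `H_n(0)` over the field `F`. -/
abbrev ZeroHecke (F : Type*) [Field F] (n : ℕ) : Type _ := RingQuot (ZeroHeckeRel F n)

/-- The generator `π_i`. -/
def gen (F : Type*) [Field F] {n : ℕ} (i : Fin (n - 1)) : ZeroHecke F n :=
  RingQuot.mkAlgHom F (ZeroHeckeRel F n) (FreeAlgebra.ι F i)

/-- The generator `π̄_i = π_i - 1`. -/
def genBar (F : Type*) [Field F] {n : ℕ} (i : Fin (n - 1)) : ZeroHecke F n := gen F i - 1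

/-- The universal property of the presentation. -/
def liftHecke (F : Type*) [Field F] {n : ℕ} {A : Type*} [Ring A] [Algebra F A]
    (f : Fin (n - 1) → A) (hq : ∀ i, f i * f i = f i)
    (hb : ∀ i j : Fin (n - 1), (i : ℕ) + 1 = j → f i * f j * f i = f j * f i * f j)
    (hc : ∀ i j : Fin (n - 1), (i : ℕ) + 1 < j → f i * f j = f j * f i) :
    ZeroHecke F n →ₐ[F] A :=
  RingQuot.liftAlgHom F ⟨FreeAlgebra.lift F f, by
    intro x y h
    cases h with
    | quad i => simpa using hq i
    | braid i j h => simpa using hb i j h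
    | comm i j h => simpa using hc i j h⟩

theorem liftHecke_gen (F : Type*) [Field F] {n : ℕ} {A : Type*} [Ring A] [Algebra F A]
    (f : Fin (n - 1) → A) (hq hb hc) (i : Fin (n - 1)) :
    liftHecke F f hq hb hc (gen F i) = f i := by
  simp [liftHecke, gen]

theorem gen_mul_self (F : Type*) [Field F] {n : ℕ} (i : Fin (n - 1)) :
    gen F i * gen F i = gen F i := by
  simp only [gen, ← map_mul]
  exact RingQuot.mkAlgHom_rel F (ZeroHeckeRel.quad i)

theorem gen_braid (F : Type*) [Field F] {n : ℕ} (i j : Fin (n - 1)) (h : (i : ℕ) + 1 = j) :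
    gen F i * gen F j * gen F i = gen F j * gen F i * gen F j := by
  simp only [gen, ← map_mul]
  exact RingQuot.mkAlgHom_rel F (ZeroHeckeRel.braid i j h)

theorem gen_comm (F : Type*) [Field F] {n : ℕ} (i j : Fin (n - 1)) (h : (i : ℕ) + 1 < j) :
    gen F i * gen F j = gen F j * gen F i := by
  simp only [gen, ← map_mul]
  exact RingQuot.mkAlgHom_rel F (ZeroHeckeRel.comm i j h)

theorem adjoin_gen (F : Type*) [Field F] (n : ℕ) :
    Algebra.adjoin F (Set.range (gen F : Fin (n - 1) → ZeroHecke F n)) = ⊤ := by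
  have h : Set.range (gen F : Fin (n - 1) → ZeroHecke F n) =
      RingQuot.mkAlgHom F (ZeroHeckeRel F n) '' Set.range (FreeAlgebra.ι F) := by
    rw [← Set.range_comp]; rfl
  rw [h, ← AlgHom.map_adjoin, FreeAlgebra.adjoin_range_ι, Algebra.map_top,
    AlgHom.range_eq_top]
  exact RingQuot.mkAlgHom_surjective F _

/-! ### Reduced words, longest elements, and the left ideals `P_I`, `P_{I,J}` -/

/-- The permutation expressed by a word in the adjacent transpositions. -/
def wordProd {n : ℕ} (l : List (Fin (n - 1))) : Equiv.Perm (Fin n) := (l.map adj).prod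

theorem exists_word {n : ℕ} (w : Equiv.Perm (Fin n)) : ∃ l, wordProd l = w := by
  cases n with
  | zero => exact ⟨[], Subsingleton.elim _ _⟩
  | succ n =>
    have hw : w ∈ Submonoid.closure
        (Set.range fun i : Fin n => Equiv.swap i.castSucc i.succ) := by
      rw [Equiv.Perm.mclosure_swap_castSucc_succ]; trivial
    obtain ⟨l, hl, rfl⟩ := Submonoid.exists_list_of_mem_closure hw
    clear hw
    induction l with
    | nil => exact ⟨[], rfl⟩
    | cons a l ih =>
      obtain ⟨m, hm⟩ := ih fun y hy => hl y (List.mem_cons_of_mem _ hy)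
      obtain ⟨i, rfl⟩ := hl a List.mem_cons_self
      refine ⟨(i : Fin (n + 1 - 1)) :: m, ?_⟩
      rw [List.prod_cons, ← hm]
      rfl

/-- The length of a permutation: the smallest length of an expression of `w` as a product of
adjacent transpositions. -/
def length {n : ℕ} (w : Equiv.Perm (Fin n)) : ℕ :=
  sInf {k | ∃ l : List (Fin (n - 1)), wordProd l = w ∧ l.length = k}

theorem exists_reducedWord {n : ℕ} (w : Equiv.Perm (Fin n)) :
    ∃ l : List (Fin (n - 1)), wordProd l = w ∧ l.length = length w :=
  Nat.sInf_mem (s := {k | ∃ l : List (Fin (n - 1)), wordProd l = w ∧ l.length = k})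
    (let ⟨l, hl⟩ := exists_word w; ⟨l.length, l, hl, rfl⟩)

/-- A reduced expression of `w`. -/
def reducedWord {n : ℕ} (w : Equiv.Perm (Fin n)) : List (Fin (n - 1)) :=
  (exists_reducedWord w).choose

/-- `π_w`, the product of the `π_i` along a reduced expression of `w` (by the braid relations it
does not depend on the reduced expression). -/
def genPerm (F : Type*) [Field F] {n : ℕ} (w : Equiv.Perm (Fin n)) : ZeroHecke F n :=
  ((reducedWord w).map (gen F)).prod

/-- `π̄_w`, the product of the `π̄_i` along a reduced expression of `w`. -/
def genBarPerm (F : Type*) [Field F] {n : ℕ} (w : Equiv.Perm (Fin n)) : ZeroHecke F n :=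
  ((reducedWord w).map (genBar F)).prod

/-- The parabolic subgroup generated by the adjacent transpositions in `I`. -/
def parabolic {n : ℕ} (I : Set (Fin (n - 1))) : Subgroup (Equiv.Perm (Fin n)) :=
  Subgroup.closure (adj '' I)

theorem exists_longest {n : ℕ} (I : Set (Fin (n - 1))) :
    ∃ w ∈ parabolic I, ∀ v ∈ parabolic I, length v ≤ length w := by
  obtain ⟨w, hw⟩ := Finite.exists_max fun w : parabolic I => length (w : Equiv.Perm (Fin n))
  exact ⟨w, w.2, fun v hv => hw ⟨v, hv⟩⟩

/-- `w_0(I)`, the longest element of the parabolic subgroup generated by `I`. -/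
def longest {n : ℕ} (I : Set (Fin (n - 1))) : Equiv.Perm (Fin n) := (exists_longest I).choose

/-- `P_{I,J} = H_n(0) π̄_{w_0(I)} π_{w_0(J \ I)}`, a left ideal of `H_n(0)`. -/
def PIJ (F : Type*) [Field F] {n : ℕ} (I J : Set (Fin (n - 1))) :
    Submodule (ZeroHecke F n) (ZeroHecke F n) :=
  Submodule.span (ZeroHecke F n) {genBarPerm F (longest I) * genPerm F (longest (J \ I))}

/-- `P_I = H_n(0) π̄_{w_0(I)} π_{w_0(Iᶜ)}`, a left ideal of `H_n(0)`. -/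
def PI (F : Type*) [Field F] {n : ℕ} (I : Set (Fin (n - 1))) :
    Submodule (ZeroHecke F n) (ZeroHecke F n) :=
  Submodule.span (ZeroHecke F n) {genBarPerm F (longest I) * genPerm F (longest Iᶜ)}

/-- A module is indecomposable if it is nonzero and is not the direct sum of two nonzero
submodules. -/
def IsIndecomposable (A M : Type*) [Ring A] [AddCommGroup M] [Module A M] : Prop :=
  Nontrivial M ∧ ∀ L N : Submodule A M, IsCompl L N → L = ⊥ ∨ N = ⊥

/-! ### Diagrams and standard tableaux -/

/-- A diagram with `n` boxes, listed in reading order; rows are numbered from bottom to top and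
columns from left to right. -/
structure Diagram (n : ℕ) where
  row : Fin n → ℤ
  col : Fin n → ℤ

/-- A standard tableau: a filling of the boxes with `n` distinct entries from `Fin n` such that
rows increase from left to right and columns increase from top to bottom. -/
structure StdTableau {n : ℕ} (D : Diagram n) where
  /-- the entry in each box; read along the list of boxes, this is the reading word -/
  entry : Equiv.Perm (Fin n)
  row_incr : ∀ p q, D.row p = D.row q → D.col p < D.col q → entry p < entry q
  col_incr : ∀ p q, D.col p = D.col q → D.row q < D.row p → entry p < entry q

namespace StdTableau

variable {n : ℕ} {D : Diagram n}

theorem ext' {τ σ : StdTableau D} (h : τ.entry = σ.entry) : τ = σ := by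
  cases τ; cases σ; cases h; rfl

/-- The row of the box that contains the entry `v`. -/
def rowOf (τ : StdTableau D) (v : Fin n) : ℤ := D.row (τ.entry.symm v)

/-- `s_i(τ)`, obtained by exchanging the entries `i` and `i + 1`, where `i` is in a lower row than
`i + 1`. -/
def swapLT (τ : StdTableau D) (i : Fin (n - 1)) (h : τ.rowOf (lo i) < τ.rowOf (hi i)) :
    StdTableau D where
  entry := adj i * τ.entry
  row_incr p q h1 h2 := by
    have h3 := τ.row_incr p q h1 h2
    by_cases hp : τ.entry p = lo i
    · by_cases hq : τ.entry q = hi i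
      · rw [rowOf, rowOf, ← hp, ← hq] at h
        simp at h; omega
      · have hq' : τ.entry q ≠ lo i := fun h => by rw [hp, h] at h3; exact lt_irrefl _ h3
        simp only [adj, Equiv.Perm.mul_apply, hp, Equiv.swap_apply_left,
          Equiv.swap_apply_of_ne_of_ne hq' hq]
        rw [hp] at h3
        simp only [lo, hi, Fin.lt_def, ne_eq, Fin.ext_iff] at *
        omega
    · by_cases hp2 : τ.entry p = hi i
      · have hq1 : τ.entry q ≠ lo i := fun h => by
          rw [hp2, h] at h3; simp only [lo, hi, Fin.lt_def] at h3; omega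
        have hq2 : τ.entry q ≠ hi i := fun h => by rw [hp2, h] at h3; exact lt_irrefl _ h3
        simp only [adj, Equiv.Perm.mul_apply, hp2, Equiv.swap_apply_right,
          Equiv.swap_apply_of_ne_of_ne hq1 hq2]
        rw [hp2] at h3
        simp only [lo, hi, Fin.lt_def, ne_eq, Fin.ext_iff] at *
        omega
      · simp only [adj, Equiv.Perm.mul_apply, Equiv.swap_apply_of_ne_of_ne hp hp2]
        rw [Equiv.swap_apply_def]
        split_ifs <;> simp only [lo, hi, Fin.lt_def, Fin.ext_iff] at * <;> omega
  col_incr p q h1 h2 := by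
    have h3 := τ.col_incr p q h1 h2
    by_cases hp : τ.entry p = lo i
    · by_cases hq : τ.entry q = hi i
      · rw [rowOf, rowOf, ← hp, ← hq] at h
        simp at h; omega
      · have hq' : τ.entry q ≠ lo i := fun h => by rw [hp, h] at h3; exact lt_irrefl _ h3
        simp only [adj, Equiv.Perm.mul_apply, hp, Equiv.swap_apply_left,
          Equiv.swap_apply_of_ne_of_ne hq' hq]
        rw [hp] at h3
        simp only [lo, hi, Fin.lt_def, ne_eq, Fin.ext_iff] at *
        omega
    · by_cases hp2 : τ.entry p = hi i
      · have hq1 : τ.entry q ≠ lo i := fun h => by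
          rw [hp2, h] at h3; simp only [lo, hi, Fin.lt_def] at h3; omega
        have hq2 : τ.entry q ≠ hi i := fun h => by rw [hp2, h] at h3; exact lt_irrefl _ h3
        simp only [adj, Equiv.Perm.mul_apply, hp2, Equiv.swap_apply_right,
          Equiv.swap_apply_of_ne_of_ne hq1 hq2]
        rw [hp2] at h3
        simp only [lo, hi, Fin.lt_def, ne_eq, Fin.ext_iff] at *
        omega
      · simp only [adj, Equiv.Perm.mul_apply, Equiv.swap_apply_of_ne_of_ne hp hp2]
        rw [Equiv.swap_apply_def]
        split_ifs <;> simp only [lo, hi, Fin.lt_def, Fin.ext_iff] at * <;> omega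

theorem rowOf_swapLT (τ : StdTableau D) (i : Fin (n - 1)) (h) (v : Fin n) :
    (τ.swapLT i h).rowOf v = τ.rowOf (adj i v) := by
  simp only [rowOf, swapLT, adj]
  congr 1

end StdTableau

/-- `P_D`, the vector space with basis the standard tableaux of shape `D`. -/
def TabSpan (F : Type*) [Field F] {n : ℕ} (D : Diagram n) : Type _ := StdTableau D →₀ F

variable (F : Type*) [Field F] {n : ℕ} (D : Diagram n)

instance : AddCommGroup (TabSpan F D) := inferInstanceAs (AddCommGroup (StdTableau D →₀ F))

instance : Module F (TabSpan F D) := inferInstanceAs (Module F (StdTableau D →₀ F))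

/-- The standard tableau `τ` as a basis vector. -/
def tab {D : Diagram n} (τ : StdTableau D) : TabSpan F D := Finsupp.single τ (1 : F)

/-- The value of `π̄_i` on a standard tableau. -/
def barVal {D : Diagram n} (i : Fin (n - 1)) (τ : StdTableau D) : TabSpan F D :=
  if τ.rowOf (hi i) < τ.rowOf (lo i) then -tab F τ
  else if h : τ.rowOf (lo i) < τ.rowOf (hi i) then tab F (τ.swapLT i h)
  else 0

/-- The linear operator `π̄_i` on the span of the standard tableaux. -/
def barOp (i : Fin (n - 1)) : Module.End F (TabSpan F D) :=
  Finsupp.linearCombination F (barVal F i : StdTableau D → TabSpan F D)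

variable {D}

theorem barOp_tab (i : Fin (n - 1)) (τ : StdTableau D) : barOp F D i (tab F τ) = barVal F i τ := by
  simp only [barOp, tab]
  exact (Finsupp.linearCombination_single F (1 : F) τ).trans (one_smul F _)

theorem barOp_gt (i : Fin (n - 1)) (τ : StdTableau D) (h : τ.rowOf (hi i) < τ.rowOf (lo i)) :
    barOp F D i (tab F τ) = -tab F τ := by
  rw [barOp_tab, barVal, if_pos h]

theorem barOp_eq (i : Fin (n - 1)) (τ : StdTableau D) (h : τ.rowOf (lo i) = τ.rowOf (hi i)) :
    barOp F D i (tab F τ) = 0 := by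
  rw [barOp_tab, barVal, if_neg (by omega), dif_neg (by omega)]

theorem barOp_lt (i : Fin (n - 1)) (τ : StdTableau D) (h : τ.rowOf (lo i) < τ.rowOf (hi i)) :
    barOp F D i (tab F τ) = tab F (τ.swapLT i h) := by
  rw [barOp_tab, barVal, if_neg (by omega), dif_pos h]

theorem end_ext {f g : Module.End F (TabSpan F D)}
    (h : ∀ τ : StdTableau D, f (tab F τ) = g (tab F τ)) : f = g :=
  Finsupp.lhom_ext' fun τ => LinearMap.ext_ring (h τ)

theorem adj_lo (i : Fin (n - 1)) : adj i (lo i) = hi i := Equiv.swap_apply_left _ _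

theorem adj_hi (i : Fin (n - 1)) : adj i (hi i) = lo i := Equiv.swap_apply_right _ _

theorem adj_ne (i : Fin (n - 1)) (v : Fin n) (h1 : (v : ℕ) ≠ i) (h2 : (v : ℕ) ≠ i + 1) :
    adj i v = v :=
  Equiv.swap_apply_of_ne_of_ne (fun h => h1 (by rw [h]; rfl)) (fun h => h2 (by rw [h]; rfl))

theorem barOp_sq (i : Fin (n - 1)) : barOp F D i * barOp F D i = -barOp F D i := by
  apply end_ext
  intro τ
  rw [Module.End.mul_apply, LinearMap.neg_apply]
  rcases lt_trichotomy (τ.rowOf (lo i)) (τ.rowOf (hi i)) with h | h | h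
  · rw [barOp_lt F i τ h, barOp_gt]
    simpa [StdTableau.rowOf_swapLT, adj_lo, adj_hi] using h
  · rw [barOp_eq F i τ h, map_zero, neg_zero]
  · rw [barOp_gt F i τ h, map_neg, barOp_gt F i τ h]

theorem barOp_comm (i j : Fin (n - 1)) (hij : (i : ℕ) + 1 < j) :
    barOp F D i * barOp F D j = barOp F D j * barOp F D i := by
  apply end_ext
  intro τ
  have e1 : adj i (lo j) = lo j := adj_ne _ _ (by simp [lo]; omega) (by simp [lo]; omega)
  have e2 : adj i (hi j) = hi j := adj_ne _ _ (by simp [hi]; omega) (by simp [hi]; omega)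
  have e3 : adj j (lo i) = lo i := adj_ne _ _ (by simp [lo]; omega) (by simp [lo]; omega)
  have e4 : adj j (hi i) = hi i := adj_ne _ _ (by simp [hi]; omega) (by simp [hi]; omega)
  have hc : adj i * adj j = adj j * adj i := by
    refine (Equiv.Perm.Disjoint.commute fun v => ?_).eq
    by_cases h : (v : ℕ) = i ∨ (v : ℕ) = i + 1
    · right; exact adj_ne _ _ (by omega) (by omega)
    · left; exact adj_ne _ _ (by omega) (by omega)
  rw [Module.End.mul_apply, Module.End.mul_apply]
  rcases lt_trichotomy (τ.rowOf (lo i)) (τ.rowOf (hi i)) with h | h | h <;>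
  rcases lt_trichotomy (τ.rowOf (lo j)) (τ.rowOf (hi j)) with h' | h' | h' <;>
  simp [barOp_lt, barOp_eq, barOp_gt, StdTableau.rowOf_swapLT, e1, e2, e3, e4, h, h']
  congr 1
  apply StdTableau.ext'
  simp only [StdTableau.swapLT, ← mul_assoc, hc]

theorem barOp_braid (i j : Fin (n - 1)) (hij : (i : ℕ) + 1 = j) :
    barOp F D i * barOp F D j * barOp F D i = barOp F D j * barOp F D i * barOp F D j := by
  apply end_ext
  intro τ
  have e0 : lo j = hi i := Fin.ext (by simp [lo, hi]; omega)
  have e2 : adj i (hi j) = hi j := adj_ne _ _ (by simp [hi]; omega) (by simp [hi]; omega)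
  have e3 : adj j (lo i) = lo i := adj_ne _ _ (by simp [lo]; omega) (by simp [lo]; omega)
  have e4 : adj j (hi i) = hi j := by rw [← e0, adj_lo]
  have e5 : adj j (hi j) = hi i := by rw [← e0, adj_hi]
  have hne1 : lo i ≠ hi i := by simp [lo, hi, Fin.ext_iff]
  have hne2 : hi i ≠ hi j := by simp [hi, Fin.ext_iff]; omega
  have hne3 : lo i ≠ hi j := by simp [lo, hi, Fin.ext_iff]; omega
  have hb : adj i * adj j * adj i = adj j * adj i * adj j := by
    ext v
    by_cases h1 : v = lo i
    · subst h1; simp [adj_lo, e2, e3, e4]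
    by_cases h2 : v = hi i
    · subst h2; simp [adj_lo, adj_hi, e2, e3, e4, e5]
    by_cases h3 : v = hi j
    · subst h3; simp [adj_hi, e2, e3, e5]
    have a1 : adj i v = v := Equiv.swap_apply_of_ne_of_ne h1 h2
    have a2 : adj j v = v := Equiv.swap_apply_of_ne_of_ne (e0 ▸ h2) h3
    simp [a1, a2]
  simp only [Module.End.mul_apply]
  rcases lt_trichotomy (τ.rowOf (lo i)) (τ.rowOf (hi i)) with h | h | h <;>
  rcases lt_trichotomy (τ.rowOf (hi i)) (τ.rowOf (hi j)) with h' | h' | h' <;>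
  rcases lt_trichotomy (τ.rowOf (lo i)) (τ.rowOf (hi j)) with h'' | h'' | h'' <;>
  first
  | (exfalso; omega)
  | simp [barOp_lt, barOp_eq, barOp_gt, StdTableau.rowOf_swapLT, e0, e2, e3, e4, e5, adj_lo,
      adj_hi, h, h', h'']
  congr 1
  apply StdTableau.ext'
  simp only [StdTableau.swapLT, ← mul_assoc, hb]

variable (D)

/-- The representation of `H_n(0)` on the span of the standard tableaux of shape `D` in which
`π̄_i` acts by the operator above, that is, `π_i = π̄_i + 1`. -/
def tabRep : ZeroHecke F n →ₐ[F] Module.End F (TabSpan F D) :=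
  liftHecke F (fun i => barOp F D i + 1)
    (fun i => by
      have := barOp_sq F (D := D) i
      rw [add_mul, mul_add, this]; noncomm_ring)
    (fun i j h => by
      have h1 := barOp_sq F (D := D) i
      have h2 := barOp_sq F (D := D) j
      have h3 := barOp_braid F (D := D) i j h
      generalize barOp F D i = a at *
      generalize barOp F D j = b at *
      have e1 : (a + 1) * (b + 1) * (a + 1) = a * b * a + (a * a + a) + a * b + b * a + a + b + 1 := by
        noncomm_ring
      have e2 : (b + 1) * (a + 1) * (b + 1) = b * a * b + (b * b + b) + a * b + b * a + a + b + 1 := by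
        noncomm_ring
      rw [e1, e2, h1, h2, h3]; simp)
    (fun i j h => by
      have h3 := barOp_comm F (D := D) i j h
      simp only [add_mul, mul_add, h3, one_mul, mul_one]; abel)

theorem tabRep_genBar (i : Fin (n - 1)) : tabRep F D (genBar F i) = barOp F D i := by
  simp [genBar, tabRep, liftHecke_gen]

/-- The `H_n(0)`-module structure on the span of the standard tableaux. -/
instance : Module (ZeroHecke F n) (TabSpan F D) := Module.compHom _ (tabRep F D).toRingHom

instance : IsScalarTower F (ZeroHecke F n) (TabSpan F D) where
  smul_assoc c x t := by
    change tabRep F D (c • x) t = c • tabRep F D x t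
    rw [map_smul]; rfl

/-! ### Compositions, ribbons and generalized ribbons -/

/-- The descent set of a sequence of positive integers: its proper nonempty partial sums. -/
def descents (l : List ℕ) : Set ℕ := {d | ∃ j, 1 ≤ j ∧ j < l.length ∧ d = (l.take j).sum}

/-- The generators `s_d` with `d` in the descent set of a sequence of positive integers. -/
def descGens (n : ℕ) (l : List ℕ) : Set (Fin (n - 1)) := {i | (i : ℕ) + 1 ∈ descents l}

/-- The near-concatenation `α ▷ β`, where the last part of `α` is added to the first part of `β`;
the empty sequence is a unit. -/
def near : List ℕ → List ℕ → List ℕ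
  | [], b => b
  | [x], [] => [x]
  | [x], y :: b => (x + y) :: b
  | x :: x' :: a, b => x :: near (x' :: a) b

/-- `α¹ ▷ ⋯ ▷ αᵏ`. -/
def nearProd (L : List (List ℕ)) : List ℕ := L.foldl near []

/-- `[α¹ ⊕ ⋯ ⊕ αᵏ]`, obtained by successively replacing a set `B` by the set of all
`β · αⁱ` and `β ▷ αⁱ` with `β ∈ B`; the first step gives `{α¹}`. -/
def glue (L : List (List ℕ)) : Set (List ℕ) :=
  L.foldl (fun B a => (fun b => b ++ a) '' B ∪ (fun b => near b a) '' B) {[]}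

/-- The ribbon diagram of a composition: the rows, from bottom to top, have lengths
`α_1, …, α_ℓ`, and each row begins in the column in which the row below it ends. -/
def ribbon {n : ℕ} (α : Composition n) : Diagram n where
  row p := (α.index p : ℕ)
  col p := (p : ℤ) - (α.index p : ℕ)

/-- A generalized ribbon `α¹ ⊕ ⋯ ⊕ αᵏ` of size `n`, given by its connected components
`αⁱ ⊨ n_i`. -/
structure GenRibbon (n : ℕ) where
  /-- the composition `(n_1, …, n_k)` of `n` formed by the sizes of the components -/
  sizes : Composition n
  /-- the components -/
  comp : ∀ i : Fin sizes.length, Composition (sizes.blocksFun i)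

namespace GenRibbon

/-- The list `α¹, …, αᵏ`. -/
def parts (α : GenRibbon n) : List (List ℕ) := List.ofFn fun i => (α.comp i).blocks

/-- The concatenation `α¹ ⋯ αᵏ`, whose parts are the lengths of all rows from bottom to top. -/
def rows (α : GenRibbon n) : Composition n where
  blocks := α.parts.flatten
  blocks_pos {m} hm := by
    obtain ⟨l, hl, hm⟩ := List.mem_flatten.1 hm
    obtain ⟨i, rfl⟩ := List.mem_ofFn.1 hl
    exact (α.comp i).blocks_pos hm
  blocks_sum := by
    rw [List.sum_flatten, parts, List.map_ofFn, List.sum_ofFn]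
    simp

/-- The diagram of a generalized ribbon: within a component each row begins in the column in which
the row below it ends, and each new component begins one row above and one column to the right of
the last box of the preceding component. -/
def diagram (α : GenRibbon n) : Diagram n where
  row p := (α.rows.index p : ℕ)
  col p := (p : ℤ) - (α.rows.index p : ℕ) + (α.sizes.index p : ℕ)

/-- `I = {s_i : i ∈ D(α¹ ▷ ⋯ ▷ αᵏ)}`. -/
def setI (α : GenRibbon n) : Set (Fin (n - 1)) := descGens n (nearProd α.parts)

/-- `J = {s_j : j ∈ D(1^{n_1} ▷ ⋯ ▷ 1^{n_k})}`. -/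
def setJ (α : GenRibbon n) : Set (Fin (n - 1)) :=
  descGens n (nearProd (α.sizes.blocks.map fun m => List.replicate m 1))

/-- The compositions of `n` that belong to `[α]`. -/
def Glued (α : GenRibbon n) : Type := {β : Composition n // β.blocks ∈ glue α.parts}

end GenRibbon

/-! ### Induction from `H_{n_1}(0) ⊗ ⋯ ⊗ H_{n_k}(0)` -/

/-- The submodule of `B ⊗_F N` spanned by all `b φ(a) ⊗ x - b ⊗ a x`. -/
def balanced {F A B N : Type*} [Field F] [Ring A] [Algebra F A] [Ring B] [Algebra F B]
    [AddCommGroup N] [Module F N] (φ : A →ₐ[F] B) (ρ : A →ₐ[F] Module.End F N) :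
    Submodule B (B ⊗[F] N) :=
  Submodule.span B {t | ∃ (b : B) (a : A) (x : N), t = (b * φ a) ⊗ₜ[F] x - b ⊗ₜ[F] ρ a x}

/-- The induced module `B ⊗_A N`, where `B` is a right `A`-module through `φ` and `N` is the left
`A`-module given by the representation `ρ`. -/
abbrev Induced {F A B N : Type*} [Field F] [Ring A] [Algebra F A] [Ring B] [Algebra F B]
    [AddCommGroup N] [Module F N] (φ : A →ₐ[F] B) (ρ : A →ₐ[F] Module.End F N) : Type _ :=
  (B ⊗[F] N) ⧸ balanced φ ρ

/-- The position in `Fin (n - 1)` of the `j`-th generator of the `i`-th factor `H_{n_i}(0)`. -/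
def blockGen (ν : Composition n) (i : Fin ν.length) (j : Fin (ν.blocksFun i - 1)) : Fin (n - 1) :=
  ⟨ν.sizeUpTo i + j, by
    have h1 := ν.sizeUpTo_succ' i
    have h2 := ν.sizeUpTo_le (i + 1)
    have h3 := j.2
    omega⟩

/-- The embedding of the `i`-th factor `H_{n_i}(0)` in `H_n(0)`. -/
def blockHom (ν : Composition n) (i : Fin ν.length) :
    ZeroHecke F (ν.blocksFun i) →ₐ[F] ZeroHecke F n :=
  liftHecke F (fun j => gen F (blockGen ν i j)) (fun _ => gen_mul_self F _)
    (fun _ _ h => gen_braid F _ _ (by simp only [blockGen]; omega))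
    (fun _ _ h => gen_comm F _ _ (by simp only [blockGen]; omega))

theorem blockGen_lt (ν : Composition n) {i i' : Fin ν.length} (h : i < i')
    (j : Fin (ν.blocksFun i - 1)) (j' : Fin (ν.blocksFun i' - 1)) :
    (blockGen ν i j : ℕ) + 1 < blockGen ν i' j' := by
  have h1 := ν.sizeUpTo_succ' i
  have h2 : ν.sizeUpTo (i + 1) ≤ ν.sizeUpTo i' := ν.monotone_sizeUpTo h
  have h3 := j.2
  simp only [blockGen]
  omega

theorem blockHom_commute (ν : Composition n) {i i' : Fin ν.length} (h : i ≠ i')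
    (x : ZeroHecke F (ν.blocksFun i)) (y : ZeroHecke F (ν.blocksFun i')) :
    Commute (blockHom F ν i x) (blockHom F ν i' y) := by
  have hg : ∀ j j', Commute (blockHom F ν i (gen F j)) (blockHom F ν i' (gen F j')) := by
    intro j j'
    rw [blockHom, blockHom, liftHecke_gen, liftHecke_gen]
    rcases lt_or_gt_of_ne h with h | h
    · exact gen_comm F _ _ (blockGen_lt ν h j j')
    · exact (gen_comm F _ _ (blockGen_lt ν h j' j)).symm
  have hx : x ∈ Algebra.adjoin F (Set.range (gen F)) := by rw [adjoin_gen]; trivial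
  have hy : y ∈ Algebra.adjoin F (Set.range (gen F)) := by rw [adjoin_gen]; trivial
  induction hx using Algebra.adjoin_induction with
  | algebraMap r => rw [AlgHom.commutes]; exact Algebra.commutes r _
  | add a b _ _ ha hb => rw [map_add]; exact ha.add_left hb
  | mul a b _ _ ha hb => rw [map_mul]; exact ha.mul_left hb
  | mem a ha =>
    obtain ⟨j, rfl⟩ := ha
    induction hy using Algebra.adjoin_induction with
    | algebraMap r => rw [AlgHom.commutes]; exact (Algebra.commutes r _).symm
    | add a b _ _ ha hb => rw [map_add]; exact ha.add_right hb
    | mul a b _ _ ha hb => rw [map_mul]; exact ha.mul_right hb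
    | mem b hb =>
      obtain ⟨j', rfl⟩ := hb
      exact hg j j'

theorem prod_ofFn_mul {R : Type*} [Monoid R] {k : ℕ} (f g : Fin k → R)
    (h : ∀ i j, i ≠ j → Commute (f i) (g j)) :
    (List.ofFn fun i => f i * g i).prod = (List.ofFn f).prod * (List.ofFn g).prod := by
  induction k with
  | zero => simp
  | succ k ih =>
    simp only [List.ofFn_succ, List.prod_cons]
    rw [ih _ _ fun i j hij => h _ _ fun e => hij (Fin.succ_injective _ e)]
    have hc : Commute (List.ofFn fun i : Fin k => f i.succ).prod (g 0) := by
      apply Commute.list_prod_left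
      intro x hx
      obtain ⟨i, rfl⟩ := List.mem_ofFn.1 hx
      exact h _ _ (Fin.succ_ne_zero i)
    calc _ = f 0 * (g 0 * (List.ofFn fun i : Fin k => f i.succ).prod) *
          (List.ofFn fun i : Fin k => g i.succ).prod := by simp only [mul_assoc]
      _ = _ := by rw [← hc.eq]; simp only [mul_assoc]

/-- The algebra embedding `H_{n_1}(0) ⊗ ⋯ ⊗ H_{n_k}(0) → H_n(0)` onto the parabolic subalgebra
`H_{n_1, …, n_k}(0)`: a pure tensor `a_1 ⊗ ⋯ ⊗ a_k` goes to the product of the images of the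
`a_i`. -/
def parabolicHom (ν : Composition n) :
    (⨂[F] i : Fin ν.length, ZeroHecke F (ν.blocksFun i)) →ₐ[F] ZeroHecke F n :=
  PiTensorProduct.liftAlgHom
    ((MultilinearMap.mkPiAlgebraFin F ν.length (ZeroHecke F n)).compLinearMap
      fun i => (blockHom F ν i).toLinearMap)
    (by simp [List.ofFn_const])
    (fun x y => by
      simp only [MultilinearMap.compLinearMap_apply, MultilinearMap.mkPiAlgebraFin_apply,
        AlgHom.toLinearMap_apply, Pi.mul_apply, map_mul]
      exact prod_ofFn_mul _ _ fun i j h => blockHom_commute F ν h _ _)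

/-- The outer tensor product of representations. -/
def tensorRep {ι : Type*} {A M : ι → Type*} [∀ i, Ring (A i)] [∀ i, Algebra F (A i)]
    [∀ i, AddCommGroup (M i)] [∀ i, Module F (M i)] (ρ : ∀ i, A i →ₐ[F] Module.End F (M i)) :
    (⨂[F] i, A i) →ₐ[F] Module.End F (⨂[F] i, M i) :=
  PiTensorProduct.liftAlgHom
    ((PiTensorProduct.mapMultilinear F M M).compLinearMap fun i => (ρ i).toLinearMap)
    (by
      refine (congrArg (PiTensorProduct.map (R := F)) (funext fun i => ?_)).trans
        (PiTensorProduct.map_id (R := F) (s := M))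
      exact map_one (ρ i))
    (fun x y => by
      refine (congrArg (PiTensorProduct.map (R := F)) (funext fun i => ?_)).trans
        (PiTensorProduct.map_comp (R := F) (fun i => ρ i (x i)) (fun i => ρ i (y i)))
      exact map_mul (ρ i) _ _)

/-- The `H_n(0)`-module induced from the `H_{n_1, …, n_k}(0)`-module
`P_{α¹} ⊗ ⋯ ⊗ P_{αᵏ}`. -/
abbrev inducedTab (α : GenRibbon n) : Type _ :=
  Induced (parabolicHom F α.sizes) (tensorRep F fun i => tabRep F (ribbon (α.comp i)))

end HeckeTableaux

end

open HeckeTableaux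

noncomputable section

namespace HeckeTableaux

/-! ### Lengths of permutations -/

section Perm

open Finset

variable {n : ℕ}

/-! Reading a tableau along its boxes gives a permutation `w`. If the steps between consecutive
boxes go up for `i ∈ I`, right for `i ∈ J \ I` and northeast for `i ∉ J` (`HasType`), the standard
tableaux are the `w` whose descents inside `J` form the set `I` (`DescIn`). With all other `w` read
as zero, π̄_i sends `w` to `-w` if `i + 1` precedes `i` in `w`, and to s_i w otherwise
(`HasType.genBar_smul_tabOf`). This is left multiplication on the basis π̄_w of H_n(0), so the
theorem becomes a statement about permutations.

Embedding: w ↦ π̄_w π_{w_0(J \ I)} is a module homomorphism, because a length-increasing s_i w can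
stop being standard only as w s_p with p ∈ J \ I, and π̄_p annihilates π_{w_0(J \ I)}. It is
injective, because the image of `w` is π̄_w plus longer terms. The tableau of w_0(I) generates the
module, so the image is P_{I,J} (`HasType.equivPIJ`).

Ribbons (`J` is everything): every proper submodule lies in the kernel of the coordinate of the
tableau w_0(I) (`HasType.coord_source_eq_zero`). Two proper submodules therefore never span, which
gives indecomposability. The same criterion shows that the embedding in H_n(0), followed by the
action on the generator, is bijective. So the embedding splits and the module is projective.

Decomposition: π̄_i either negates a word or never removes a descent from it, so the words whose
descents contain `S` span a submodule. For S ∩ J = I it maps onto the module of the ribbon with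
descent set `S`. By projectivity this surjection splits, and the sections for all `S` together are
triangular with respect to the number of descents (`HasType.nonempty_equiv_directSum`). The elements
of [α] realize each such `S` exactly once (`mem_glue_imp`, `exists_mem_glue`, `descGens_injective`).

Induction: each permutation is u v with `u` increasing along the steps in `J` and `v` in the
parabolic subgroup, a product of symmetric groups. Hence the elements π̄_u ⊗ τ span the induced
module, and they go to distinct tableaux of the generalized ribbon (`GenRibbon.equivInduced`). -/

theorem val_lo (i : Fin (n - 1)) : (lo i : ℕ) = i := rfl

theorem val_hi (i : Fin (n - 1)) : (hi i : ℕ) = i + 1 := rfl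

theorem lo_lt_hi (i : Fin (n - 1)) : lo i < hi i := by
  simp [Fin.lt_def, val_lo, val_hi]

theorem lo_ne_hi (i : Fin (n - 1)) : lo i ≠ hi i := (lo_lt_hi i).ne

theorem adj_mul_self (i : Fin (n - 1)) : adj i * adj i = 1 := Equiv.swap_mul_self _ _

theorem adj_mul_cancel (i : Fin (n - 1)) (w : Equiv.Perm (Fin n)) : adj i * (adj i * w) = w := by
  rw [← mul_assoc, adj_mul_self, one_mul]

theorem mul_adj_cancel (i : Fin (n - 1)) (w : Equiv.Perm (Fin n)) : w * adj i * adj i = w := by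
  rw [mul_assoc, adj_mul_self, mul_one]

theorem adj_inv (i : Fin (n - 1)) : (adj i)⁻¹ = adj i := Equiv.swap_inv _ _

theorem adj_adj (i : Fin (n - 1)) (v : Fin n) : adj i (adj i v) = v :=
  Equiv.swap_apply_self _ _ _

/-- A transitive relation that holds between consecutive elements of `Fin n` holds between all
`p < q`. -/
theorem rel_of_step {P : Fin n → Fin n → Prop} (step : ∀ i : Fin (n - 1), P (lo i) (hi i))
    (trans : ∀ p q r, p < q → q < r → P p q → P q r → P p r) {p q : Fin n} (h : p < q) : P p q := by
  obtain ⟨q, hq⟩ := q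
  induction q with
  | zero => exact absurd h (Nat.not_lt_zero _)
  | succ q ih =>
    have hs := step ⟨q, by omega⟩
    rcases (Nat.lt_succ_iff.1 h).lt_or_eq with h' | h'
    · exact trans p ⟨q, by omega⟩ _ h' (Nat.lt_succ_self q) (ih _ h') hs
    · have : p = lo ⟨q, by omega⟩ := Fin.ext h'
      rw [this]; exact hs

/-- The inversions of a permutation. -/
def inversions (w : Equiv.Perm (Fin n)) : Finset (Fin n × Fin n) :=
  univ.filter fun x => x.1 < x.2 ∧ w x.2 < w x.1

theorem mem_inversions {w : Equiv.Perm (Fin n)} {x : Fin n × Fin n} :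
    x ∈ inversions w ↔ x.1 < x.2 ∧ w x.2 < w x.1 := by
  rw [inversions, Finset.mem_filter]
  exact ⟨fun h => h.2, fun h => ⟨mem_univ _, h⟩⟩

theorem adj_lt_adj (i : Fin (n - 1)) {a b : Fin n} (h : a < b) (h' : ¬ (a = lo i ∧ b = hi i)) :
    adj i a < adj i b := by
  simp only [adj, Equiv.swap_apply_def]
  split_ifs <;> simp only [lo, hi, Fin.lt_def, Fin.ext_iff] at * <;> omega

/-- Multiplication by s_i on the right creates the inversion (i, i + 1). Applying s_i to both
positions matches the remaining inversions with those of `w`. -/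
theorem card_inversions_mul_adj {w : Equiv.Perm (Fin n)} {i : Fin (n - 1)}
    (h : w (lo i) < w (hi i)) : (inversions (w * adj i)).card = (inversions w).card + 1 := by
  have hmem : (lo i, hi i) ∈ inversions (w * adj i) := by
    simp [mem_inversions, lo_lt_hi, adj_lo, adj_hi, h]
  rw [← Finset.card_erase_add_one hmem]
  congr 1
  refine Finset.card_nbij' (fun x => (adj i x.1, adj i x.2)) (fun x => (adj i x.1, adj i x.2))
    ?_ ?_ ?_ ?_
  · rintro ⟨a, b⟩ hx
    simp only [mem_coe, mem_erase, mem_inversions, ne_eq, Prod.mk.injEq,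
      Equiv.Perm.mul_apply] at hx ⊢
    exact ⟨adj_lt_adj i hx.2.1 hx.1, hx.2.2⟩
  · rintro ⟨a, b⟩ hx
    simp only [mem_coe, mem_erase, mem_inversions, ne_eq, Prod.mk.injEq,
      Equiv.Perm.mul_apply, adj_adj] at hx ⊢
    have hne : ¬ (a = lo i ∧ b = hi i) := by
      rintro ⟨rfl, rfl⟩; exact absurd hx.2 (not_lt.2 h.le)
    refine ⟨?_, adj_lt_adj i hx.1 hne, hx.2⟩
    rintro ⟨h1, h2⟩
    have h1' : a = hi i := by rw [← adj_adj i a, h1, adj_lo]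
    have h2' : b = lo i := by rw [← adj_adj i b, h2, adj_hi]
    rw [h1', h2'] at hx
    exact absurd hx.1 (not_lt.2 (lo_lt_hi i).le)
  · rintro ⟨a, b⟩ _; simp [adj_adj]
  · rintro ⟨a, b⟩ _; simp [adj_adj]

theorem apply_lt_or_gt (w : Equiv.Perm (Fin n)) (i : Fin (n - 1)) :
    w (lo i) < w (hi i) ∨ w (hi i) < w (lo i) :=
  lt_or_gt_of_ne (w.injective.ne (lo_ne_hi i))

theorem card_inversions_mul_adj_of_gt {w : Equiv.Perm (Fin n)} {i : Fin (n - 1)}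
    (h : w (hi i) < w (lo i)) : (inversions (w * adj i)).card + 1 = (inversions w).card := by
  have := card_inversions_mul_adj (w := w * adj i) (i := i) (by simpa [adj_lo, adj_hi] using h)
  rw [mul_adj_cancel] at this
  exact this.symm

theorem eq_one_of_ascents {w : Equiv.Perm (Fin n)} (h : ∀ i, w (lo i) < w (hi i)) : w = 1 := by
  have hm : StrictMono w := fun a b hab =>
    rel_of_step (P := fun a b => w a < w b) h (fun _ _ _ _ _ => lt_trans) hab
  have h2 := Subsingleton.elim (StrictMono.orderIsoOfSurjective w hm w.surjective) (OrderIso.refl _)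
  ext x
  have := congrArg (fun e : Fin n ≃o Fin n => (e x : ℕ)) h2
  simpa using this

theorem exists_descent {w : Equiv.Perm (Fin n)} (h : w ≠ 1) : ∃ i, w (hi i) < w (lo i) := by
  by_contra! hc
  exact h (eq_one_of_ascents fun i => (apply_lt_or_gt w i).resolve_right (not_lt.2 (hc i)))

theorem wordProd_nil : wordProd ([] : List (Fin (n - 1))) = 1 := rfl

theorem wordProd_cons (i : Fin (n - 1)) (l : List (Fin (n - 1))) :
    wordProd (i :: l) = adj i * wordProd l := by simp [wordProd]

theorem wordProd_append (l l' : List (Fin (n - 1))) :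
    wordProd (l ++ l') = wordProd l * wordProd l' := by simp [wordProd]

theorem wordProd_reverse (l : List (Fin (n - 1))) : wordProd l.reverse = (wordProd l)⁻¹ := by
  induction l with
  | nil => simp [wordProd]
  | cons a l ih =>
    rw [List.reverse_cons, wordProd_append, ih, wordProd_cons, wordProd_cons, wordProd_nil,
      mul_inv_rev, adj_inv, mul_one]

theorem length_le (l : List (Fin (n - 1))) : length (wordProd l) ≤ l.length :=
  Nat.sInf_le ⟨l, rfl, rfl⟩

theorem card_inversions_wordProd_le (l : List (Fin (n - 1))) :
    (inversions (wordProd l)).card ≤ l.length := by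
  induction l using List.reverseRecOn with
  | nil =>
    simp only [List.length_nil, Nat.le_zero, Finset.card_eq_zero, inversions, wordProd_nil]
    exact Finset.filter_eq_empty_iff.2 fun x _ h => lt_asymm h.1 h.2
  | append_singleton l a ih =>
    rw [wordProd_append, wordProd_cons, wordProd_nil, mul_one, List.length_append]
    rcases apply_lt_or_gt (wordProd l) a with h | h
    · rw [card_inversions_mul_adj h]; simpa using ih
    · have := card_inversions_mul_adj_of_gt h
      simp only [List.length_cons, List.length_nil]; omega

/-- A permutation other than 1 has a descent, and removing it costs exactly one inversion. So
sorting by adjacent transpositions yields a word with as many letters as there are inversions. -/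
theorem exists_word_card_inversions (w : Equiv.Perm (Fin n)) :
    ∃ l, wordProd l = w ∧ l.length = (inversions w).card := by
  induction h : (inversions w).card generalizing w with
  | zero =>
    refine ⟨[], ?_, rfl⟩
    by_contra hw
    obtain ⟨i, hi⟩ := exists_descent (w := w) (fun h => hw h.symm)
    have := card_inversions_mul_adj_of_gt hi
    omega
  | succ k ih =>
    have hw : w ≠ 1 := by
      rintro rfl
      have := card_inversions_wordProd_le ([] : List (Fin (n - 1)))
      rw [wordProd_nil, h] at this
      simp at this
    obtain ⟨i, hi⟩ := exists_descent hw
    have := card_inversions_mul_adj_of_gt hi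
    obtain ⟨l, hl, hl'⟩ := ih (w * adj i) (by omega)
    refine ⟨l ++ [i], ?_, by simp [hl']⟩
    rw [wordProd_append, hl, wordProd_cons, wordProd_nil, mul_one, mul_adj_cancel]

theorem length_eq_card_inversions (w : Equiv.Perm (Fin n)) : length w = (inversions w).card := by
  apply le_antisymm
  · obtain ⟨l, hl, hl'⟩ := exists_word_card_inversions w
    rw [← hl', ← hl]; exact length_le l
  · obtain ⟨l, hl, hl'⟩ := exists_reducedWord w
    rw [← hl', ← hl]; exact card_inversions_wordProd_le l

theorem length_mul_adj {w : Equiv.Perm (Fin n)} {i : Fin (n - 1)} (h : w (lo i) < w (hi i)) :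
    length (w * adj i) = length w + 1 := by
  rw [length_eq_card_inversions, length_eq_card_inversions, card_inversions_mul_adj h]

theorem length_mul_adj_of_gt {w : Equiv.Perm (Fin n)} {i : Fin (n - 1)}
    (h : w (hi i) < w (lo i)) : length (w * adj i) + 1 = length w := by
  rw [length_eq_card_inversions, length_eq_card_inversions, card_inversions_mul_adj_of_gt h]

theorem length_inv_le (w : Equiv.Perm (Fin n)) : length w⁻¹ ≤ length w := by
  obtain ⟨l, hl, hl'⟩ := exists_reducedWord w
  rw [← hl', ← hl, ← wordProd_reverse, ← List.length_reverse]
  exact length_le _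

theorem length_inv (w : Equiv.Perm (Fin n)) : length w⁻¹ = length w :=
  le_antisymm (length_inv_le w) (by simpa using length_inv_le w⁻¹)

theorem length_adj_mul {w : Equiv.Perm (Fin n)} {i : Fin (n - 1)}
    (h : w⁻¹ (lo i) < w⁻¹ (hi i)) : length (adj i * w) = length w + 1 := by
  rw [← length_inv, mul_inv_rev, adj_inv, length_mul_adj h, length_inv]

theorem length_adj_mul_of_gt {w : Equiv.Perm (Fin n)} {i : Fin (n - 1)}
    (h : w⁻¹ (hi i) < w⁻¹ (lo i)) : length (adj i * w) + 1 = length w := by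
  rw [← length_inv, mul_inv_rev, adj_inv, length_mul_adj_of_gt h, length_inv]

theorem length_one : length (1 : Equiv.Perm (Fin n)) = 0 :=
  Nat.le_zero.1 (length_le ([] : List (Fin (n - 1))))

theorem eq_one_of_length {w : Equiv.Perm (Fin n)} (h : length w = 0) : w = 1 := by
  obtain ⟨l, hl, hl'⟩ := exists_reducedWord w
  rw [h, List.length_eq_zero_iff] at hl'
  rw [← hl, hl', wordProd_nil]

/-! ### Reduced words -/

/-- A word is reduced if no shorter word expresses the same permutation. -/
def Reduced (l : List (Fin (n - 1))) : Prop := l.length = length (wordProd l)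

/-- Left multiplication by s_i changes the length by exactly one. In a reduced word the change must
be an increase at each letter, so the first letter is a left descent of the product. -/
theorem Reduced.tail {i : Fin (n - 1)} {l : List (Fin (n - 1))} (h : Reduced (i :: l)) :
    Reduced l ∧ (wordProd (i :: l))⁻¹ (hi i) < (wordProd (i :: l))⁻¹ (lo i) := by
  have h1 := length_le l
  rw [Reduced, List.length_cons] at h
  rw [Reduced]
  rcases apply_lt_or_gt (wordProd (i :: l))⁻¹ i with h' | h'
  · have := length_adj_mul h'
    rw [wordProd_cons, adj_mul_cancel] at this
    rw [wordProd_cons] at h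
    omega
  · have := length_adj_mul_of_gt h'
    rw [wordProd_cons, adj_mul_cancel] at this
    rw [wordProd_cons] at h
    exact ⟨by omega, h'⟩

theorem Reduced.init {i : Fin (n - 1)} {l : List (Fin (n - 1))} (h : Reduced (l ++ [i])) :
    Reduced l ∧ (wordProd l) (lo i) < (wordProd l) (hi i) := by
  have h1 := length_le l
  rw [Reduced, List.length_append, wordProd_append, wordProd_cons, wordProd_nil, mul_one,
    List.length_singleton] at h
  rw [Reduced]
  rcases apply_lt_or_gt (wordProd l) i with h' | h'
  · have := length_mul_adj h'
    exact ⟨by omega, h'⟩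
  · have := length_mul_adj_of_gt h'
    omega

theorem Reduced.cons {i : Fin (n - 1)} {l : List (Fin (n - 1))} (h : Reduced l)
    (h' : (wordProd l)⁻¹ (lo i) < (wordProd l)⁻¹ (hi i)) : Reduced (i :: l) := by
  rw [Reduced, List.length_cons, wordProd_cons, length_adj_mul h', h]

theorem Reduced.concat {i : Fin (n - 1)} {l : List (Fin (n - 1))} (h : Reduced l)
    (h' : wordProd l (lo i) < wordProd l (hi i)) : Reduced (l ++ [i]) := by
  rw [Reduced, List.length_append, wordProd_append, wordProd_cons, wordProd_nil, mul_one,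
    length_mul_adj h', h]; rfl

theorem wordProd_reducedWord (w : Equiv.Perm (Fin n)) : wordProd (reducedWord w) = w :=
  (exists_reducedWord w).choose_spec.1

theorem reduced_reducedWord (w : Equiv.Perm (Fin n)) : Reduced (reducedWord w) := by
  rw [Reduced, wordProd_reducedWord]; exact (exists_reducedWord w).choose_spec.2

/-- Inductive step of Matsumoto's theorem for words with different first letters. Both letters are
left descents of `w`, so `w` also has reduced words that begin with either form of the commutation
or braid relation of `i` and `j`. Each given word shares its first letter with one of these, and
induction compares the tails. -/
theorem prod_eq_of_reduced_aux {M : Type*} [Monoid M] (f : Fin (n - 1) → M)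
    (hb : ∀ i j : Fin (n - 1), (i : ℕ) + 1 = j → f i * f j * f i = f j * f i * f j)
    (hc : ∀ i j : Fin (n - 1), (i : ℕ) + 1 < j → f i * f j = f j * f i) (k : ℕ)
    (ih : ∀ l l' : List (Fin (n - 1)), l.length < k → Reduced l → Reduced l' →
      wordProd l = wordProd l' → (l.map f).prod = (l'.map f).prod)
    (i j : Fin (n - 1)) (m m' : List (Fin (n - 1))) (hk : m.length + 1 = k)
    (hl : Reduced (i :: m)) (hl' : Reduced (j :: m')) (h : wordProd (i :: m) = wordProd (j :: m'))
    (hij : i < j) : ((i :: m).map f).prod = ((j :: m').map f).prod := by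
  obtain ⟨hm, hdi⟩ := hl.tail
  obtain ⟨hm', hdj⟩ := hl'.tail
  rw [← h] at hdj
  have hmk : m'.length + 1 = k := by
    have h1 := hl; have h2 := hl'
    rw [Reduced, List.length_cons] at h1 h2
    rw [h] at h1; omega
  set w := wordProd (i :: m) with hw
  have ei : wordProd m = adj i * w := by rw [hw, wordProd_cons, adj_mul_cancel]
  have ej : wordProd m' = adj j * w := by rw [h, wordProd_cons, adj_mul_cancel]
  rw [List.map_cons, List.map_cons, List.prod_cons, List.prod_cons]
  have hij' : (i : ℕ) < j := hij
  rcases (Nat.succ_le_of_lt hij').lt_or_eq with hij | hij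
  · have e3 : adj j (lo i) = lo i := adj_ne _ _ (by simp [lo]; omega) (by simp [lo]; omega)
    have e4 : adj j (hi i) = hi i := adj_ne _ _ (by simp [hi]; omega) (by simp [hi]; omega)
    have e1 : adj i (lo j) = lo j := adj_ne _ _ (by simp [lo]; omega) (by simp [lo]; omega)
    have e2 : adj i (hi j) = hi j := adj_ne _ _ (by simp [hi]; omega) (by simp [hi]; omega)
    have hcomm : adj i * adj j = adj j * adj i := by
      refine (Equiv.Perm.Disjoint.commute fun v => ?_).eq
      by_cases h : (v : ℕ) = i ∨ (v : ℕ) = i + 1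
      · right; exact adj_ne _ _ (by omega) (by omega)
      · left; exact adj_ne _ _ (by omega) (by omega)
    set r := reducedWord (adj j * (adj i * w)) with hr
    have er : wordProd r = adj j * (adj i * w) := wordProd_reducedWord _
    have er' : wordProd r = adj i * (adj j * w) := by
      rw [er, ← mul_assoc, ← hcomm, mul_assoc]
    have hrr : Reduced r := reduced_reducedWord _
    have a1 : ((m).map f).prod = ((j :: r).map f).prod := by
      refine ih _ _ (by omega) hm (hrr.cons ?_) ?_
      · rw [er]; simpa [adj_inv, adj_lo, adj_hi, e1, e2] using hdj
      · rw [wordProd_cons, er, adj_mul_cancel, ei]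
    have a2 : ((m').map f).prod = ((i :: r).map f).prod := by
      refine ih _ _ (by omega) hm' (hrr.cons ?_) ?_
      · rw [er']; simpa [adj_inv, adj_lo, adj_hi, e3, e4] using hdi
      · rw [wordProd_cons, er', adj_mul_cancel, ej]
    rw [a1, a2, List.map_cons, List.map_cons, List.prod_cons, List.prod_cons, ← mul_assoc,
      ← mul_assoc, hc i j hij]
  · have hij : (i : ℕ) + 1 = j := hij
    have e0 : lo j = hi i := Fin.ext (by simp [lo, hi]; omega)
    have e2 : adj i (hi j) = hi j := adj_ne _ _ (by simp [hi]; omega) (by simp [hi]; omega)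
    have e3 : adj j (lo i) = lo i := adj_ne _ _ (by simp [lo]; omega) (by simp [lo]; omega)
    have e4 : adj j (hi i) = hi j := by rw [← e0, adj_lo]
    have e5 : adj j (hi j) = hi i := by rw [← e0, adj_hi]
    have hbr : adj i * (adj j * (adj i * w)) = adj j * (adj i * (adj j * w)) := by
      ext v
      simp only [Equiv.Perm.mul_apply]
      generalize w v = v
      congr 1
      by_cases h1 : v = lo i
      · subst h1; simp [adj_lo, e2, e3, e4]
      by_cases h2 : v = hi i
      · subst h2; simp [adj_lo, adj_hi, e2, e3, e4, e5]
      by_cases h3 : v = hi j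
      · subst h3; simp [adj_hi, e2, e3, e5]
      have a1 : adj i v = v := Equiv.swap_apply_of_ne_of_ne h1 h2
      have a2 : adj j v = v := Equiv.swap_apply_of_ne_of_ne (e0 ▸ h2) h3
      simp [a1, a2]
    rw [e0] at hdj
    -- The values i, i + 1, i + 2 occur in `w` in decreasing order of value, so the longest element
    -- of the group generated by s_i and s_j splits off on the left and leaves `r`.
    set r := reducedWord (adj i * (adj j * (adj i * w))) with hr
    have er : wordProd r = adj i * (adj j * (adj i * w)) := wordProd_reducedWord _
    have er' : wordProd r = adj j * (adj i * (adj j * w)) := by rw [er, hbr]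
    have hrr : Reduced r := reduced_reducedWord _
    have a1 : ((m).map f).prod = ((j :: i :: r).map f).prod := by
      refine ih _ _ (by omega) hm ((hrr.cons ?_).cons ?_) ?_
      · rw [er]; simpa [adj_inv, adj_lo, adj_hi, e2, e3, e4, e5] using hdj
      · rw [wordProd_cons, er, adj_mul_cancel]
        simpa [adj_inv, adj_lo, adj_hi, e0, e2, e3, e4, e5] using hdj.trans hdi
      · rw [wordProd_cons, wordProd_cons, er, adj_mul_cancel, adj_mul_cancel, ei]
    have a2 : ((m').map f).prod = ((i :: j :: r).map f).prod := by
      refine ih _ _ (by omega) hm' ((hrr.cons ?_).cons ?_) ?_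
      · rw [er']; simpa [adj_inv, adj_lo, adj_hi, e0, e2, e3, e4, e5] using hdi
      · rw [wordProd_cons, er', adj_mul_cancel]
        simpa [adj_inv, adj_lo, adj_hi, e0, e2, e3, e4, e5] using hdj.trans hdi
      · rw [wordProd_cons, wordProd_cons, er', adj_mul_cancel, adj_mul_cancel, ej]
    rw [a1, a2]
    simp only [List.map_cons, List.prod_cons, ← mul_assoc]
    rw [hb i j hij]

/-- Matsumoto's theorem for the symmetric group: the product along a reduced word of a family that
satisfies the braid relations only depends on the permutation. -/
theorem prod_eq_of_reduced {M : Type*} [Monoid M] (f : Fin (n - 1) → M)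
    (hb : ∀ i j : Fin (n - 1), (i : ℕ) + 1 = j → f i * f j * f i = f j * f i * f j)
    (hc : ∀ i j : Fin (n - 1), (i : ℕ) + 1 < j → f i * f j = f j * f i)
    (l l' : List (Fin (n - 1))) (hl : Reduced l) (hl' : Reduced l')
    (h : wordProd l = wordProd l') : (l.map f).prod = (l'.map f).prod := by
  induction hk : l.length using Nat.strong_induction_on generalizing l l' with
  | _ k ih =>
    have ih' : ∀ l l' : List (Fin (n - 1)), l.length < k → Reduced l → Reduced l' →
      wordProd l = wordProd l' → (l.map f).prod = (l'.map f).prod :=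
        fun l l' h1 h2 h3 h4 => ih _ h1 l l' h2 h3 h4 rfl
    have hlen : l.length = l'.length := by
      have h1 := hl; have h2 := hl'
      rw [Reduced] at h1 h2
      rw [h1, h2, h]
    cases l with
    | nil =>
      rw [List.length_nil] at hlen
      rw [List.length_eq_zero_iff.1 hlen.symm]
    | cons i m =>
      cases l' with
      | nil => simp at hlen
      | cons j m' =>
        rw [List.length_cons] at hk
        rw [List.length_cons, List.length_cons] at hlen
        rcases lt_trichotomy i j with hij | hij | hij
        · exact prod_eq_of_reduced_aux f hb hc k ih' i j m m' hk hl hl' h hij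
        · subst hij
          rw [List.map_cons, List.map_cons, List.prod_cons, List.prod_cons,
            ih' m m' (by omega) hl.tail.1 hl'.tail.1 (by
              rw [wordProd_cons, wordProd_cons] at h; exact mul_left_cancel h)]
        · exact (prod_eq_of_reduced_aux f hb hc k ih' j i m' m (by omega) hl' hl h.symm hij).symm

end Perm

/-! ### Standard tableaux as permutations with prescribed descents -/

section Tableaux

variable {n : ℕ}

/-- A diagram whose boxes, in reading order, form rows, with the step from box `i` to box `i + 1`
going up if `i ∈ I`, to the right if `i ∈ J \ I`, and to the northeast if `i ∉ J`. -/
structure HasType (D : Diagram n) (I J : Set (Fin (n - 1))) : Prop where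
  subset : I ⊆ J
  right : ∀ i ∈ J, i ∉ I → D.row (lo i) = D.row (hi i) ∧ D.col (lo i) < D.col (hi i)
  up : ∀ i ∈ I, D.row (lo i) < D.row (hi i) ∧ D.col (lo i) = D.col (hi i)
  northeast : ∀ i ∉ J, D.row (lo i) < D.row (hi i) ∧ D.col (lo i) < D.col (hi i)

/-- The permutations whose descents in `J` are the elements of `I`. -/
def DescIn (I J : Set (Fin (n - 1))) (w : Equiv.Perm (Fin n)) : Prop :=
  ∀ i ∈ J, (w (hi i) < w (lo i) ↔ i ∈ I)

variable {D : Diagram n} {I J : Set (Fin (n - 1))}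

/-- Rows and columns increase weakly along the reading order, so two boxes in one row (or one
column) have all intermediate boxes in it as well. This lets the conditions on adjacent boxes
propagate, and it makes standardness a condition on descents alone. -/
theorem HasType.rel (h : HasType D I J) {w : Equiv.Perm (Fin n)} (hw : DescIn I J w) {p q : Fin n}
    (hpq : p < q) : (D.row p ≤ D.row q ∧ D.col p ≤ D.col q) ∧
      (D.row p = D.row q → D.col p < D.col q ∧ w p < w q) ∧
      (D.col p = D.col q → D.row p < D.row q ∧ w q < w p) := by
  refine rel_of_step (P := fun p q => (D.row p ≤ D.row q ∧ D.col p ≤ D.col q) ∧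
      (D.row p = D.row q → D.col p < D.col q ∧ w p < w q) ∧
      (D.col p = D.col q → D.row p < D.row q ∧ w q < w p)) (fun i => ?_) ?_ hpq
  · by_cases hJ : i ∈ J
    · by_cases hI : i ∈ I
      · obtain ⟨h1, h2⟩ := h.up i hI
        have := (hw i hJ).2 hI
        exact ⟨⟨h1.le, h2.le⟩, fun h => absurd h h1.ne, fun _ => ⟨h1, this⟩⟩
      · obtain ⟨h1, h2⟩ := h.right i hJ hI
        have := (apply_lt_or_gt w i).resolve_right fun h => hI ((hw i hJ).1 h)
        exact ⟨⟨h1.le, h2.le⟩, fun _ => ⟨h2, this⟩, fun h => absurd h h2.ne⟩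
    · obtain ⟨h1, h2⟩ := h.northeast i hJ
      exact ⟨⟨h1.le, h2.le⟩, fun h => absurd h h1.ne, fun h => absurd h h2.ne⟩
  · rintro p q r - - ⟨⟨a1, a2⟩, a3, a4⟩ ⟨⟨b1, b2⟩, b3, b4⟩
    refine ⟨⟨a1.trans b1, a2.trans b2⟩, fun e => ?_, fun e => ?_⟩
    · obtain ⟨c1, c2⟩ := a3 (by omega)
      obtain ⟨d1, d2⟩ := b3 (by omega)
      exact ⟨c1.trans d1, c2.trans d2⟩
    · obtain ⟨c1, c2⟩ := a4 (by omega)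
      obtain ⟨d1, d2⟩ := b4 (by omega)
      exact ⟨c1.trans d1, d2.trans c2⟩

theorem HasType.descIn (h : HasType D I J) (τ : StdTableau D) : DescIn I J τ.entry := by
  intro i hJ
  by_cases hI : i ∈ I
  · obtain ⟨h1, h2⟩ := h.up i hI
    exact ⟨fun _ => hI, fun _ => τ.col_incr _ _ h2.symm h1⟩
  · obtain ⟨h1, h2⟩ := h.right i hJ hI
    exact ⟨fun h3 => absurd (τ.row_incr _ _ h1 h2) (not_lt.2 h3.le), fun h => absurd h hI⟩

/-- The standard tableau of a permutation with the prescribed descents. -/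
def HasType.tableau (h : HasType D I J) (w : Equiv.Perm (Fin n)) (hw : DescIn I J w) :
    StdTableau D where
  entry := w
  row_incr p q h1 h2 := by
    rcases lt_trichotomy p q with hpq | rfl | hpq
    · exact ((h.rel hw hpq).2.1 h1).2
    · exact absurd h2 (lt_irrefl _)
    · have := (h.rel hw hpq).1; omega
  col_incr p q h1 h2 := by
    rcases lt_trichotomy p q with hpq | rfl | hpq
    · have := (h.rel hw hpq).1; omega
    · exact absurd h2 (lt_irrefl _)
    · exact ((h.rel hw hpq).2.2 h1.symm).2

theorem entry_injective : Function.Injective (StdTableau.entry : StdTableau D → _) :=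
  fun _ _ => StdTableau.ext'

instance : Finite (StdTableau D) := Finite.of_injective _ entry_injective

variable (F : Type*) [Field F]

/-- The basis of standard tableaux. -/
def tabBasis (D : Diagram n) : Module.Basis (StdTableau D) F (TabSpan F D) :=
  Finsupp.basisSingleOne

theorem tabBasis_apply (τ : StdTableau D) : tabBasis F D τ = tab F τ :=
  congrFun Finsupp.coe_basisSingleOne τ

instance : Module.Finite F (TabSpan F D) := Module.Finite.of_basis (tabBasis F D)

open Classical in
/-- The basis vector of a permutation, which is zero if there is no tableau with these entries. -/
def tabOf (D : Diagram n) (w : Equiv.Perm (Fin n)) : TabSpan F D :=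
  if h : ∃ τ : StdTableau D, τ.entry = w then tab F h.choose else 0

theorem tabOf_entry (τ : StdTableau D) : tabOf F D τ.entry = tab F τ := by
  have h : ∃ σ : StdTableau D, σ.entry = τ.entry := ⟨τ, rfl⟩
  rw [tabOf, dif_pos h, StdTableau.ext' h.choose_spec]

/-- The convention that nonstandard words are zero absorbs the zero case of the action. -/
theorem HasType.tabOf_eq_zero (h : HasType D I J) {w : Equiv.Perm (Fin n)} (hw : ¬ DescIn I J w) :
    tabOf F D w = 0 := by
  rw [tabOf, dif_neg]
  rintro ⟨τ, rfl⟩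
  exact hw (h.descIn τ)

theorem HasType.tabOf_eq (h : HasType D I J) {w : Equiv.Perm (Fin n)} (hw : DescIn I J w) :
    tabOf F D w = tab F (h.tableau w hw) :=
  tabOf_entry F (h.tableau w hw)

theorem genBar_smul (i : Fin (n - 1)) (x : TabSpan F D) : genBar F i • x = barOp F D i x := by
  rw [← tabRep_genBar]; rfl

open Classical in
-- If `i` precedes `i + 1`, its row is weakly lower; in case of equality the exchange destroys the
-- increase of that row, so both sides vanish. If `i + 1` precedes `i`, the rows must differ. The
-- three cases of the action thus become two.
theorem HasType.genBar_smul_tabOf (h : HasType D I J) {w : Equiv.Perm (Fin n)} (hw : DescIn I J w)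
    (i : Fin (n - 1)) : genBar F i • tabOf F D w =
      if w⁻¹ (hi i) < w⁻¹ (lo i) then -tabOf F D w else tabOf F D (adj i * w) := by
  have key : ∀ v, (h.tableau w hw).rowOf v = D.row (w⁻¹ v) := fun v => rfl
  rw [genBar_smul, h.tabOf_eq F hw]
  rcases apply_lt_or_gt w⁻¹ i with hlt | hgt
  · rw [if_neg (not_lt.2 hlt.le)]
    have h1 := h.rel hw hlt
    rcases h1.1.1.lt_or_eq with h2 | h2
    · rw [barOp_lt F i (h.tableau w hw) (by rw [key, key]; exact h2)]
      exact (tabOf_entry F ((h.tableau w hw).swapLT i h2)).symm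
    · rw [barOp_eq F i (h.tableau w hw) (by rw [key, key]; exact h2), h.tabOf_eq_zero F]
      intro hw'
      have h3 := ((h.rel hw' hlt).2.1 h2).2
      simp only [Equiv.Perm.mul_apply, Equiv.Perm.coe_inv, Equiv.apply_symm_apply, adj_lo, adj_hi] at h3
      exact absurd h3 (not_lt.2 (lo_lt_hi i).le)
  · rw [if_pos hgt, barOp_gt]
    rw [key, key]
    have h1 := h.rel hw hgt
    refine h1.1.1.lt_of_ne fun h2 => ?_
    have h3 := (h1.2.1 h2).2
    simp only [Equiv.Perm.coe_inv, Equiv.apply_symm_apply] at h3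
    exact absurd h3 (not_lt.2 (lo_lt_hi i).le)

/-- A diagram whose boxes lie in distinct rows and columns. -/
def freeDiagram (n : ℕ) : Diagram n where
  row p := p
  col p := p

theorem hasType_freeDiagram : HasType (freeDiagram n) ∅ ∅ where
  subset := le_rfl
  right _ h := absurd h (Set.notMem_empty _)
  up _ h := absurd h (Set.notMem_empty _)
  northeast i _ := by simp [freeDiagram, val_lo, val_hi]

theorem descIn_empty (I : Set (Fin (n - 1))) (w : Equiv.Perm (Fin n)) : DescIn I ∅ w :=
  fun _ h => absurd h (Set.notMem_empty _)

end Tableaux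

/-! ### The basis `π̄_w` -/

section Basis

variable (F : Type*) [Field F] {n : ℕ}

theorem sub_one_mul_sub_one {R : Type*} [Ring R] {a : R} (h : a * a = a) :
    (a - 1) * (a - 1) = -(a - 1) := by
  rw [sub_mul, mul_sub, h]; noncomm_ring

theorem sub_one_mul_self {R : Type*} [Ring R] {a : R} (h : a * a = a) : (a - 1) * a = 0 := by
  rw [sub_mul, h, one_mul, sub_self]

theorem sub_one_comm {R : Type*} [Ring R] {a b : R} (h : a * b = b * a) :
    (a - 1) * (b - 1) = (b - 1) * (a - 1) := by
  simp only [sub_mul, mul_sub, h]; noncomm_ring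

theorem sub_one_braid {R : Type*} [Ring R] {a b : R} (h1 : a * a = a) (h2 : b * b = b)
    (h3 : a * b * a = b * a * b) :
    (a - 1) * (b - 1) * (a - 1) = (b - 1) * (a - 1) * (b - 1) := by
  have e1 : (a - 1) * (b - 1) * (a - 1) =
      a * b * a - a * b - b * a - (a * a) + a + a + b - 1 := by noncomm_ring
  have e2 : (b - 1) * (a - 1) * (b - 1) =
      b * a * b - a * b - b * a - (b * b) + b + b + a - 1 := by noncomm_ring
  rw [e1, e2, h1, h2, h3]; abel

theorem genBar_mul_self (i : Fin (n - 1)) : genBar F i * genBar F i = (-1 : F) • genBar F i := by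
  exact (sub_one_mul_sub_one (gen_mul_self F i)).trans (neg_one_smul F _).symm

theorem genBar_comm (i j : Fin (n - 1)) (h : (i : ℕ) + 1 < j) :
    genBar F i * genBar F j = genBar F j * genBar F i :=
  sub_one_comm (gen_comm F i j h)

theorem genBar_braid (i j : Fin (n - 1)) (h : (i : ℕ) + 1 = j) :
    genBar F i * genBar F j * genBar F i = genBar F j * genBar F i * genBar F j :=
  sub_one_braid (gen_mul_self F i) (gen_mul_self F j) (gen_braid F i j h)

theorem gen_eq (i : Fin (n - 1)) : gen F i = 1 + genBar F i := by simp [genBar]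

theorem genBar_mul_gen (i : Fin (n - 1)) : genBar F i * gen F i = 0 :=
  sub_one_mul_self (gen_mul_self F i)

theorem genBarPerm_eq {l : List (Fin (n - 1))} (h : Reduced l) :
    genBarPerm F (wordProd l) = (l.map (genBar F)).prod :=
  prod_eq_of_reduced _ (genBar_braid F) (genBar_comm F) _ _ (reduced_reducedWord _) h
    (wordProd_reducedWord _)

theorem genPerm_eq {l : List (Fin (n - 1))} (h : Reduced l) :
    genPerm F (wordProd l) = (l.map (gen F)).prod :=
  prod_eq_of_reduced _ (gen_braid F) (gen_comm F) _ _ (reduced_reducedWord _) h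
    (wordProd_reducedWord _)

theorem genBarPerm_one : genBarPerm F (1 : Equiv.Perm (Fin n)) = 1 :=
  genBarPerm_eq F (l := []) length_one.symm

variable {F} {w : Equiv.Perm (Fin n)} {i : Fin (n - 1)}

theorem genBar_mul_genBarPerm (h : w⁻¹ (lo i) < w⁻¹ (hi i)) :
    genBar F i * genBarPerm F w = genBarPerm F (adj i * w) := by
  have hr := (reduced_reducedWord w).cons (i := i) (by rwa [wordProd_reducedWord])
  have := genBarPerm_eq F hr
  rw [wordProd_cons, wordProd_reducedWord, List.map_cons, List.prod_cons] at this
  exact this.symm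

theorem genBarPerm_mul_genBar (h : w (lo i) < w (hi i)) :
    genBarPerm F w * genBar F i = genBarPerm F (w * adj i) := by
  have hr := (reduced_reducedWord w).concat (i := i) (by rwa [wordProd_reducedWord])
  have := genBarPerm_eq F hr
  rw [wordProd_append, wordProd_cons, wordProd_nil, mul_one, wordProd_reducedWord] at this
  rw [this]; simp [genBarPerm]

theorem gen_mul_genPerm (h : w⁻¹ (lo i) < w⁻¹ (hi i)) :
    gen F i * genPerm F w = genPerm F (adj i * w) := by
  have hr := (reduced_reducedWord w).cons (i := i) (by rwa [wordProd_reducedWord])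
  have := genPerm_eq F hr
  rw [wordProd_cons, wordProd_reducedWord, List.map_cons, List.prod_cons] at this
  exact this.symm

theorem genBar_mul_genBarPerm_of_gt (h : w⁻¹ (hi i) < w⁻¹ (lo i)) :
    genBar F i * genBarPerm F w = (-1 : F) • genBarPerm F w := by
  have := genBar_mul_genBarPerm (F := F) (w := adj i * w) (i := i)
    (by simpa [adj_inv, adj_lo, adj_hi] using h)
  rw [adj_mul_cancel] at this
  rw [← this, ← mul_assoc, genBar_mul_self, smul_mul_assoc]

theorem genBarPerm_mul_genBar_of_gt (h : w (hi i) < w (lo i)) :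
    genBarPerm F w * genBar F i = (-1 : F) • genBarPerm F w := by
  have := genBarPerm_mul_genBar (F := F) (w := w * adj i) (i := i)
    (by simpa [adj_lo, adj_hi] using h)
  rw [mul_adj_cancel] at this
  rw [← this, mul_assoc, genBar_mul_self, mul_smul_comm]

theorem gen_mul_genPerm_of_gt (h : w⁻¹ (hi i) < w⁻¹ (lo i)) :
    gen F i * genPerm F w = genPerm F w := by
  have := gen_mul_genPerm (F := F) (w := adj i * w) (i := i)
    (by simpa [adj_inv, adj_lo, adj_hi] using h)
  rw [adj_mul_cancel] at this
  rw [← this, ← mul_assoc, gen_mul_self]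

variable (F)

theorem genBarPerm_smul_tabOf_one (w : Equiv.Perm (Fin n)) :
    genBarPerm F w • tabOf F (freeDiagram n) 1 = tabOf F (freeDiagram n) w := by
  have : ∀ l : List (Fin (n - 1)), Reduced l → (l.map (genBar F)).prod •
      tabOf F (freeDiagram n) 1 = tabOf F (freeDiagram n) (wordProd l) := by
    intro l hl
    induction l with
    | nil => simp [wordProd_nil]
    | cons i l ih =>
      obtain ⟨h1, h2⟩ := hl.tail
      rw [wordProd_cons, mul_inv_rev, adj_inv, Equiv.Perm.mul_apply, Equiv.Perm.mul_apply, adj_lo,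
        adj_hi] at h2
      rw [List.map_cons, List.prod_cons, mul_smul, ih h1, wordProd_cons,
        hasType_freeDiagram.genBar_smul_tabOf F (descIn_empty _ _), if_neg (not_lt.2 h2.le)]
  have h := this _ (reduced_reducedWord w)
  rwa [wordProd_reducedWord] at h

/-- On the shape without any row or column relation every permutation is a standard tableau. There
π̄_w sends the tableau of 1 to the tableau of `w`, so evaluation at that tableau carries the family
to a basis. -/
theorem linearIndependent_genBarPerm :
    LinearIndependent F (genBarPerm F : Equiv.Perm (Fin n) → ZeroHecke F n) := by
  let f : ZeroHecke F n →ₗ[F] TabSpan F (freeDiagram n) :=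
    { toFun := fun h => h • tabOf F (freeDiagram n) 1
      map_add' := fun a b => add_smul a b _
      map_smul' := fun c a => smul_assoc c a _ }
  apply LinearIndependent.of_comp f
  have h : (f ∘ genBarPerm F) = fun w => tabBasis F (freeDiagram n)
      (hasType_freeDiagram.tableau w (descIn_empty _ _)) := by
    funext w
    rw [tabBasis_apply, ← HasType.tabOf_eq]
    exact genBarPerm_smul_tabOf_one F w
  rw [h]
  refine (tabBasis F (freeDiagram n)).linearIndependent.comp (fun w => _) ?_
  intro w w' hw
  exact congrArg StdTableau.entry hw

/-- A subspace that is stable under the operators `π̄_i` is a submodule. -/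
theorem smul_mem_of_genBar {M : Type*} [AddCommGroup M] [Module F M] [Module (ZeroHecke F n) M]
    [IsScalarTower F (ZeroHecke F n) M] (V : Submodule F M)
    (hV : ∀ i : Fin (n - 1), ∀ x ∈ V, genBar F i • x ∈ V) (h : ZeroHecke F n) :
    ∀ x ∈ V, h • x ∈ V := by
  have hh : h ∈ Algebra.adjoin F (Set.range (gen F)) := by rw [adjoin_gen]; trivial
  induction hh using Algebra.adjoin_induction with
  | algebraMap r => intro x hx; rw [algebraMap_smul]; exact V.smul_mem r hx
  | add a b _ _ ha hb => intro x hx; rw [add_smul]; exact V.add_mem (ha x hx) (hb x hx)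
  | mul a b _ _ ha hb => intro x hx; rw [mul_smul]; exact ha _ (hb x hx)
  | mem a ha =>
    obtain ⟨i, rfl⟩ := ha
    intro x hx
    rw [gen_eq, add_smul, one_smul]
    exact V.add_mem hx (hV i x hx)

theorem span_genBarPerm :
    Submodule.span F (Set.range (genBarPerm F : Equiv.Perm (Fin n) → ZeroHecke F n)) = ⊤ := by
  rw [eq_top_iff]
  intro h _
  rw [← mul_one h, ← smul_eq_mul]
  -- The span contains 1 and is stable under left multiplication by every π̄_i, so it contains h ·
  -- 1.
  refine smul_mem_of_genBar F _ (fun i x hx => ?_) h 1 ?_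
  · induction hx using Submodule.span_induction with
    | zero => rw [smul_zero]; exact Submodule.zero_mem _
    | add x y _ _ hx hy => rw [smul_add]; exact Submodule.add_mem _ hx hy
    | smul c x _ hx =>
      rw [smul_eq_mul, mul_smul_comm]; exact Submodule.smul_mem _ c hx
    | mem x hx =>
      obtain ⟨w, rfl⟩ := hx
      rw [smul_eq_mul]
      rcases apply_lt_or_gt w⁻¹ i with hlt | hgt
      · rw [genBar_mul_genBarPerm hlt]; exact Submodule.subset_span ⟨_, rfl⟩
      · rw [genBar_mul_genBarPerm_of_gt hgt]
        exact Submodule.smul_mem _ _ (Submodule.subset_span ⟨_, rfl⟩)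
  · rw [← genBarPerm_one]; exact Submodule.subset_span ⟨_, rfl⟩

/-- The basis of the elements `π̄_w`. -/
def heckeBasis : Module.Basis (Equiv.Perm (Fin n)) F (ZeroHecke F n) :=
  Module.Basis.mk (linearIndependent_genBarPerm F) (span_genBarPerm F).ge

theorem heckeBasis_apply (w : Equiv.Perm (Fin n)) : heckeBasis F w = genBarPerm F w := by
  simp [heckeBasis]

end Basis

/-! ### Parabolic subgroups -/

section Parabolic

variable {n : ℕ} {I J K : Set (Fin (n - 1))} {w : Equiv.Perm (Fin n)}

theorem parabolic_mono (h : I ⊆ J) : (parabolic I : Subgroup (Equiv.Perm (Fin n))) ≤ parabolic J :=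
  Subgroup.closure_mono (Set.image_mono h)

theorem adj_mem_parabolic {i : Fin (n - 1)} (h : i ∈ K) : adj i ∈ parabolic K :=
  Subgroup.subset_closure ⟨i, h, rfl⟩

/-- Every s_k with k ≠ i permutes the initial segment {0, …, i}. -/
theorem apply_le_iff_of_mem_parabolic (hw : w ∈ parabolic K) {i : Fin (n - 1)} (hi : i ∉ K)
    (x : Fin n) : (w x : ℕ) ≤ i ↔ (x : ℕ) ≤ i := by
  induction hw using Subgroup.closure_induction generalizing x with
  | one => rfl
  | mul a b _ _ ha hb => rw [Equiv.Perm.mul_apply, ha, hb]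
  | inv a _ ha => rw [← ha (a⁻¹ x)]; simp
  | mem a ha =>
    obtain ⟨k, hk, rfl⟩ := ha
    have hne : (k : ℕ) ≠ i := fun h => hi (Fin.ext h ▸ hk)
    by_cases h1 : (x : ℕ) = k
    · obtain rfl : x = lo k := Fin.ext h1
      rw [adj_lo, val_lo, val_hi]; omega
    · by_cases h2 : (x : ℕ) = k + 1
      · obtain rfl : x = HeckeTableaux.hi k := Fin.ext h2
        rw [adj_hi, val_lo, val_hi]; omega
      · rw [adj_ne k x h1 h2]

theorem apply_lo_lt_hi_of_mem_parabolic (hw : w ∈ parabolic K) {i : Fin (n - 1)} (h : i ∉ K) :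
    w (lo i) < w (hi i) := by
  have h1 := (apply_le_iff_of_mem_parabolic hw h (lo i)).2 le_rfl
  have h2 := mt (apply_le_iff_of_mem_parabolic hw h (hi i)).1 (by rw [val_hi]; omega)
  rw [Fin.lt_def]; omega

/-- The first letter of a reduced word is a left descent, and an element of a parabolic subgroup has
no left descents outside `K`. Removing that letter stays inside the subgroup. -/
theorem mem_of_reduced {l : List (Fin (n - 1))} (hl : Reduced l) (h : wordProd l ∈ parabolic K) :
    ∀ i ∈ l, i ∈ K := by
  induction l with
  | nil => simp
  | cons i l ih =>
    obtain ⟨h1, h2⟩ := hl.tail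
    have hi : i ∈ K := by
      by_contra hi
      exact absurd (apply_lo_lt_hi_of_mem_parabolic (inv_mem h) hi) (not_lt.2 h2.le)
    have h3 := mul_mem (adj_mem_parabolic hi) h
    rw [wordProd_cons, adj_mul_cancel] at h3
    exact List.forall_mem_cons.2 ⟨hi, ih h1 h3⟩

theorem wordProd_mem_parabolic {l : List (Fin (n - 1))} (h : ∀ i ∈ l, i ∈ K) :
    wordProd l ∈ parabolic K := by
  induction l with
  | nil => exact one_mem _
  | cons i l ih =>
    rw [List.forall_mem_cons] at h
    rw [wordProd_cons]
    exact mul_mem (adj_mem_parabolic h.1) (ih h.2)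

theorem mem_of_mem_reducedWord (h : w ∈ parabolic K) : ∀ i ∈ reducedWord w, i ∈ K :=
  mem_of_reduced (reduced_reducedWord w) (by rwa [wordProd_reducedWord])

theorem longest_mem (K : Set (Fin (n - 1))) : longest K ∈ parabolic K :=
  (exists_longest K).choose_spec.1

theorem length_le_longest (h : w ∈ parabolic K) : length w ≤ length (longest K) :=
  (exists_longest K).choose_spec.2 w h

theorem longest_desc {i : Fin (n - 1)} (h : i ∈ K) : longest K (hi i) < longest K (lo i) := by
  refine (apply_lt_or_gt (longest K) i).resolve_left fun h1 => ?_
  have h2 := length_mul_adj h1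
  have h3 := length_le_longest (mul_mem (longest_mem K) (adj_mem_parabolic h))
  omega

theorem longest_inv_desc {i : Fin (n - 1)} (h : i ∈ K) :
    (longest K)⁻¹ (hi i) < (longest K)⁻¹ (lo i) := by
  refine (apply_lt_or_gt (longest K)⁻¹ i).resolve_left fun h1 => ?_
  have h2 := length_adj_mul h1
  have h3 := length_le_longest (mul_mem (adj_mem_parabolic h) (longest_mem K))
  omega

theorem descIn_longest (_ : I ⊆ J) : DescIn I J (longest I) := by
  intro i _
  refine ⟨fun h1 => ?_, longest_desc⟩
  by_contra hI
  exact absurd (apply_lo_lt_hi_of_mem_parabolic (longest_mem I) hI) (not_lt.2 h1.le)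

/-- A permutation that increases along the steps in `J` increases on the orbits of the parabolic
subgroup of `J`. -/
theorem apply_lt_of_ascents (hw : ∀ i ∈ J, w (lo i) < w (hi i)) {p q : Fin n} (hpq : p < q)
    (h : ∀ i ∉ J, (p : ℕ) ≤ i → (q : ℕ) ≤ i) : w p < w q := by
  revert h
  refine rel_of_step (P := fun p q : Fin n => (∀ i ∉ J, (p : ℕ) ≤ i → (q : ℕ) ≤ i) → w p < w q)
    ?_ ?_ hpq
  · intro i h
    by_cases hi : i ∈ J
    · exact hw i hi
    · have := h i hi le_rfl
      rw [val_hi] at this; omega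
  · intro p q r hpq hqr h1 h2 h
    have hpq : (p : ℕ) < q := hpq
    have hqr : (q : ℕ) < r := hqr
    refine (h1 fun i hi hp => ?_).trans (h2 fun i hi hp => h i hi (by omega))
    have := h i hi hp
    omega

/-- For p ∈ J the values of `v` at p and p + 1 lie in one orbit of the parabolic subgroup, and `u`
is increasing there. -/
theorem mul_apply_lt_of_ascents {u v : Equiv.Perm (Fin n)} (hu : ∀ i ∈ J, u (lo i) < u (hi i))
    (hv : v ∈ parabolic J) {p : Fin (n - 1)} (hp : p ∈ J) (h : v (lo p) < v (hi p)) :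
    u (v (lo p)) < u (v (hi p)) := by
  refine apply_lt_of_ascents hu h fun i hi h1 => ?_
  have hne : (p : ℕ) ≠ i := fun h => hi (Fin.ext h ▸ hp)
  rw [apply_le_iff_of_mem_parabolic hv hi, val_lo] at h1
  rw [apply_le_iff_of_mem_parabolic hv hi, val_hi]
  omega

theorem mul_apply_gt_of_ascents {u v : Equiv.Perm (Fin n)} (hu : ∀ i ∈ J, u (lo i) < u (hi i))
    (hv : v ∈ parabolic J) {p : Fin (n - 1)} (h : v (hi p) < v (lo p)) :
    u (v (hi p)) < u (v (lo p)) := by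
  refine apply_lt_of_ascents hu h fun i hi h1 => ?_
  rw [apply_le_iff_of_mem_parabolic hv hi, val_hi] at h1
  rw [apply_le_iff_of_mem_parabolic hv hi, val_lo]
  omega

/-- Here `u` is a minimal representative of its left coset, so an ascent of `v` at a letter of `J`
remains an ascent of u v, and letters can be appended one at a time. Lengths, and the elements π̄,
are therefore multiplicative along u v. -/
theorem reduced_append_of_ascents {u : Equiv.Perm (Fin n)} (hu : ∀ i ∈ J, u (lo i) < u (hi i))
    {l : List (Fin (n - 1))} (hl : Reduced l) (hl' : ∀ i ∈ l, i ∈ J) :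
    Reduced (reducedWord u ++ l) := by
  induction l using List.reverseRecOn with
  | nil => simpa using reduced_reducedWord u
  | append_singleton l p ih =>
    obtain ⟨h1, h2⟩ := hl.init
    rw [List.forall_mem_append] at hl'
    rw [← List.append_assoc]
    refine (ih h1 hl'.1).concat ?_
    rw [wordProd_append, wordProd_reducedWord, Equiv.Perm.mul_apply, Equiv.Perm.mul_apply]
    exact mul_apply_lt_of_ascents hu (wordProd_mem_parabolic hl'.1) (hl'.2 p (by simp)) h2

theorem length_mul_of_ascents {u v : Equiv.Perm (Fin n)} (hu : ∀ i ∈ J, u (lo i) < u (hi i))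
    (hv : v ∈ parabolic J) : length (u * v) = length u + length v := by
  have h := reduced_append_of_ascents hu (reduced_reducedWord v) (mem_of_mem_reducedWord hv)
  have h1 := reduced_reducedWord u
  have h2 := reduced_reducedWord v
  rw [Reduced, wordProd_reducedWord] at h1 h2
  rw [Reduced, wordProd_append, wordProd_reducedWord, wordProd_reducedWord,
    List.length_append, h1, h2] at h
  exact h.symm

/-- With x = v v'⁻¹ one has u' = u x and u = u' x⁻¹. Additivity of length, used both ways, forces
`x` to have length 0. -/
theorem eq_of_mul_eq_mul_of_ascents {u u' v v' : Equiv.Perm (Fin n)}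
    (hu : ∀ i ∈ J, u (lo i) < u (hi i)) (hu' : ∀ i ∈ J, u' (lo i) < u' (hi i))
    (hv : v ∈ parabolic J) (hv' : v' ∈ parabolic J) (h : u * v = u' * v') : u = u' ∧ v = v' := by
  have hx : v * v'⁻¹ ∈ parabolic J := mul_mem hv (inv_mem hv')
  have e1 : u' = u * (v * v'⁻¹) := by rw [← mul_assoc, h, mul_inv_cancel_right]
  have e2 : u = u' * (v * v'⁻¹)⁻¹ := by rw [e1, mul_inv_cancel_right]
  have l1 := length_mul_of_ascents hu hx
  have l2 := length_mul_of_ascents hu' (inv_mem hx)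
  rw [← e1] at l1
  rw [← e2, length_inv] at l2
  have hx1 : v * v'⁻¹ = 1 := eq_one_of_length (by omega)
  rw [hx1, mul_one] at e1
  exact ⟨e1.symm, by rwa [mul_inv_eq_one] at hx1⟩

/-- As long as `w` has a descent in `J`, that letter can be moved from the right end of `w` into
`v`, which shortens `w`. -/
theorem exists_mul_of_ascents (J : Set (Fin (n - 1))) (w : Equiv.Perm (Fin n)) :
    ∃ u v, (∀ i ∈ J, u (lo i) < u (hi i)) ∧ v ∈ parabolic J ∧ w = u * v := by
  induction h : length w using Nat.strong_induction_on generalizing w with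
  | _ k ih =>
    by_cases hw : ∀ i ∈ J, w (lo i) < w (hi i)
    · exact ⟨w, 1, hw, one_mem _, (mul_one w).symm⟩
    · push Not at hw
      obtain ⟨i, hi, h1⟩ := hw
      have h2 := (apply_lt_or_gt w i).resolve_left (not_lt.2 h1)
      have h3 := length_mul_adj_of_gt h2
      obtain ⟨u, v, hu, hv, e⟩ := ih _ (by omega) (w * adj i) rfl
      refine ⟨u, v * adj i, hu, mul_mem hv (adj_mem_parabolic hi), ?_⟩
      rw [← mul_assoc, ← e, mul_adj_cancel]

end Parabolic

/-! ### Absorption of parabolic elements and uniqueness of the longest element -/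

section Absorption

variable (F : Type*) [Field F] {n : ℕ} {I J K : Set (Fin (n - 1))} {w : Equiv.Perm (Fin n)}

theorem genBarPerm_mul_of_ascents {u v : Equiv.Perm (Fin n)} (hu : ∀ i ∈ J, u (lo i) < u (hi i))
    (hv : v ∈ parabolic J) : genBarPerm F u * genBarPerm F v = genBarPerm F (u * v) := by
  have h := genBarPerm_eq F
    (reduced_append_of_ascents hu (reduced_reducedWord v) (mem_of_mem_reducedWord hv))
  rw [wordProd_append, wordProd_reducedWord, wordProd_reducedWord] at h
  rw [h]; simp [genBarPerm]

theorem genBarPerm_mul_prod {l : List (Fin (n - 1))} (h : ∀ i ∈ l, w (hi i) < w (lo i)) :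
    genBarPerm F w * (l.map (genBar F)).prod = (-1 : F) ^ l.length • genBarPerm F w := by
  induction l with
  | nil => simp
  | cons i l ih =>
    rw [List.forall_mem_cons] at h
    rw [List.map_cons, List.prod_cons, ← mul_assoc, genBarPerm_mul_genBar_of_gt h.1,
      smul_mul_assoc, ih h.2, smul_smul, List.length_cons, pow_succ']

theorem prod_mul_genBarPerm {l : List (Fin (n - 1))} (h : ∀ i ∈ l, w⁻¹ (hi i) < w⁻¹ (lo i)) :
    (l.map (genBar F)).prod * genBarPerm F w = (-1 : F) ^ l.length • genBarPerm F w := by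
  induction l with
  | nil => simp
  | cons i l ih =>
    rw [List.forall_mem_cons] at h
    rw [List.map_cons, List.prod_cons, mul_assoc, ih h.2, mul_smul_comm,
      genBar_mul_genBarPerm_of_gt h.1, smul_smul, List.length_cons, pow_succ]

theorem genBarPerm_mul_genBarPerm_of_desc {v : Equiv.Perm (Fin n)} (hv : v ∈ parabolic K)
    (h : ∀ i ∈ K, w (hi i) < w (lo i)) :
    genBarPerm F w * genBarPerm F v = (-1 : F) ^ length v • genBarPerm F w := by
  have := genBarPerm_mul_prod F (w := w) (l := reducedWord v)
    fun i hi => h i (mem_of_mem_reducedWord hv i hi)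
  rwa [reduced_reducedWord v, wordProd_reducedWord] at this

theorem genBarPerm_mul_genBarPerm_of_inv_desc {v : Equiv.Perm (Fin n)} (hv : v ∈ parabolic K)
    (h : ∀ i ∈ K, w⁻¹ (hi i) < w⁻¹ (lo i)) :
    genBarPerm F v * genBarPerm F w = (-1 : F) ^ length v • genBarPerm F w := by
  have := prod_mul_genBarPerm F (w := w) (l := reducedWord v)
    fun i hi => h i (mem_of_mem_reducedWord hv i hi)
  rwa [reduced_reducedWord v, wordProd_reducedWord] at this

theorem eq_of_smul_genBarPerm {v : Equiv.Perm (Fin n)} {a b : ℕ}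
    (h : (-1 : F) ^ a • genBarPerm F w = (-1 : F) ^ b • genBarPerm F v) : w = v := by
  by_contra hne
  have h1 := congrArg (fun x => (heckeBasis F).repr x w) h
  simp only [← heckeBasis_apply, map_smul, Module.Basis.repr_self, Finsupp.smul_apply,
    Finsupp.single_eq_same, Finsupp.single_eq_of_ne hne] at h1
  simp at h1

/-- The product π̄_w π̄_{w_0(K)} is ±π̄_w, since `w` absorbs on its right, and ±π̄_{w_0(K)}, since
w_0(K) absorbs on its left. Linear independence identifies the two permutations. The field plays no
role, and ℚ is used. -/
theorem eq_longest (hw : w ∈ parabolic K) (h : ∀ i ∈ K, w (hi i) < w (lo i)) : w = longest K :=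
  eq_of_smul_genBarPerm ℚ <|
    (genBarPerm_mul_genBarPerm_of_desc ℚ (longest_mem K) h).symm.trans
      (genBarPerm_mul_genBarPerm_of_inv_desc ℚ hw fun _ => longest_inv_desc)

theorem eq_longest_of_inv_desc (hw : w ∈ parabolic K) (h : ∀ i ∈ K, w⁻¹ (hi i) < w⁻¹ (lo i)) :
    w = longest K :=
  eq_of_smul_genBarPerm ℚ <|
    (genBarPerm_mul_genBarPerm_of_inv_desc ℚ (longest_mem K) h).symm.trans
      (genBarPerm_mul_genBarPerm_of_desc ℚ hw fun _ => longest_desc)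

/-- The element π_{w_0(K)} can be written with π_i in front, and π̄_i π_i = 0. -/
theorem genBar_mul_genPerm_longest {i : Fin (n - 1)} (h : i ∈ K) :
    genBar F i * genPerm F (longest K) = 0 := by
  rw [← gen_mul_genPerm_of_gt (longest_inv_desc h), ← mul_assoc, genBar_mul_gen, zero_mul]

end Absorption

/-! ### The embedding of the module of tableaux in the 0-Hecke algebra -/

section Embedding

theorem injective_of_linearIndependent {F ι M N : Type*} [Field F] [AddCommGroup M] [Module F M]
    [AddCommGroup N] [Module F N] (f : M →ₗ[F] N) {y : ι → M}
    (hy : Submodule.span F (Set.range y) = ⊤) (h : LinearIndependent F fun i => f (y i)) :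
    Function.Injective f := by
  rw [injective_iff_map_eq_zero]
  intro x hx
  have hx' : x ∈ Submodule.span F (Set.range y) := by rw [hy]; trivial
  rw [Finsupp.mem_span_range_iff_exists_finsupp] at hx'
  obtain ⟨c, rfl⟩ := hx'
  rw [Finsupp.sum, map_sum] at hx
  have := linearIndependent_iff.1 h c
    (by simpa [Finsupp.linearCombination_apply, Finsupp.sum] using hx)
  simp [this]

/-- In a vanishing combination, choose an index of minimal rank in the support. At its leading basis
vector no other term contributes, so its coefficient is zero. -/
theorem linearIndependent_of_triangular {F ι κ M : Type*} [Field F] [AddCommGroup M] [Module F M]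
    (b : Module.Basis κ F M) {f : ι → κ} (hf : Function.Injective f) (r : κ → ℕ) {x : ι → M}
    (h : ∀ i, x i - b (f i) ∈ Submodule.span F (b '' {k | r (f i) < r k})) :
    LinearIndependent F x := by
  classical
  have key : ∀ i j, r (f j) ≤ r (f i) → b.repr (x i) (f j) = if i = j then 1 else 0 := by
    intro i j hij
    have h0 : ∀ y ∈ Submodule.span F (b '' {k | r (f i) < r k}), b.repr y (f j) = 0 := by
      intro y hy
      have := (b.mem_span_image).1 hy
      by_contra hne
      have h1 := this (Finsupp.mem_support_iff.2 hne)
      exact absurd h1 (not_lt.2 hij)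
    have h1 := h0 _ (h i)
    rw [map_sub, Finsupp.sub_apply, sub_eq_zero, Module.Basis.repr_self, Finsupp.single_apply] at h1
    rw [h1]
    simp only [hf.eq_iff]
  rw [linearIndependent_iff]
  intro c hc
  by_contra hne
  obtain ⟨j, hj, hmin⟩ := Finset.exists_min_image c.support (fun i => r (f i))
    (Finsupp.support_nonempty_iff.2 hne)
  have h1 := congrArg (fun y => b.repr y (f j)) hc
  simp only [Finsupp.linearCombination_apply, Finsupp.sum, map_sum, map_smul, map_zero,
    Finsupp.coe_finsetSum, Finset.sum_apply, Finsupp.smul_apply, Finsupp.coe_zero,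
    Pi.zero_apply, smul_eq_mul] at h1
  rw [Finset.sum_eq_single j] at h1
  · rw [key j j le_rfl, if_pos rfl, mul_one] at h1
    exact Finsupp.mem_support_iff.1 hj h1
  · intro i hi hij
    rw [key i j (hmin i hi), if_neg hij, mul_zero]
  · intro h; exact absurd hj h

variable (F : Type*) [Field F] {n : ℕ} {I J K : Set (Fin (n - 1))} {w : Equiv.Perm (Fin n)}
  {D : Diagram n}

/-- A linear map that commutes with the operators `π̄_i` is a homomorphism of modules. -/
def homOfGenBar {M N : Type*} [AddCommMonoid M] [Module F M] [Module (ZeroHecke F n) M]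
    [IsScalarTower F (ZeroHecke F n) M] [AddCommMonoid N] [Module F N] [Module (ZeroHecke F n) N]
    [IsScalarTower F (ZeroHecke F n) N] (f : M →ₗ[F] N)
    (hf : ∀ (i : Fin (n - 1)) (x : M), f (genBar F i • x) = genBar F i • f x) :
    M →ₗ[ZeroHecke F n] N where
  toFun := f
  map_add' := f.map_add
  map_smul' h x := by
    have hh : h ∈ Algebra.adjoin F (Set.range (gen F)) := by rw [adjoin_gen]; trivial
    rw [RingHom.id_apply]
    induction hh using Algebra.adjoin_induction generalizing x with
    | algebraMap r => rw [algebraMap_smul, algebraMap_smul, map_smul]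
    | add a b _ _ ha hb => rw [add_smul, add_smul, map_add, ha, hb]
    | mul a b _ _ ha hb => rw [mul_smul, mul_smul, ha, hb]
    | mem a ha =>
      obtain ⟨i, rfl⟩ := ha
      rw [gen_eq, add_smul, add_smul, one_smul, one_smul, map_add, hf]

/-- Left multiplication by s_i changes only the relative order of the values `i` and `i + 1`. If
this alters the descent at some p ∈ J, these values sit at p and p + 1. The assumed order makes p an
ascent of `w`, so p ∉ I, and s_i w = w s_p. -/
theorem exists_adj_mul_eq {i : Fin (n - 1)} (hw : DescIn I J w) (hw' : ¬ DescIn I J (adj i * w))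
    (h : w⁻¹ (lo i) < w⁻¹ (hi i)) : ∃ p ∈ J \ I, w (lo p) < w (hi p) ∧ adj i * w = w * adj p := by
  rw [DescIn] at hw'
  push Not at hw'
  obtain ⟨p, hp, hp'⟩ := hw'
  have hlt : w (lo p) < w (hi p) ∧ adj i (w (hi p)) < adj i (w (lo p)) → p ∈ J \ I ∧
      adj i * w = w * adj p := by
    rintro ⟨h1, h2⟩
    have h3 : w (lo p) = lo i ∧ w (hi p) = hi i := by
      by_contra hne
      exact absurd (adj_lt_adj i h1 hne) (not_lt.2 h2.le)
    refine ⟨⟨hp, fun hI => absurd ((hw p hp).2 hI) (not_lt.2 h1.le)⟩, ?_⟩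
    rw [adj, adj, Equiv.mul_swap_eq_swap_mul, h3.1, h3.2]
  rcases apply_lt_or_gt w p with h1 | h1
  · rcases apply_lt_or_gt (adj i * w) p with h2 | h2
    · exfalso
      have : p ∉ I := fun hI => absurd ((hw p hp).2 hI) (not_lt.2 h1.le)
      have h3 := not_lt.2 h2.le
      tauto
    · have := hlt ⟨h1, h2⟩
      exact ⟨p, this.1, h1, this.2⟩
  · exfalso
    have hI := (hw p hp).1 h1
    have h2 : ¬ (w (hi p) = lo i ∧ w (lo p) = hi i) := by
      rintro ⟨h2, h3⟩
      rw [← h2, ← h3, Equiv.Perm.coe_inv, Equiv.symm_apply_apply, Equiv.symm_apply_apply] at h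
      exact absurd h (not_lt.2 (lo_lt_hi p).le)
    have h3 := adj_lt_adj i h1 h2
    rw [Equiv.Perm.mul_apply, Equiv.Perm.mul_apply] at hp'
    rcases hp' with ⟨-, h4⟩ | ⟨h4, -⟩
    · exact h4 hI
    · exact absurd h3 (not_lt.2 h4)

/-- The linear map `τ ↦ π̄_w π_{w_0(K)}`, where `w` is the reading word of `τ`. -/
def toHeckeAux (D : Diagram n) (K : Set (Fin (n - 1))) : TabSpan F D →ₗ[F] ZeroHecke F n :=
  (tabBasis F D).constr F fun τ => genBarPerm F τ.entry * genPerm F (longest K)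

variable (h : HasType D I J)
include h

theorem HasType.toHeckeAux_tabOf (hw : DescIn I J w) :
    toHeckeAux F D K (tabOf F D w) = genBarPerm F w * genPerm F (longest K) := by
  rw [h.tabOf_eq F hw, toHeckeAux, ← tabBasis_apply, Module.Basis.constr_basis]; rfl

theorem HasType.tab_induction {p : TabSpan F D → Prop} (x : TabSpan F D) (h0 : p 0)
    (hadd : ∀ x y, p x → p y → p (x + y)) (hsmul : ∀ (c : F) x, p x → p (c • x))
    (htab : ∀ w, DescIn I J w → p (tabOf F D w)) : p x := by
  have hx : x ∈ Submodule.span F (Set.range (tabBasis F D)) := by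
    rw [Module.Basis.span_eq]; trivial
  induction hx using Submodule.span_induction with
  | zero => exact h0
  | add x y _ _ hx hy => exact hadd x y hx hy
  | smul c x _ hx => exact hsmul c x hx
  | mem x hx =>
    obtain ⟨τ, rfl⟩ := hx
    rw [tabBasis_apply, ← tabOf_entry]
    exact htab _ (h.descIn τ)

theorem HasType.toHeckeAux_genBar (i : Fin (n - 1)) (x : TabSpan F D) :
    toHeckeAux F D (J \ I) (genBar F i • x) = genBar F i • toHeckeAux F D (J \ I) x := by
  induction x using h.tab_induction F with
  | h0 => simp
  | hadd x y hx hy => rw [smul_add, map_add, hx, hy, map_add, smul_add]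
  | hsmul c x hx => rw [smul_comm, map_smul, hx, map_smul, smul_comm]
  | htab w hw =>
    rw [h.genBar_smul_tabOf F hw, h.toHeckeAux_tabOf F hw, smul_eq_mul, ← mul_assoc]
    rcases apply_lt_or_gt w⁻¹ i with hlt | hgt
    · rw [if_neg (not_lt.2 hlt.le), genBar_mul_genBarPerm hlt]
      by_cases hw' : DescIn I J (adj i * w)
      · rw [h.toHeckeAux_tabOf F hw']
      -- The word s_i w is zero as a tableau. In the algebra it gives π̄_w π̄_p π_{w_0(J \ I)} with
      -- p ∈ J \ I, which vanishes as well.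
      · obtain ⟨p, hp, h1, h2⟩ := exists_adj_mul_eq hw hw' hlt
        rw [h.tabOf_eq_zero F hw', map_zero, h2, ← genBarPerm_mul_genBar h1, mul_assoc,
          genBar_mul_genPerm_longest F hp, mul_zero]
    · rw [if_pos hgt, genBar_mul_genBarPerm_of_gt hgt, map_neg, h.toHeckeAux_tabOf F hw,
        smul_mul_assoc]
      exact (neg_one_smul F _).symm

/-- The embedding `τ ↦ π̄_w π_{w_0(J \ I)}` of the module of tableaux in `H_n(0)`. -/
def HasType.toHecke : TabSpan F D →ₗ[ZeroHecke F n] ZeroHecke F n :=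
  homOfGenBar F (toHeckeAux F D (J \ I)) (h.toHeckeAux_genBar F)

theorem HasType.toHecke_tabOf (hw : DescIn I J w) :
    h.toHecke F (tabOf F D w) = genBarPerm F w * genPerm F (longest (J \ I)) :=
  h.toHeckeAux_tabOf F hw

omit h

/-- Expand each π_p as 1 + π̄_p. Since p is an ascent of `w`, the factor π̄_p lengthens π̄_w, and
terms that are already longer than `w` stay longer. -/
theorem genBarPerm_mul_prod_gen_sub_mem {l : List (Fin (n - 1))}
    (hl : ∀ i ∈ l, w (lo i) < w (hi i)) :
    genBarPerm F w * (l.map (gen F)).prod - genBarPerm F w ∈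
      Submodule.span F (heckeBasis F '' {v | length w < length v}) := by
  have hmem : ∀ {v : Equiv.Perm (Fin n)}, length w < length v → genBarPerm F v ∈
      Submodule.span F (heckeBasis F '' {v | length w < length v}) := fun {v} hv =>
    Submodule.subset_span ⟨v, hv, heckeBasis_apply F v⟩
  have hst : ∀ i : Fin (n - 1), ∀ x ∈ Submodule.span F (heckeBasis F '' {v | length w < length v}),
      x * genBar F i ∈ Submodule.span F (heckeBasis F '' {v | length w < length v}) := by
    intro i x hx
    induction hx using Submodule.span_induction with
    | zero => rw [zero_mul]; exact Submodule.zero_mem _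
    | add x y _ _ hx hy => rw [add_mul]; exact Submodule.add_mem _ hx hy
    | smul c x _ hx => rw [smul_mul_assoc]; exact Submodule.smul_mem _ c hx
    | mem x hx =>
      obtain ⟨v, hv, rfl⟩ := hx
      have hv : length w < length v := hv
      rw [heckeBasis_apply]
      rcases apply_lt_or_gt v i with hlt | hgt
      · rw [genBarPerm_mul_genBar hlt]
        exact hmem (by rw [length_mul_adj hlt]; omega)
      · rw [genBarPerm_mul_genBar_of_gt hgt]
        exact Submodule.smul_mem _ _ (hmem hv)
  induction l using List.reverseRecOn with
  | nil => simp
  | append_singleton l p ih =>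
    rw [List.forall_mem_append] at hl
    have h1 := ih hl.1
    have h2 := hst p _ h1
    have hp := hl.2 p (by simp)
    have h3 := hmem (v := w * adj p) (by rw [length_mul_adj hp]; omega)
    rw [← genBarPerm_mul_genBar hp] at h3
    -- With `a` the product so far, b = π̄_w and c = π̄_p, this is a (1 + c) - b = (a - b) + (a - b)
    -- c + b c.
    have h4 := Submodule.add_mem _ (Submodule.add_mem _ h1 h2) h3
    convert h4 using 1
    rw [List.map_append, List.prod_append, List.map_singleton, List.prod_singleton, gen_eq,
      ← mul_assoc]
    generalize genBarPerm F w * (List.map (gen F) l).prod = a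
    generalize genBarPerm F w = b
    generalize genBar F p = c
    rw [mul_add, sub_mul, mul_one]; abel

/-- A word for w_0(J \ I) uses only letters of J \ I, all of them ascents of a standard `w`. So the
image of `w` has leading term π̄_w with respect to length. -/
theorem HasType.toHecke_injective (h : HasType D I J) : Function.Injective (h.toHecke F) := by
  have hLI : LinearIndependent F fun τ : StdTableau D => toHeckeAux F D (J \ I) (tabBasis F D τ) := by
    refine linearIndependent_of_triangular (heckeBasis F) entry_injective length fun τ => ?_
    rw [tabBasis_apply, ← tabOf_entry, h.toHeckeAux_tabOf F (h.descIn τ), heckeBasis_apply]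
    refine genBarPerm_mul_prod_gen_sub_mem F fun i hi => ?_
    have hi := mem_of_mem_reducedWord (longest_mem _) i hi
    exact (apply_lt_or_gt τ.entry i).resolve_right fun h1 => hi.2 ((h.descIn τ i hi.1).1 h1)
  exact injective_of_linearIndependent (toHeckeAux F D (J \ I)) (tabBasis F D).span_eq hLI

include h

/-- All elements of `I` are descents of `w`, hence π̄_w π̄_{w_0(I)} = ±π̄_w in the algebra, and
injectivity of the embedding carries this back. The tableau of w_0(I) therefore generates the
module. -/
theorem HasType.tabOf_eq_smul_longest (hw : DescIn I J w) : tabOf F D w =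
    (-1 : F) ^ length (longest I) • genBarPerm F w • tabOf F D (longest I) := by
  apply h.toHecke_injective F
  have h1 := genBarPerm_mul_genBarPerm_of_desc F (w := w) (longest_mem I)
    fun i hi => (hw i (h.subset hi)).2 hi
  have h2 : (-1 : F) ^ length (longest I) * (-1 : F) ^ length (longest I) = 1 := by
    rw [← mul_pow]; simp
  rw [LinearMap.map_smul_of_tower, map_smul, h.toHecke_tabOf F (descIn_longest h.subset),
    smul_eq_mul, ← mul_assoc, h1, h.toHecke_tabOf F hw, smul_mul_assoc, smul_smul, h2, one_smul]

theorem HasType.genBarPerm_smul_tabOf {K : Set (Fin (n - 1))} {u v : Equiv.Perm (Fin n)}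
    (hu : ∀ i ∈ K, u (lo i) < u (hi i)) (hv : v ∈ parabolic K) (hv' : DescIn I J v)
    (huv : DescIn I J (u * v)) : genBarPerm F u • tabOf F D v = tabOf F D (u * v) := by
  apply h.toHecke_injective F
  rw [map_smul, h.toHecke_tabOf F hv', h.toHecke_tabOf F huv, smul_eq_mul, ← mul_assoc,
    genBarPerm_mul_of_ascents F hu hv]

theorem HasType.range_toHecke : LinearMap.range (h.toHecke F) = PIJ F I J := by
  apply le_antisymm
  · rintro _ ⟨x, rfl⟩
    induction x using h.tab_induction F with
    | h0 => rw [map_zero]; exact Submodule.zero_mem _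
    | hadd x y hx hy => rw [map_add]; exact Submodule.add_mem _ hx hy
    | hsmul c x hx => rw [LinearMap.map_smul_of_tower]; exact Submodule.smul_of_tower_mem _ c hx
    | htab w hw =>
      rw [h.tabOf_eq_smul_longest F hw, LinearMap.map_smul_of_tower, map_smul,
        h.toHecke_tabOf F (descIn_longest h.subset)]
      exact Submodule.smul_of_tower_mem _ _ (Submodule.smul_mem _ _ (Submodule.subset_span rfl))
  · rw [PIJ, Submodule.span_le, Set.singleton_subset_iff]
    exact ⟨_, h.toHecke_tabOf F (descIn_longest h.subset)⟩

/-- The module of tableaux is isomorphic to the left ideal `P_{I,J}`. -/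
def HasType.equivPIJ : TabSpan F D ≃ₗ[ZeroHecke F n] PIJ F I J :=
  (LinearEquiv.ofInjective _ (h.toHecke_injective F)).trans
    (LinearEquiv.ofEq _ _ (h.range_toHecke F))

end Embedding

/-! ### Modules of ribbon tableaux are projective and indecomposable -/

section Ribbon

variable (F : Type*) [Field F] {n : ℕ} {I J : Set (Fin (n - 1))} {D : Diagram n}

open Classical in
/-- A functional that spans a one-dimensional representation in the dual module: it is multiplied
by `-1` by the operators `π̄_i` with `i ∈ S` and by `0` by the other ones. -/
def IsWeight (S : Set (Fin (n - 1))) (f : TabSpan F D →ₗ[F] F) : Prop :=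
  ∀ (i : Fin (n - 1)) (x : TabSpan F D), f (genBar F i • x) = if i ∈ S then -f x else 0

variable {F}

theorem IsWeight.apply_prod {S : Set (Fin (n - 1))} {f : TabSpan F D →ₗ[F] F}
    (hf : IsWeight F S f) {l : List (Fin (n - 1))} {x : TabSpan F D}
    (hx : f ((l.map (genBar F)).prod • x) ≠ 0) : (∀ i ∈ l, i ∈ S) ∧ f x ≠ 0 := by
  induction l with
  | nil => simpa using hx
  | cons i l ih =>
    rw [List.map_cons, List.prod_cons, mul_smul, hf] at hx
    split_ifs at hx with hi
    · have := ih (neg_ne_zero.1 hx)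
      exact ⟨List.forall_mem_cons.2 ⟨hi, this.1⟩, this.2⟩
    · exact absurd rfl hx

theorem IsWeight.apply_prod_ne_zero {S : Set (Fin (n - 1))} {f : TabSpan F D →ₗ[F] F}
    (hf : IsWeight F S f) {l : List (Fin (n - 1))} (hl : ∀ i ∈ l, i ∈ S) {x : TabSpan F D}
    (hx : f x ≠ 0) : f ((l.map (genBar F)).prod • x) ≠ 0 := by
  induction l with
  | nil => simpa using hx
  | cons i l ih =>
    rw [List.forall_mem_cons] at hl
    rw [List.map_cons, List.prod_cons, mul_smul, hf, if_pos hl.1]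
    exact neg_ne_zero.2 (ih hl.2)

theorem IsWeight.apply_prod_gen {S : Set (Fin (n - 1))} {f : TabSpan F D →ₗ[F] F}
    (hf : IsWeight F S f) {l : List (Fin (n - 1))} (hl : ∀ i ∈ l, i ∉ S) (x : TabSpan F D) :
    f ((l.map (gen F)).prod • x) = f x := by
  induction l with
  | nil => simp
  | cons i l ih =>
    rw [List.forall_mem_cons] at hl
    rw [List.map_cons, List.prod_cons, mul_smul, gen_eq, add_smul, one_smul, map_add, hf,
      if_neg hl.1, add_zero, ih hl.2]

theorem HasType.eq_of_tabOf (h : HasType D I J) {f : TabSpan F D →ₗ[F] F}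
    {w : Equiv.Perm (Fin n)} (hw : f (tabOf F D w) ≠ 0) : DescIn I J w := by
  by_contra hc
  rw [h.tabOf_eq_zero F hc, map_zero] at hw
  exact hw rfl

/-- Take a minimal set `U` of words, closed under length-increasing left multiplications, that spans
the module together with `N`. Removing a shortest word `w₀` keeps `U` closed, so by minimality the
span becomes proper and some nonzero functional vanishes on it. Each π̄_i multiplies a word of `U`
by -1 or sends it into the remainder, so only the action on `w₀` matters for this functional. -/
theorem HasType.exists_isWeight (h : HasType D I J) (N : Submodule (ZeroHecke F n) (TabSpan F D))
    (hN : N ≠ ⊤) : ∃ (f : TabSpan F D →ₗ[F] F) (S : Set (Fin (n - 1))),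
      f ≠ 0 ∧ (∀ x ∈ N, f x = 0) ∧ IsWeight F S f := by
  classical
  let V : Finset (Equiv.Perm (Fin n)) → Submodule F (TabSpan F D) := fun U =>
    N.restrictScalars F ⊔ Submodule.span F (tabOf F D '' U)
  let good : Finset (Equiv.Perm (Fin n)) → Prop := fun U =>
    (∀ w ∈ U, ∀ i, w⁻¹ (lo i) < w⁻¹ (hi i) → adj i * w ∈ U) ∧ V U = ⊤
  have hex : ∃ U, good U := by
    refine ⟨Finset.univ, fun _ _ _ _ => Finset.mem_univ _, ?_⟩
    refine eq_top_iff.2 (le_trans ?_ le_sup_right)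
    intro x _
    induction x using h.tab_induction F with
    | h0 => exact Submodule.zero_mem _
    | hadd x y hx hy => exact Submodule.add_mem _ (hx trivial) (hy trivial)
    | hsmul c x hx => exact Submodule.smul_mem _ c (hx trivial)
    | htab w hw => exact Submodule.subset_span ⟨w, by simp, rfl⟩
  obtain ⟨U, hU, hmin⟩ := exists_minimal_of_wellFoundedLT good hex
  have hne : U.Nonempty := by
    rw [Finset.nonempty_iff_ne_empty]
    rintro rfl
    have := hU.2
    simp only [V, Finset.coe_empty, Set.image_empty, Submodule.span_empty, sup_bot_eq] at this
    exact hN (by rwa [Submodule.restrictScalars_eq_top_iff] at this)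
  obtain ⟨w₀, hw₀, hlen⟩ := Finset.exists_min_image U length hne
  -- A raised word is strictly longer than some element of `U`, so it cannot be the shortest one,
  -- `w₀`.
  have hup : ∀ w ∈ U, ∀ i, w⁻¹ (lo i) < w⁻¹ (hi i) → adj i * w ∈ U.erase w₀ := by
    intro w hw i hi
    refine Finset.mem_erase.2 ⟨?_, hU.1 w hw i hi⟩
    intro he
    have h1 := length_adj_mul hi
    have h2 := hlen w hw
    rw [he] at h1; omega
  have hlt : V (U.erase w₀) < ⊤ := by
    rw [lt_top_iff_ne_top]
    intro htop
    have := hmin ⟨fun w hw i hi => hup w (Finset.mem_of_mem_erase hw) i hi, htop⟩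
      (Finset.erase_subset _ _) hw₀
    exact absurd rfl (Finset.mem_erase.1 this).1
  obtain ⟨f, hf, hker⟩ := Submodule.exists_le_ker_of_lt_top _ hlt
  have hfN : ∀ x ∈ N, f x = 0 := fun x hx =>
    hker (le_sup_left (α := Submodule F (TabSpan F D)) (by exact hx))
  have hfU : ∀ w ∈ U.erase w₀, f (tabOf F D w) = 0 := fun w hw =>
    hker (le_sup_right (α := Submodule F (TabSpan F D))
      (Submodule.subset_span ⟨w, hw, rfl⟩))
  refine ⟨f, {i | w₀⁻¹ (hi i) < w₀⁻¹ (lo i)}, hf, hfN, fun i x => ?_⟩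
  have hx : x ∈ V U := by rw [hU.2]; trivial
  obtain ⟨y, hy, z, hz, rfl⟩ := Submodule.mem_sup.1 hx
  have hy : y ∈ N := hy
  rw [smul_add, map_add, map_add, hfN y hy, hfN _ (N.smul_mem _ hy), zero_add, zero_add]
  clear hx
  induction hz using Submodule.span_induction with
  | zero => simp
  | add a b _ _ ha hb =>
    rw [smul_add, map_add, map_add, ha, hb]
    split_ifs
    · rw [neg_add]
    · rw [add_zero]
  | smul c a _ ha =>
    rw [smul_comm, f.map_smul c, f.map_smul c, ha]
    split_ifs
    · rw [smul_neg]
    · rw [smul_zero]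
  | mem a ha =>
    obtain ⟨w, hw, rfl⟩ := ha
    have hw : w ∈ U := hw
    by_cases hT : DescIn I J w
    · rw [h.genBar_smul_tabOf F hT, Set.mem_ofPred_eq]
      by_cases hww : w = w₀
      · subst hww
        split_ifs with hi
        · rw [map_neg]
        · exact hfU _ (hup w hw i ((apply_lt_or_gt w⁻¹ i).resolve_right hi))
      · have h0 := hfU w (Finset.mem_erase.2 ⟨hww, hw⟩)
        rw [h0, neg_zero, ite_self]
        split_ifs with hi
        · rw [map_neg, h0, neg_zero]
        · exact hfU _ (hup w hw i ((apply_lt_or_gt w⁻¹ i).resolve_right hi))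
    · rw [h.tabOf_eq_zero F hT]; simp

variable (h : HasType D I Set.univ)
include h

/-- Each tableau is ±π̄_w applied to the generator. So `f` is nonzero on the generator, and the
words in its support use only letters of `S`. The generator forces I ⊆ S. A longest word in the
support must be w_0(S), whose descents contain `S`; a standard word for a ribbon has descent set
`I`, so S ⊆ I. -/
theorem HasType.eq_of_isWeight {f : TabSpan F D →ₗ[F] F} {S : Set (Fin (n - 1))} (hf : f ≠ 0)
    (hS : IsWeight F S f) : S = I ∧
      ∀ w, f (tabOf F D w) ≠ 0 ↔ w = longest I := by
  classical
  have hex : ∃ w, f (tabOf F D w) ≠ 0 := by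
    by_contra! hc
    apply hf
    ext x
    induction x using h.tab_induction F with
    | h0 => simp
    | hadd x y hx hy => rw [map_add, hx, hy, map_add]
    | hsmul c x hx => rw [map_smul, hx, map_smul]
    | htab w hw => rw [hc w]; rfl
  have hkey : ∀ w, f (tabOf F D w) ≠ 0 → w ∈ parabolic S ∧ f (tabOf F D (longest I)) ≠ 0 := by
    intro w hw
    have hT := h.eq_of_tabOf hw
    rw [h.tabOf_eq_smul_longest F hT, map_smul] at hw
    have h1 := hS.apply_prod (right_ne_zero_of_smul hw)
    refine ⟨?_, h1.2⟩
    rw [← wordProd_reducedWord w]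
    exact wordProd_mem_parabolic h1.1
  have h0 : f (tabOf F D (longest I)) ≠ 0 := by
    obtain ⟨w, hw⟩ := hex
    exact (hkey w hw).2
  have hIS : I ⊆ S := by
    intro i hi
    by_contra hiS
    have h1 := hS i (tabOf F D (longest I))
    rw [h.genBar_smul_tabOf F (descIn_longest h.subset), if_pos (longest_inv_desc hi),
      if_neg hiS, map_neg, neg_eq_zero] at h1
    exact h0 h1
  have hSI : S ⊆ I := by
    obtain ⟨w, hw, hmax⟩ := Finset.exists_max_image
      (Finset.univ.filter fun w => f (tabOf F D w) ≠ 0) length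
      ⟨longest I, Finset.mem_filter.2 ⟨Finset.mem_univ _, h0⟩⟩
    have hw := (Finset.mem_filter.1 hw).2
    have hT := h.eq_of_tabOf hw
    -- For i ∈ S the functional is nonzero on π̄_i w as well. If this were the longer word s_i w,
    -- the choice of `w` would be contradicted.
    have hd : ∀ i ∈ S, w⁻¹ (hi i) < w⁻¹ (lo i) := by
      intro i hi
      refine (apply_lt_or_gt w⁻¹ i).resolve_left fun hlt => ?_
      have h1 := hS i (tabOf F D w)
      rw [h.genBar_smul_tabOf F hT, if_neg (not_lt.2 hlt.le), if_pos hi] at h1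
      have h2 := hmax (adj i * w) (Finset.mem_filter.2 ⟨Finset.mem_univ _, by
        rw [h1]; exact neg_ne_zero.2 hw⟩)
      rw [length_adj_mul hlt] at h2
      omega
    have hwS := eq_longest_of_inv_desc (hkey w hw).1 hd
    intro i hi
    exact (hT i trivial).1 (hwS ▸ longest_desc hi)
  have hSe : S = I := hSI.antisymm hIS
  refine ⟨hSe, fun w => ⟨fun hw => ?_, fun hw => hw ▸ h0⟩⟩
  exact eq_longest (hSe ▸ (hkey w hw).1) fun i hi => (h.eq_of_tabOf hw i trivial).2 hi

/-- The tableau of the longest element of the parabolic subgroup of `I`. -/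
def HasType.source : StdTableau D := h.tableau (longest I) (descIn_longest h.subset)

theorem HasType.isWeight_apply {f : TabSpan F D →ₗ[F] F} {S : Set (Fin (n - 1))} (hf : f ≠ 0)
    (hS : IsWeight F S f) (x : TabSpan F D) :
    f x = (tabBasis F D).coord h.source x * f (tabOf F D (longest I)) := by
  have hw := (h.eq_of_isWeight hf hS).2
  induction x using h.tab_induction F with
  | h0 => simp
  | hadd x y hx hy => rw [map_add, hx, hy, map_add, add_mul]
  | hsmul c x hx => rw [map_smul, hx, map_smul, smul_eq_mul, smul_eq_mul, mul_assoc]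
  | htab w hT =>
    rw [h.tabOf_eq F hT, ← tabBasis_apply, Module.Basis.coord_apply, Module.Basis.repr_self]
    by_cases hwI : w = longest I
    · subst hwI
      rw [HasType.source, Finsupp.single_eq_same, one_mul, tabBasis_apply, ← h.tabOf_eq F hT]
    · rw [Finsupp.single_eq_of_ne, zero_mul, tabBasis_apply, ← h.tabOf_eq F hT]
      · by_contra hc
        exact hwI ((hw w).1 hc)
      · intro he
        exact hwI (congrArg StdTableau.entry he).symm

/-- A weight functional that vanishes on `N` is a nonzero multiple of the coordinate of the
generator. All proper submodules thus lie in one hyperplane, from which both indecomposability and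
projectivity follow. -/
theorem HasType.coord_source_eq_zero {N : Submodule (ZeroHecke F n) (TabSpan F D)} (hN : N ≠ ⊤)
    {x : TabSpan F D} (hx : x ∈ N) : (tabBasis F D).coord h.source x = 0 := by
  obtain ⟨f, S, hf, hfN, hS⟩ := h.exists_isWeight N hN
  have h1 := h.isWeight_apply hf hS x
  rw [hfN x hx] at h1
  exact (mul_eq_zero.1 h1.symm).resolve_right (((h.eq_of_isWeight hf hS).2 _).2 rfl)

theorem HasType.isIndecomposable : IsIndecomposable (ZeroHecke F n) (TabSpan F D) := by
  have h1 : (tabBasis F D).coord h.source (tabBasis F D h.source) = 1 := by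
    rw [Module.Basis.coord_apply, Module.Basis.repr_self, Finsupp.single_eq_same]
  refine ⟨⟨tabBasis F D h.source, 0, (tabBasis F D).ne_zero _⟩, fun L N hLN => ?_⟩
  by_cases hL : L = ⊤
  · right
    rw [← hLN.inf_eq_bot, hL, top_inf_eq]
  by_cases hN : N = ⊤
  · left
    rw [← hLN.inf_eq_bot, hN, inf_top_eq]
  exfalso
  have hx : tabBasis F D h.source ∈ L ⊔ N := by rw [hLN.sup_eq_top]; trivial
  obtain ⟨y, hy, z, hz, he⟩ := Submodule.mem_sup.1 hx
  rw [← he, map_add, h.coord_source_eq_zero hL hy, h.coord_source_eq_zero hN hz, add_zero] at h1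
  exact zero_ne_one h1

/-- The embedding in H_n(0) followed by the action on the generator `t` is an endomorphism `e` with
e(t) = π̄_{w_0(I)} π_{w_0(Iᶜ)} t. The weight functional is nonzero there: letters outside `I` act
through π_i as 1, and letters in `I` act through π̄_i as -1. So the range of `e` is not proper, and
finite dimension makes `e` bijective; its inverse splits the embedding. -/
theorem HasType.projective : Module.Projective (ZeroHecke F n) (TabSpan F D) := by
  have hbot : (⊥ : Submodule (ZeroHecke F n) (TabSpan F D)) ≠ ⊤ := by
    have := (h.isIndecomposable (F := F)).1
    exact bot_ne_top
  obtain ⟨f, S, hf, -, hS⟩ := h.exists_isWeight ⊥ hbot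
  obtain ⟨rfl, hw⟩ := h.eq_of_isWeight hf hS
  let g : ZeroHecke F n →ₗ[ZeroHecke F n] TabSpan F D :=
    LinearMap.toSpanSingleton _ _ (tabOf F D (longest S))
  let e : TabSpan F D →ₗ[ZeroHecke F n] TabSpan F D := g ∘ₗ h.toHecke F
  have he : f (e (tabOf F D (longest S))) ≠ 0 := by
    have : e (tabOf F D (longest S)) = genBarPerm F (longest S) • genPerm F (longest (Set.univ \ S))
        • tabOf F D (longest S) := by
      simp only [e, g, LinearMap.comp_apply, h.toHecke_tabOf F (descIn_longest h.subset),
        LinearMap.toSpanSingleton_apply, mul_smul]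
    rw [this]
    refine hS.apply_prod_ne_zero (mem_of_mem_reducedWord (longest_mem S)) ?_
    rw [genPerm, hS.apply_prod_gen fun i hi => (mem_of_mem_reducedWord (longest_mem _) i hi).2]
    exact (hw _).2 rfl
  have hsurj : Function.Surjective e := by
    rw [← LinearMap.range_eq_top]
    by_contra hc
    have h1 := h.coord_source_eq_zero hc (LinearMap.mem_range_self e (tabOf F D (longest S)))
    rw [h.isWeight_apply hf hS, h1, zero_mul] at he
    exact he rfl
  have hinj : Function.Injective e :=
    (LinearMap.injective_iff_surjective (f := e.restrictScalars F)).2 hsurj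
  refine Module.Projective.of_split (h.toHecke F)
    ((LinearEquiv.ofBijective e ⟨hinj, hsurj⟩).symm.toLinearMap ∘ₗ g) ?_
  ext x : 1
  exact (LinearEquiv.ofBijective e ⟨hinj, hsurj⟩).symm_apply_apply x

end Ribbon

/-! ### Decomposition into modules of ribbon tableaux -/

section Decomposition

variable (F : Type*) [Field F] {n : ℕ} {I J S : Set (Fin (n - 1))} {D E : Diagram n}

/-- The descents of a permutation. -/
def descSet (w : Equiv.Perm (Fin n)) : Set (Fin (n - 1)) := {i | w (hi i) < w (lo i)}

theorem descIn_iff {w : Equiv.Perm (Fin n)} (h : I ⊆ J) : DescIn I J w ↔ descSet w ∩ J = I := by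
  constructor
  · intro hw
    ext i
    exact ⟨fun hi => (hw i hi.2).1 hi.1, fun hi => ⟨(hw i (h hi)).2 hi, h hi⟩⟩
  · rintro rfl i hi
    exact ⟨fun h => ⟨h, hi⟩, fun h => h.1⟩

theorem descIn_univ_iff {w : Equiv.Perm (Fin n)} : DescIn S Set.univ w ↔ descSet w = S := by
  rw [descIn_iff (Set.subset_univ _), Set.inter_univ]

/-- A descent could be lost only if its two values were `i + 1` followed by `i`, but here `i`
precedes `i + 1`. -/
theorem descSet_subset_adj_mul {w : Equiv.Perm (Fin n)} {i : Fin (n - 1)}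
    (h : w⁻¹ (lo i) < w⁻¹ (hi i)) : descSet w ⊆ descSet (adj i * w) := by
  intro p hp
  refine adj_lt_adj i hp ?_
  rintro ⟨h2, h3⟩
  rw [← h2, ← h3, Equiv.Perm.coe_inv, Equiv.symm_apply_apply, Equiv.symm_apply_apply] at h
  exact absurd h (not_lt.2 (lo_lt_hi p).le)

/-- The linear map that preserves the tableaux that are standard for both diagrams and annihilates
the other ones. -/
def transfer (D E : Diagram n) : TabSpan F D →ₗ[F] TabSpan F E :=
  (tabBasis F D).constr F fun τ => tabOf F E τ.entry

variable {F} in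
theorem HasType.transfer_tabOf (h : HasType D I J) {w : Equiv.Perm (Fin n)} (hw : DescIn I J w) :
    transfer F D E (tabOf F D w) = tabOf F E w := by
  rw [h.tabOf_eq F hw, transfer, ← tabBasis_apply, Module.Basis.constr_basis]; rfl

variable (hD : HasType D I J) (hE : HasType E S Set.univ)
include hD

/-- The submodule spanned by the tableaux whose reading words have all elements of `S` as
descents. -/
def HasType.descSubmodule (S : Set (Fin (n - 1))) : Submodule (ZeroHecke F n) (TabSpan F D) where
  carrier := Submodule.span F (tabOf F D '' {w | DescIn I J w ∧ S ⊆ descSet w})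
  add_mem' := Submodule.add_mem _
  zero_mem' := Submodule.zero_mem _
  smul_mem' h x hx := by
    refine smul_mem_of_genBar F _ (fun i x hx => ?_) h x hx
    induction hx using Submodule.span_induction with
    | zero => rw [smul_zero]; exact Submodule.zero_mem _
    | add x y _ _ hx hy => rw [smul_add]; exact Submodule.add_mem _ hx hy
    | smul c x _ hx => rw [smul_comm]; exact Submodule.smul_mem _ c hx
    | mem x hx =>
      obtain ⟨w, ⟨hw, hS⟩, rfl⟩ := hx
      rw [hD.genBar_smul_tabOf F hw]
      rcases apply_lt_or_gt w⁻¹ i with hlt | hgt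
      · rw [if_neg (not_lt.2 hlt.le)]
        by_cases hw' : DescIn I J (adj i * w)
        · exact Submodule.subset_span ⟨_, ⟨hw', hS.trans (descSet_subset_adj_mul hlt)⟩, rfl⟩
        · rw [hD.tabOf_eq_zero F hw']; exact Submodule.zero_mem _
      · rw [if_pos hgt]
        exact Submodule.neg_mem _ (Submodule.subset_span ⟨w, ⟨hw, hS⟩, rfl⟩)

theorem HasType.descIn_of_inter (hS : S ∩ J = I) {w : Equiv.Perm (Fin n)}
    (hw : DescIn S Set.univ w) : DescIn I J w := by
  rw [descIn_iff hD.subset, descIn_univ_iff.1 hw, hS]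

include hE

/-- A word whose descent set strictly contains `S` is annihilated by the transfer. Since
length-increasing moves never lose descents, it cannot return to descent set exactly `S`. -/
theorem HasType.transfer_genBar (hS : S ∩ J = I) (i : Fin (n - 1)) {x : TabSpan F D}
    (hx : x ∈ hD.descSubmodule F S) :
    transfer F D E (genBar F i • x) = genBar F i • transfer F D E x := by
  have htr : ∀ w, transfer F D E (tabOf F D w) = tabOf F E w := by
    intro w
    by_cases hw : DescIn I J w
    · exact hD.transfer_tabOf hw
    · rw [hD.tabOf_eq_zero F hw, map_zero,
        hE.tabOf_eq_zero F fun hw' => hw (hD.descIn_of_inter hS hw')]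
  replace hx : x ∈ Submodule.span F (tabOf F D '' {w | DescIn I J w ∧ S ⊆ descSet w}) := hx
  induction hx using Submodule.span_induction with
  | zero => simp
  | add x y _ _ hx hy => rw [smul_add, map_add, hx, hy, map_add, smul_add]
  | smul c x _ hx =>
    rw [smul_comm, (transfer F D E).map_smul c, hx, (transfer F D E).map_smul c, smul_comm]
  | mem x hx =>
    obtain ⟨w, ⟨hw, hSw⟩, rfl⟩ := hx
    rw [hD.genBar_smul_tabOf F hw, htr]
    by_cases hw' : DescIn S Set.univ w
    · rw [hE.genBar_smul_tabOf F hw']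
      split_ifs
      · rw [map_neg, htr]
      · rw [htr]
    · rw [hE.tabOf_eq_zero F hw', smul_zero]
      split_ifs with hgt
      · rw [map_neg, htr, hE.tabOf_eq_zero F hw', neg_zero]
      · rw [htr, hE.tabOf_eq_zero F]
        intro h1
        have hlt := (apply_lt_or_gt w⁻¹ i).resolve_right hgt
        rw [descIn_univ_iff] at hw' h1
        exact hw' ((h1 ▸ descSet_subset_adj_mul hlt).antisymm hSw)

/-- The transfer is a surjection from the submodule of words with descents containing `S` onto the
ribbon module, and it splits because the latter is projective. Its kernel involves only words with
strictly more descents, which gives the triangular form of the section. -/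
theorem HasType.exists_section (hS : S ∩ J = I) :
    ∃ s : TabSpan F E →ₗ[ZeroHecke F n] TabSpan F D, ∀ w, DescIn S Set.univ w →
      s (tabOf F E w) - tabOf F D w ∈
        Submodule.span F (tabOf F D '' {v | DescIn I J v ∧ S ⊂ descSet v}) := by
  let V := hD.descSubmodule F S
  let q₀ : V →ₗ[F] TabSpan F E :=
    { toFun := fun x => transfer F D E x.1
      map_add' := fun x y => (transfer F D E).map_add x.1 y.1
      map_smul' := fun c x => (transfer F D E).map_smul c x.1 }
  let q : V →ₗ[ZeroHecke F n] TabSpan F E :=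
    homOfGenBar F q₀ fun i x => hD.transfer_genBar F hE hS i x.2
  have hmem : ∀ w, DescIn S Set.univ w → tabOf F D w ∈ V := fun w hw =>
    Submodule.subset_span (s := tabOf F D '' {w | DescIn I J w ∧ S ⊆ descSet w})
      ⟨w, ⟨hD.descIn_of_inter hS hw, (descIn_univ_iff.1 hw).ge⟩, rfl⟩
  have hq : Function.Surjective q := by
    intro x
    induction x using hE.tab_induction F with
    | h0 => exact ⟨0, map_zero _⟩
    | hadd x y hx hy =>
      obtain ⟨a, rfl⟩ := hx
      obtain ⟨b, rfl⟩ := hy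
      exact ⟨a + b, map_add _ _ _⟩
    | hsmul c x hx =>
      obtain ⟨a, rfl⟩ := hx
      exact ⟨c • a, LinearMap.map_smul_of_tower _ _ _⟩
    | htab w hw =>
      exact ⟨⟨tabOf F D w, hmem w hw⟩, hD.transfer_tabOf (hD.descIn_of_inter hS hw)⟩
  have := hE.projective (F := F)
  obtain ⟨s, hs⟩ := Module.projective_lifting_property q LinearMap.id hq
  refine ⟨V.subtype ∘ₗ s, fun w hw => ?_⟩
  have key : ∀ z ∈ V, z - transfer F E D (transfer F D E z) ∈
      Submodule.span F (tabOf F D '' {v | DescIn I J v ∧ S ⊂ descSet v}) := by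
    intro z hz
    replace hz : z ∈ Submodule.span F (tabOf F D '' {w | DescIn I J w ∧ S ⊆ descSet w}) := hz
    induction hz using Submodule.span_induction with
    | zero => simp
    | add x y _ _ hx hy =>
      rw [map_add, map_add, add_sub_add_comm]; exact Submodule.add_mem _ hx hy
    | smul c x _ hx =>
      rw [map_smul, map_smul, ← smul_sub]; exact Submodule.smul_mem _ c hx
    | mem x hx =>
      obtain ⟨v, ⟨hv, hSv⟩, rfl⟩ := hx
      rw [hD.transfer_tabOf hv]
      by_cases hv' : DescIn S Set.univ v
      · rw [hE.transfer_tabOf hv', sub_self]; exact Submodule.zero_mem _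
      · rw [hE.tabOf_eq_zero F hv', map_zero, sub_zero]
        refine Submodule.subset_span ⟨v, ⟨hv, hSv.ssubset_of_ne fun h => hv' ?_⟩, rfl⟩
        rw [descIn_univ_iff, h]
  have h1 : transfer F D E (s (tabOf F E w)) = tabOf F E w :=
    congrArg (fun f : TabSpan F E →ₗ[ZeroHecke F n] TabSpan F E => f (tabOf F E w)) hs
  have h2 := key _ (s (tabOf F E w)).2
  rw [h1, hE.transfer_tabOf hw] at h2
  exact h2

omit hE

/-- The module of tableaux of a shape of type `I`, `J` is the direct sum of the modules of tableaux
of all ribbons with descent set `S` such that `S ∩ J = I`. -/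
theorem HasType.nonempty_equiv_directSum {ι : Type*} {E : ι → Diagram n}
    {S : ι → Set (Fin (n - 1))} (hE : ∀ b, HasType (E b) (S b) Set.univ)
    (hinj : Function.Injective S) (hS : ∀ b, S b ∩ J = I)
    (hsurj : ∀ X : Set (Fin (n - 1)), X ∩ J = I → ∃ b, S b = X) :
    Nonempty (TabSpan F D ≃ₗ[ZeroHecke F n] ⨁ b, TabSpan F (E b)) := by
  classical
  choose s hs using fun b => hD.exists_section F (hE b) (hS b)
  let Φ : (⨁ b, TabSpan F (E b)) →ₗ[ZeroHecke F n] TabSpan F D := DirectSum.toModule _ _ _ s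
  have : IsScalarTower F (ZeroHecke F n) (⨁ b, TabSpan F (E b)) :=
    inferInstanceAs (IsScalarTower F (ZeroHecke F n) (Π₀ b, TabSpan F (E b)))
  let y : (Σ b, StdTableau (E b)) → ⨁ b, TabSpan F (E b) := fun p =>
    DirectSum.lof (ZeroHecke F n) ι (fun b => TabSpan F (E b)) p.1 (tab F p.2)
  have hΦy : ∀ p, Φ (y p) = s p.1 (tab F p.2) := fun p => DirectSum.toModule_lof _ _ _
  have hspan : Submodule.span F (Set.range y) = ⊤ := by
    rw [eq_top_iff]
    intro x _
    induction x using DirectSum.induction_on with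
    | zero => exact Submodule.zero_mem _
    | add x y hx hy => exact Submodule.add_mem _ (hx trivial) (hy trivial)
    | of b x =>
      induction x using (hE b).tab_induction F with
      | h0 => rw [map_zero]; exact Submodule.zero_mem _
      | hadd x y hx hy => rw [map_add]; exact Submodule.add_mem _ (hx trivial) (hy trivial)
      | hsmul c x hx =>
        have := Submodule.smul_mem _ c (hx trivial)
        rwa [← DirectSum.of_smul] at this
      | htab w hw =>
        rw [(hE b).tabOf_eq F hw]
        exact Submodule.subset_span ⟨⟨b, _⟩, rfl⟩
  let f : (Σ b, StdTableau (E b)) → StdTableau D := fun p =>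
    hD.tableau p.2.entry (hD.descIn_of_inter (hS p.1) ((hE p.1).descIn p.2))
  -- The descent set of a standard word for `D` meets `J` in `I`, so it equals `S b` for exactly one
  -- `b`.
  have hf : Function.Bijective f := by
    constructor
    · rintro ⟨b, τ⟩ ⟨b', τ'⟩ h
      have he : τ.entry = τ'.entry := congrArg StdTableau.entry h
      have h1 := descIn_univ_iff.1 ((hE b).descIn τ)
      have h2 := descIn_univ_iff.1 ((hE b').descIn τ')
      obtain rfl : b = b' := hinj (by rw [← h1, ← h2, he])
      rw [StdTableau.ext' he]
    · intro τ
      obtain ⟨b, hb⟩ := hsurj _ ((descIn_iff hD.subset).1 (hD.descIn τ))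
      exact ⟨⟨b, (hE b).tableau τ.entry (descIn_univ_iff.2 hb.symm)⟩, rfl⟩
  have hLI : LinearIndependent F fun p => Φ.restrictScalars F (y p) := by
    refine linearIndependent_of_triangular (tabBasis F D) hf.injective
      (fun τ => (descSet τ.entry).ncard) ?_
    rintro ⟨b, τ⟩
    have hτ := (hE b).descIn τ
    have h1 := hs b τ.entry hτ
    rw [tabOf_entry] at h1
    rw [LinearMap.restrictScalars_apply, hΦy, tabBasis_apply, ← tabOf_entry F (f _)]
    refine Submodule.span_mono ?_ h1
    rintro _ ⟨v, ⟨hv, hv'⟩, rfl⟩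
    refine ⟨hD.tableau v hv, ?_, ?_⟩
    · refine Set.ncard_lt_ncard ?_ (Set.toFinite _)
      change descSet τ.entry ⊂ descSet v
      rwa [descIn_univ_iff.1 hτ]
    · rw [tabBasis_apply, hD.tabOf_eq F hv]
  have hΦi : Function.Injective Φ :=
    injective_of_linearIndependent (Φ.restrictScalars F) hspan hLI
  have hΦs : Function.Surjective Φ := by
    have := Fintype.ofFinite (StdTableau D)
    have := Fintype.ofBijective (Equiv.ofBijective f hf).symm (Equiv.bijective _)
    -- The independent family has as many members as there are standard tableaux of shape `D`, so it
    -- spans.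
    have h1 := hLI.span_eq_top_of_card_eq_finrank' (by
      rw [Module.finrank_eq_card_basis (tabBasis F D)]
      exact Fintype.card_congr (Equiv.ofBijective f hf))
    have h2 : LinearMap.range (Φ.restrictScalars F) = ⊤ := by
      rw [eq_top_iff, ← h1, Submodule.span_le]
      rintro _ ⟨p, rfl⟩
      exact LinearMap.mem_range_self _ _
    exact (LinearMap.range_eq_top (f := Φ.restrictScalars F)).1 h2
  exact ⟨(LinearEquiv.ofBijective Φ ⟨hΦi, hΦs⟩).symm⟩

end Decomposition

/-! ### Descent sets of compositions -/

section Lists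

theorem descents_nil : descents [] = ∅ := by
  ext d; simp [descents]

theorem descents_singleton (x : ℕ) : descents [x] = ∅ := by
  ext d
  simp only [descents, List.length_singleton, Set.mem_ofPred_eq, Set.mem_empty_iff_false, iff_false]
  rintro ⟨j, h1, h2, -⟩; omega

theorem descents_cons (x : ℕ) {t : List ℕ} (ht : t ≠ []) :
    descents (x :: t) = insert x ((x + ·) '' descents t) := by
  have ht := List.length_pos_iff.2 ht
  ext d
  simp only [descents, List.length_cons, Set.mem_ofPred_eq, Set.mem_insert_iff, Set.mem_image]
  constructor
  · rintro ⟨j, h1, h2, rfl⟩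
    obtain ⟨j, rfl⟩ : ∃ k, j = k + 1 := ⟨j - 1, by omega⟩
    rw [List.take_succ_cons, List.sum_cons]
    rcases Nat.eq_zero_or_pos j with rfl | hj
    · left; simp
    · right; exact ⟨_, ⟨j, hj, by omega, rfl⟩, rfl⟩
  · rintro (rfl | ⟨_, ⟨j, h1, h2, rfl⟩, rfl⟩)
    · exact ⟨1, le_rfl, by omega, by simp⟩
    · exact ⟨j + 1, by omega, by omega, by simp⟩

theorem mem_descents_cons {x d : ℕ} {t : List ℕ} (ht : t ≠ []) :
    d ∈ descents (x :: t) ↔ d = x ∨ ∃ e ∈ descents t, x + e = d := by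
  rw [descents_cons x ht]; rfl

theorem mem_descents_append {a b : List ℕ} (ha : a ≠ []) (hb : b ≠ []) {d : ℕ} :
    d ∈ descents (a ++ b) ↔ d ∈ descents a ∨ d = a.sum ∨ ∃ e ∈ descents b, a.sum + e = d := by
  induction a generalizing d with
  | nil => exact absurd rfl ha
  | cons x a ih =>
    rcases eq_or_ne a [] with rfl | ha'
    · rw [List.singleton_append, mem_descents_cons hb, descents_singleton]; simp
    · rw [List.cons_append, mem_descents_cons (by simp [hb]), mem_descents_cons ha', List.sum_cons]
      simp only [ih ha']
      constructor
      · rintro (h | ⟨e, h | rfl | ⟨f, hf, rfl⟩, rfl⟩)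
        · exact Or.inl (Or.inl h)
        · exact Or.inl (Or.inr ⟨e, h, rfl⟩)
        · exact Or.inr (Or.inl rfl)
        · exact Or.inr (Or.inr ⟨f, hf, by omega⟩)
      · rintro ((h | ⟨e, h, rfl⟩) | rfl | ⟨f, hf, rfl⟩)
        · exact Or.inl h
        · exact Or.inr ⟨e, Or.inl h, rfl⟩
        · exact Or.inr ⟨_, Or.inr (Or.inl rfl), rfl⟩
        · exact Or.inr ⟨a.sum + f, Or.inr (Or.inr ⟨f, hf, rfl⟩), by omega⟩

theorem near_cons_ne_nil (x : ℕ) (a b : List ℕ) : near (x :: a) b ≠ [] := by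
  cases a with
  | nil => cases b <;> simp [near]
  | cons y a => simp [near]

theorem near_ne_nil {a b : List ℕ} (hb : b ≠ []) : near a b ≠ [] := by
  cases a with
  | nil => simpa [near] using hb
  | cons x a => exact near_cons_ne_nil x a b

theorem sum_near (a b : List ℕ) : (near a b).sum = a.sum + b.sum := by
  induction a with
  | nil => simp [near]
  | cons x a ih =>
    cases a with
    | nil => cases b <;> simp [near, add_assoc]
    | cons y a => rw [near, List.sum_cons, ih, List.sum_cons (a := x), add_assoc]

theorem pos_near {a b : List ℕ} (ha : ∀ x ∈ a, 0 < x) (hb : ∀ x ∈ b, 0 < x) :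
    ∀ x ∈ near a b, 0 < x := by
  induction a with
  | nil => simpa [near] using hb
  | cons x a ih =>
    rw [List.forall_mem_cons] at ha
    cases a with
    | nil =>
      cases b with
      | nil => simpa [near] using ha.1
      | cons y b =>
        rw [List.forall_mem_cons] at hb
        rw [near, List.forall_mem_cons]
        exact ⟨by omega, hb.2⟩
    | cons y a =>
      rw [near, List.forall_mem_cons]
      exact ⟨ha.1, ih ha.2⟩

theorem mem_descents_near {a b : List ℕ} {d : ℕ} :
    d ∈ descents (near a b) ↔ d ∈ descents a ∨ ∃ e ∈ descents b, a.sum + e = d := by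
  induction a generalizing d with
  | nil => simp [near, descents_nil]
  | cons x a ih =>
    cases a with
    | nil =>
      cases b with
      | nil => simp [near, descents_nil]
      | cons y b =>
        rw [near, descents_singleton, List.sum_singleton]
        rcases eq_or_ne b [] with rfl | hb
        · simp [descents_singleton]
        · rw [mem_descents_cons hb]
          simp only [mem_descents_cons hb, Set.mem_empty_iff_false, false_or]
          constructor
          · rintro (rfl | ⟨e, he, rfl⟩)
            · exact ⟨y, Or.inl rfl, rfl⟩
            · exact ⟨y + e, Or.inr ⟨e, he, rfl⟩, by omega⟩
          · rintro ⟨_, rfl | ⟨e, he, rfl⟩, rfl⟩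
            · exact Or.inl rfl
            · exact Or.inr ⟨e, he, by omega⟩
    | cons y a =>
      rw [near, mem_descents_cons (near_cons_ne_nil y a b), mem_descents_cons (by simp),
        List.sum_cons]
      simp only [ih]
      constructor
      · rintro (h | ⟨e, h | ⟨f, hf, rfl⟩, rfl⟩)
        · exact Or.inl (Or.inl h)
        · exact Or.inl (Or.inr ⟨e, h, rfl⟩)
        · exact Or.inr ⟨f, hf, by omega⟩
      · rintro ((h | ⟨e, h, rfl⟩) | ⟨f, hf, rfl⟩)
        · exact Or.inl h
        · exact Or.inr ⟨e, Or.inl h, rfl⟩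
        · exact Or.inr ⟨_, Or.inr ⟨f, hf, rfl⟩, by omega⟩

theorem mem_descents_bound {l : List ℕ} (hl : ∀ x ∈ l, 0 < x) {d : ℕ} (hd : d ∈ descents l) :
    0 < d ∧ d < l.sum := by
  induction l generalizing d with
  | nil => simp [descents_nil] at hd
  | cons x t ih =>
    rw [List.forall_mem_cons] at hl
    rcases eq_or_ne t [] with rfl | ht
    · simp [descents_singleton] at hd
    · have h0 : 0 < t.sum := by
        obtain ⟨y, t, rfl⟩ := List.exists_cons_of_ne_nil ht
        have := hl.2 y (by simp)
        rw [List.sum_cons]; omega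
      rw [mem_descents_cons ht] at hd
      rw [List.sum_cons]
      rcases hd with rfl | ⟨e, he, rfl⟩
      · omega
      · have := ih hl.2 he; omega

/-- With positive parts, the first part is the smallest descent if there is one. The other descents,
shifted by it, are those of the tail. -/
theorem eq_of_descents_eq {l l' : List ℕ} (hl : ∀ x ∈ l, 0 < x) (hl' : ∀ x ∈ l', 0 < x)
    (hs : l.sum = l'.sum) (h : descents l = descents l') : l = l' := by
  induction l generalizing l' with
  | nil =>
    cases l' with
    | nil => rfl
    | cons x t =>
      have := hl' x (by simp)
      simp at hs; omega
  | cons x t ih =>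
    cases l' with
    | nil =>
      have := hl x (by simp)
      simp at hs; omega
    | cons x' t' =>
      rw [List.sum_cons, List.sum_cons] at hs
      rw [List.forall_mem_cons] at hl hl'
      rcases eq_or_ne t [] with rfl | ht
      · rcases eq_or_ne t' [] with rfl | ht'
        · simpa using hs
        · rw [descents_singleton, descents_cons x' ht'] at h
          exact absurd h.symm ((Set.insert_nonempty _ _).ne_empty)
      · rcases eq_or_ne t' [] with rfl | ht'
        · rw [descents_singleton, descents_cons x ht] at h
          exact absurd h ((Set.insert_nonempty _ _).ne_empty)
        · have hd : ∀ d, (d = x ∨ ∃ e ∈ descents t, x + e = d) ↔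
              (d = x' ∨ ∃ e ∈ descents t', x' + e = d) := by
            intro d
            rw [← mem_descents_cons ht, ← mem_descents_cons ht', h]
          have h1 : x' ≤ x := by
            rcases (hd x).1 (Or.inl rfl) with h | ⟨e, -, h⟩ <;> omega
          have h2 : x ≤ x' := by
            rcases (hd x').2 (Or.inl rfl) with h | ⟨e, -, h⟩ <;> omega
          obtain rfl : x = x' := le_antisymm h2 h1
          rw [ih hl.2 hl'.2 (by omega)]
          ext e
          constructor
          · intro he
            have := mem_descents_bound hl.2 he
            rcases (hd (x + e)).1 (Or.inr ⟨e, he, rfl⟩) with h | ⟨f, hf, h⟩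
            · omega
            · rwa [← Nat.add_left_cancel h]
          · intro he
            have := mem_descents_bound hl'.2 he
            rcases (hd (x + e)).2 (Or.inr ⟨e, he, rfl⟩) with h | ⟨f, hf, h⟩
            · omega
            · rwa [← Nat.add_left_cancel h]

/-- A sequence of nonempty sequences of positive integers. -/
def Proper (L : List (List ℕ)) : Prop := ∀ a ∈ L, a ≠ [] ∧ ∀ x ∈ a, 0 < x

theorem proper_append_singleton {L : List (List ℕ)} {a : List ℕ} :
    Proper (L ++ [a]) ↔ Proper L ∧ a ≠ [] ∧ ∀ x ∈ a, 0 < x := by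
  rw [Proper, List.forall_mem_append, List.forall_mem_singleton]; rfl

theorem nearProd_append_singleton (L : List (List ℕ)) (a : List ℕ) :
    nearProd (L ++ [a]) = near (nearProd L) a := by
  simp [nearProd]

theorem sum_nearProd (L : List (List ℕ)) : (nearProd L).sum = (L.map List.sum).sum := by
  induction L using List.reverseRecOn with
  | nil => rfl
  | append_singleton L a ih => rw [nearProd_append_singleton, sum_near, ih]; simp

theorem pos_nearProd {L : List (List ℕ)} (h : Proper L) : ∀ x ∈ nearProd L, 0 < x := by
  induction L using List.reverseRecOn with
  | nil => simp [nearProd]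
  | append_singleton L a ih =>
    rw [proper_append_singleton] at h
    rw [nearProd_append_singleton]
    exact pos_near (ih h.1) h.2.2

theorem pos_map_sum {L : List (List ℕ)} (h : Proper L) : ∀ x ∈ L.map List.sum, 0 < x := by
  intro x hx
  obtain ⟨a, ha, rfl⟩ := List.mem_map.1 hx
  obtain ⟨y, t, rfl⟩ := List.exists_cons_of_ne_nil (h a ha).1
  have := (h _ ha).2 y (by simp)
  rw [List.sum_cons]; omega

theorem mem_descents_map_sum {L : List (List ℕ)} (hL : L ≠ []) {a : List ℕ} {d : ℕ} :
    d ∈ descents ((L ++ [a]).map List.sum) ↔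
      d ∈ descents (L.map List.sum) ∨ d = (L.map List.sum).sum := by
  rw [List.map_append, List.map_singleton, mem_descents_append (by simpa using hL) (by simp),
    descents_singleton]
  simp

/-- Concatenation keeps the boundaries between components as descents, while near-concatenation
erases them. The partial sums of the component sizes are exactly these boundaries. -/
theorem mem_descents_flatten {L : List (List ℕ)} (h : Proper L) {d : ℕ} :
    d ∈ descents L.flatten ↔ d ∈ descents (nearProd L) ∨ d ∈ descents (L.map List.sum) := by
  induction L using List.reverseRecOn generalizing d with
  | nil => simp [nearProd]
  | append_singleton L a ih =>
    rw [proper_append_singleton] at h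
    rcases eq_or_ne L [] with rfl | hL
    · simp [nearProd, near, descents_singleton]
    · have hne : L.flatten ≠ [] := by
        obtain ⟨b, L, rfl⟩ := List.exists_cons_of_ne_nil hL
        have := (h.1 b (by simp)).1
        simp [this]
      rw [mem_descents_map_sum hL, nearProd_append_singleton, mem_descents_near,
        List.flatten_append, List.flatten_singleton, mem_descents_append hne h.2.1, ih h.1,
        sum_nearProd, List.sum_flatten]
      generalize (∃ e ∈ descents a, (L.map List.sum).sum + e = d) = P
      tauto

theorem notMem_descents_nearProd {L : List (List ℕ)} (h : Proper L) {d : ℕ}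
    (hd : d ∈ descents (L.map List.sum)) : d ∉ descents (nearProd L) := by
  induction L using List.reverseRecOn generalizing d with
  | nil => simp [descents_nil] at hd
  | append_singleton L a ih =>
    rw [proper_append_singleton] at h
    rcases eq_or_ne L [] with rfl | hL
    · simp [descents_singleton] at hd
    · rw [mem_descents_map_sum hL] at hd
      rw [nearProd_append_singleton, mem_descents_near, sum_nearProd]
      rintro (h1 | ⟨e, he, rfl⟩)
      · rcases hd with hd | rfl
        · exact ih h.1 hd h1
        · have := (mem_descents_bound (pos_nearProd h.1) h1).2
          rw [sum_nearProd] at this; omega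
      · have h2 := (mem_descents_bound h.2.2 he).1
        rcases hd with hd | hd
        · have := (mem_descents_bound (pos_map_sum h.1) hd).2
          omega
        · omega

theorem mem_descents_nearProd {L : List (List ℕ)} {d : ℕ} : d ∈ descents (nearProd L) ↔
    ∃ (k : ℕ) (hk : k < L.length), ∃ e ∈ descents L[k], ((L.take k).map List.sum).sum + e = d := by
  induction L using List.reverseRecOn generalizing d with
  | nil => simp [nearProd, descents_nil]
  | append_singleton L a ih =>
    rw [nearProd_append_singleton, mem_descents_near, sum_nearProd, ih]
    constructor
    · rintro (⟨k, hk, e, he, rfl⟩ | ⟨e, he, rfl⟩)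
      · refine ⟨k, by simp; omega, e, ?_, ?_⟩
        · rwa [List.getElem_append_left hk]
        · rw [List.take_append_of_le_length hk.le]
      · refine ⟨L.length, by simp, e, ?_, ?_⟩
        · simpa using he
        · rw [List.take_append_of_le_length le_rfl, List.take_length]
    · rintro ⟨k, hk, e, he, rfl⟩
      rw [List.length_append, List.length_singleton] at hk
      rcases (Nat.lt_succ_iff.1 hk).lt_or_eq with hk' | rfl
      · left
        rw [List.getElem_append_left hk'] at he
        exact ⟨k, hk', e, he, by rw [List.take_append_of_le_length hk'.le]⟩
      · right
        refine ⟨e, by simpa using he, ?_⟩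
        rw [List.take_append_of_le_length le_rfl, List.take_length]

theorem mem_glue_append_singleton {L : List (List ℕ)} {a b : List ℕ} :
    b ∈ glue (L ++ [a]) ↔ ∃ c ∈ glue L, b = c ++ a ∨ b = near c a := by
  simp only [glue, List.foldl_append, List.foldl_cons, List.foldl_nil, Set.mem_union, Set.mem_image]
  constructor
  · rintro (⟨c, hc, rfl⟩ | ⟨c, hc, rfl⟩)
    · exact ⟨c, hc, Or.inl rfl⟩
    · exact ⟨c, hc, Or.inr rfl⟩
  · rintro ⟨c, hc, rfl | rfl⟩
    · exact Or.inl ⟨c, hc, rfl⟩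
    · exact Or.inr ⟨c, hc, rfl⟩

theorem mem_glue_nil {b : List ℕ} : b ∈ glue [] ↔ b = [] := Iff.rfl

/-- At each boundary between components, · keeps the boundary as a descent and ▷ drops it; `X` is
the set of boundaries kept. The inner descents are always those of the near-product. -/
theorem mem_glue_imp {L : List (List ℕ)} (h : Proper L) {b : List ℕ} (hb : b ∈ glue L) :
    (∀ x ∈ b, 0 < x) ∧ b.sum = (L.map List.sum).sum ∧ (L ≠ [] → b ≠ []) ∧
      ∃ X ⊆ descents (L.map List.sum), descents b = descents (nearProd L) ∪ X := by
  induction L using List.reverseRecOn generalizing b with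
  | nil =>
    rw [mem_glue_nil] at hb
    subst hb
    exact ⟨by simp, rfl, by simp, ∅, Set.empty_subset _, by simp [nearProd]⟩
  | append_singleton L a ih =>
    rw [proper_append_singleton] at h
    obtain ⟨c, hc, hb⟩ := mem_glue_append_singleton.1 hb
    obtain ⟨h1, h2, h3, X, hX, hcX⟩ := ih h.1 hc
    have hsum : ((L ++ [a]).map List.sum).sum = c.sum + a.sum := by simp [h2]
    have hnear : (∀ x ∈ near c a, 0 < x) ∧ (near c a).sum = ((L ++ [a]).map List.sum).sum ∧
        (L ++ [a] ≠ [] → near c a ≠ []) ∧ ∃ X ⊆ descents ((L ++ [a]).map List.sum),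
          descents (near c a) = descents (nearProd (L ++ [a])) ∪ X := by
      refine ⟨pos_near h1 h.2.2, by rw [hsum, sum_near], fun _ => near_ne_nil h.2.1, X, ?_, ?_⟩
      · rcases eq_or_ne L [] with rfl | hL
        · intro d hd
          have := hX hd
          simp [descents_nil] at this
        · intro d hd
          exact (mem_descents_map_sum hL).2 (Or.inl (hX hd))
      · ext d
        rw [Set.mem_union, nearProd_append_singleton, mem_descents_near, mem_descents_near, hcX,
          Set.mem_union, sum_nearProd, h2]
        generalize (∃ e ∈ descents a, (L.map List.sum).sum + e = d) = P
        tauto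
    rcases hb with rfl | rfl
    · rcases eq_or_ne L [] with rfl | hL
      -- For the first component the accumulated sequence is empty. Both ways of gluing then give
      -- `a`, and no boundary arises.
      · rw [mem_glue_nil] at hc
        subst hc
        simpa [near] using hnear
      · refine ⟨List.forall_mem_append.2 ⟨h1, h.2.2⟩, by rw [hsum, List.sum_append],
          fun _ => by simp [h.2.1], insert (L.map List.sum).sum X, ?_, ?_⟩
        · rintro d (rfl | hd)
          · exact (mem_descents_map_sum hL).2 (Or.inr rfl)
          · exact (mem_descents_map_sum hL).2 (Or.inl (hX hd))
        · ext d
          rw [Set.mem_union, nearProd_append_singleton, mem_descents_near,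
            mem_descents_append (h3 hL) h.2.1, hcX, Set.mem_union, sum_nearProd, h2,
            Set.mem_insert_iff]
          generalize (∃ e ∈ descents a, (L.map List.sum).sum + e = d) = P
          tauto
    · exact hnear

theorem exists_mem_glue {L : List (List ℕ)} (h : Proper L) (X : Set ℕ)
    (hX : X ⊆ descents (L.map List.sum)) :
    ∃ b ∈ glue L, descents b = descents (nearProd L) ∪ X := by
  induction L using List.reverseRecOn generalizing X with
  | nil =>
    refine ⟨[], rfl, ?_⟩
    rw [List.map_nil, descents_nil, Set.subset_empty_iff] at hX
    simp [hX, nearProd]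
  | append_singleton L a ih =>
    rw [proper_append_singleton] at h
    obtain ⟨c, hc, hcX⟩ := ih h.1 (X ∩ descents (L.map List.sum)) Set.inter_subset_right
    obtain ⟨-, h2, h3, -⟩ := mem_glue_imp h.1 hc
    -- The newest boundary is the sum of the earlier sizes; it belongs to `X` exactly when the last
    -- component has to be attached by concatenation.
    by_cases hs : (L.map List.sum).sum ∈ X
    · have hL : L ≠ [] := by
        rintro rfl
        have := hX hs
        simp [descents_singleton] at this
      refine ⟨c ++ a, mem_glue_append_singleton.2 ⟨c, hc, Or.inl rfl⟩, ?_⟩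
      ext d
      have h4 : d ∈ X → d ∈ descents (L.map List.sum) ∨ d = (L.map List.sum).sum := fun hd =>
        (mem_descents_map_sum hL).1 (hX hd)
      have h5 : d = (L.map List.sum).sum → d ∈ X := fun h => h ▸ hs
      rw [Set.mem_union, nearProd_append_singleton, mem_descents_near,
        mem_descents_append (h3 hL) h.2.1, hcX, Set.mem_union, sum_nearProd, h2, Set.mem_inter_iff]
      generalize (∃ e ∈ descents a, (L.map List.sum).sum + e = d) = P
      tauto
    · refine ⟨near c a, mem_glue_append_singleton.2 ⟨c, hc, Or.inr rfl⟩, ?_⟩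
      ext d
      have h4 : d ∈ X → d ∈ descents (L.map List.sum) := by
        intro hd
        have hd' := hX hd
        rcases eq_or_ne L [] with rfl | hL
        · simp [descents_singleton] at hd'
        · exact ((mem_descents_map_sum hL).1 hd').resolve_right fun he => hs (he ▸ hd)
      rw [Set.mem_union, nearProd_append_singleton, mem_descents_near, mem_descents_near, hcX,
        Set.mem_union, sum_nearProd, h2, Set.mem_inter_iff]
      generalize (∃ e ∈ descents a, (L.map List.sum).sum + e = d) = P
      tauto

theorem mem_descents_replicate_one {m d : ℕ} :
    d ∈ descents (List.replicate m 1) ↔ 0 < d ∧ d < m := by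
  constructor
  · rintro ⟨j, h1, h2, rfl⟩
    rw [List.length_replicate] at h2
    simp [List.take_replicate]; omega
  · rintro ⟨h1, h2⟩
    exact ⟨d, h1, by simpa using h2, by simp [List.take_replicate]; omega⟩

/-- The concatenation of the columns is a single column, for which every d strictly between 0 and
the size is a descent. These descents are the disjoint union of those of the near-product and the
boundaries. Hence `J` consists of the generators that do not cross a boundary. -/
theorem mem_descents_nearProd_replicate {l : List ℕ} (hl : ∀ x ∈ l, 0 < x) {d : ℕ}
    (h0 : 0 < d) (hd : d < l.sum) :
    d ∈ descents (nearProd (l.map fun m => List.replicate m 1)) ↔ d ∉ descents l := by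
  have hP : Proper (l.map fun m => List.replicate m 1) := by
    intro a ha
    obtain ⟨m, hm, rfl⟩ := List.mem_map.1 ha
    refine ⟨by simpa using (hl m hm).ne', fun x hx => ?_⟩
    rw [List.eq_of_mem_replicate hx]; exact one_pos
  have hsum : (l.map fun m => List.replicate m 1).map List.sum = l := by
    rw [List.map_map]; simp [Function.comp_def]
  have hfl : (l.map fun m => List.replicate m 1).flatten = List.replicate l.sum 1 := by
    rw [List.eq_replicate_iff]
    constructor
    · rw [List.length_flatten, List.map_map]; simp [Function.comp_def]
    · intro x hx
      obtain ⟨a, ha, hx⟩ := List.mem_flatten.1 hx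
      obtain ⟨m, hm, rfl⟩ := List.mem_map.1 ha
      exact List.eq_of_mem_replicate hx
  have h1 := mem_descents_flatten hP (d := d)
  rw [hfl, hsum, mem_descents_replicate_one] at h1
  have h2 := fun h => notMem_descents_nearProd hP (d := d) h
  rw [hsum] at h2
  tauto

end Lists

/-! ### Types of ribbon diagrams -/

section RibbonType

variable {n : ℕ}

theorem index_eq_of_sizeUpTo (c : Composition n) {x : Fin n} {k : Fin c.length}
    (h1 : c.sizeUpTo k ≤ x) (h2 : (x : ℕ) < c.sizeUpTo (k + 1)) : c.index x = k :=
  (c.mem_range_embedding_iff'.1 (c.mem_range_embedding_iff.2 ⟨h1, h2⟩)).symm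

theorem mem_descGens_iff (c : Composition n) (i : Fin (n - 1)) : i ∈ descGens n c.blocks ↔
    ∃ k, 1 ≤ k ∧ k < c.length ∧ (i : ℕ) + 1 = c.sizeUpTo k := Iff.rfl

theorem index_hi_of_mem (c : Composition n) {i : Fin (n - 1)} (h : i ∈ descGens n c.blocks) :
    (c.index (hi i) : ℕ) = c.index (lo i) + 1 := by
  obtain ⟨k, h1, h2, h3⟩ := (mem_descGens_iff c i).1 h
  obtain ⟨k, rfl⟩ : ∃ m, k = m + 1 := ⟨k - 1, by omega⟩
  have e1 : c.index (hi i) = ⟨k + 1, h2⟩ := by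
    apply index_eq_of_sizeUpTo
    · rw [val_hi]; exact h3.ge
    · rw [val_hi, h3]; exact c.sizeUpTo_strict_mono h2
  have e2 : c.index (lo i) = ⟨k, by omega⟩ := by
    have := c.sizeUpTo_strict_mono (i := k) (by omega)
    apply index_eq_of_sizeUpTo
    · rw [val_lo]; change c.sizeUpTo k ≤ _; omega
    · rw [val_lo]; change _ < c.sizeUpTo (k + 1); omega
  rw [e1, e2]

theorem index_hi_of_notMem (c : Composition n) {i : Fin (n - 1)} (h : i ∉ descGens n c.blocks) :
    c.index (hi i) = c.index (lo i) := by
  have h1 := c.sizeUpTo_index_le (lo i)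
  have h2 := c.lt_sizeUpTo_index_succ (lo i)
  have h2' : (lo i : ℕ) < c.sizeUpTo (c.index (lo i) + 1) := h2
  rw [val_lo] at h1 h2'
  apply index_eq_of_sizeUpTo
  · rw [val_hi]; omega
  · rw [val_hi]
    refine lt_of_le_of_ne h2' fun he => h ?_
    have he : (i : ℕ) + 1 = c.sizeUpTo (c.index (lo i) + 1) := he
    refine (mem_descGens_iff c i).2 ⟨_, by omega, ?_, he⟩
    by_contra hc
    -- After the last block the partial sum is n, whereas i + 1 < n.
    rw [c.sizeUpTo_ofLength_le _ (by omega)] at he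
    have := i.2; omega

theorem hasType_ribbon (α : Composition n) :
    HasType (ribbon α) (descGens n α.blocks) Set.univ where
  subset := Set.subset_univ _
  right i _ hi := by
    have := index_hi_of_notMem α hi
    simp only [ribbon, this, val_lo, val_hi]
    exact ⟨trivial, by push_cast; omega⟩
  up i hi := by
    have := index_hi_of_mem α hi
    simp only [ribbon, this, val_lo, val_hi]
    push_cast; omega
  northeast i hi := absurd trivial hi

theorem descGens_injective :
    Function.Injective fun α : Composition n => descGens n α.blocks := by
  intro α β h
  have h : descGens n α.blocks = descGens n β.blocks := h
  apply Composition.ext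
  refine eq_of_descents_eq (fun _ => α.blocks_pos) (fun _ => β.blocks_pos)
    (by rw [α.blocks_sum, β.blocks_sum]) ?_
  have key : ∀ α β : Composition n, descGens n α.blocks = descGens n β.blocks →
      descents α.blocks ⊆ descents β.blocks := by
    intro α β h d hd
    have hb := mem_descents_bound (fun _ => α.blocks_pos) hd
    rw [α.blocks_sum] at hb
    -- Descents lie between 1 and n - 1, so each one is i + 1 for a generator index `i`.
    have h1 : (⟨d - 1, by omega⟩ : Fin (n - 1)) ∈ descGens n α.blocks := by
      change d - 1 + 1 ∈ descents α.blocks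
      rwa [Nat.sub_add_cancel hb.1]
    rw [h] at h1
    change d - 1 + 1 ∈ descents β.blocks at h1
    rwa [Nat.sub_add_cancel hb.1] at h1
  exact (key α β h).antisymm (key β α h.symm)

namespace GenRibbon

variable (α : GenRibbon n)

theorem proper_parts : Proper α.parts := by
  intro a ha
  obtain ⟨i, rfl⟩ := List.mem_ofFn.1 ha
  refine ⟨?_, fun _ => (α.comp i).blocks_pos⟩
  have := α.sizes.one_le_blocksFun i
  rw [Ne, (α.comp i).blocks_eq_nil]; omega

theorem map_sum_parts : α.parts.map List.sum = α.sizes.blocks := by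
  rw [parts, List.map_ofFn, ← α.sizes.ofFn_blocksFun]
  congr 1
  funext i
  exact (α.comp i).blocks_sum

theorem mem_setJ {i : Fin (n - 1)} : i ∈ α.setJ ↔ i ∉ descGens n α.sizes.blocks :=
  mem_descents_nearProd_replicate (fun _ => α.sizes.blocks_pos) (Nat.succ_pos _)
    (by rw [α.sizes.blocks_sum]; omega)

theorem mem_descGens_rows {i : Fin (n - 1)} :
    i ∈ descGens n α.rows.blocks ↔ i ∈ α.setI ∨ i ∉ α.setJ := by
  rw [mem_setJ, not_not]
  have := mem_descents_flatten α.proper_parts (d := i + 1)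
  rwa [map_sum_parts] at this

theorem setI_subset_setJ : α.setI ⊆ α.setJ := by
  intro i hi
  rw [mem_setJ]
  intro h
  refine notMem_descents_nearProd α.proper_parts ?_ hi
  rw [map_sum_parts]; exact h

theorem hasType_diagram : HasType α.diagram α.setI α.setJ where
  subset := α.setI_subset_setJ
  right i hJ hI := by
    have h1 := index_hi_of_notMem α.rows (i := i) (by rw [mem_descGens_rows]; tauto)
    have h2 := index_hi_of_notMem α.sizes (α.mem_setJ.1 hJ)
    simp only [diagram, h1, h2, val_lo, val_hi]
    exact ⟨trivial, by push_cast; omega⟩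
  up i hI := by
    have h1 := index_hi_of_mem α.rows (i := i) (by rw [mem_descGens_rows]; tauto)
    have h2 := index_hi_of_notMem α.sizes (α.mem_setJ.1 (α.setI_subset_setJ hI))
    simp only [diagram, h1, h2, val_lo, val_hi]
    push_cast; omega
  northeast i hJ := by
    have h1 := index_hi_of_mem α.rows (i := i) (by rw [mem_descGens_rows]; tauto)
    have h2 := index_hi_of_mem α.sizes (i := i) (by rw [mem_setJ] at hJ; tauto)
    simp only [diagram, h1, h2, val_lo, val_hi]
    push_cast; omega

theorem descGens_inter_setJ (β : α.Glued) : descGens n β.1.blocks ∩ α.setJ = α.setI := by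
  obtain ⟨-, -, -, X, hX, h⟩ := mem_glue_imp α.proper_parts β.2
  rw [map_sum_parts] at hX
  ext i
  have h1 : i ∈ descGens n β.1.blocks ↔ i ∈ α.setI ∨ (i : ℕ) + 1 ∈ X := by
    change _ ∈ descents _ ↔ _
    rw [h]; rfl
  have h2 : (i : ℕ) + 1 ∈ X → i ∉ α.setJ := by
    intro hi
    rw [mem_setJ, not_not]; exact hX hi
  have h3 := @setI_subset_setJ n α i
  rw [Set.mem_inter_iff]; tauto

theorem exists_glued (X : Set (Fin (n - 1))) (hX : X ∩ α.setJ = α.setI) :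
    ∃ β : α.Glued, descGens n β.1.blocks = X := by
  obtain ⟨b, hb, h⟩ := exists_mem_glue α.proper_parts
    -- Only the part of `X` at the boundaries can be chosen freely; inside `J` the hypothesis fixes
    -- it to be `I`.
    {d | d ∈ descents α.sizes.blocks ∧ ∃ i ∈ X, (i : ℕ) + 1 = d} (by
      rw [map_sum_parts]; exact fun d hd => hd.1)
  obtain ⟨h1, h2, -⟩ := mem_glue_imp α.proper_parts hb
  rw [map_sum_parts, α.sizes.blocks_sum] at h2
  refine ⟨⟨⟨b, fun {_} => h1 _, h2⟩, hb⟩, ?_⟩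
  ext i
  have h3 : i ∈ descGens n b ↔ i ∈ α.setI ∨ (i ∉ α.setJ ∧ i ∈ X) := by
    change _ ∈ descents _ ↔ _
    rw [h, mem_setJ, not_not]
    refine or_congr Iff.rfl (and_congr Iff.rfl ?_)
    constructor
    · rintro ⟨j, hj, he⟩
      rwa [← Fin.ext (Nat.succ_injective he)]
    · intro hi; exact ⟨i, hi, rfl⟩
  have h4 : i ∈ α.setI ↔ i ∈ X ∧ i ∈ α.setJ := by rw [← hX]; rfl
  change i ∈ descGens n b ↔ _
  tauto

theorem mem_setJ_iff_exists {i : Fin (n - 1)} :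
    i ∈ α.setJ ↔ ∃ k j, i = blockGen α.sizes k j := by
  rw [mem_setJ]
  constructor
  · intro h
    have h1 := index_hi_of_notMem α.sizes h
    have h2 := α.sizes.sizeUpTo_index_le (lo i)
    have h3 := α.sizes.lt_sizeUpTo_index_succ (hi i)
    rw [h1] at h3
    have h4 := α.sizes.sizeUpTo_succ' (α.sizes.index (lo i))
    rw [val_lo] at h2
    rw [val_hi] at h3
    have h3 : (i : ℕ) + 1 < α.sizes.sizeUpTo (α.sizes.index (lo i) + 1) := h3
    refine ⟨α.sizes.index (lo i), ⟨i - α.sizes.sizeUpTo (α.sizes.index (lo i)), by omega⟩,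
      Fin.ext ?_⟩
    simp only [blockGen]; omega
  · rintro ⟨k, j, rfl⟩ h
    have h1 := index_hi_of_mem α.sizes h
    have h2 := α.sizes.sizeUpTo_succ' k
    have hj := j.2
    have e1 : α.sizes.index (lo (blockGen α.sizes k j)) = k := by
      apply index_eq_of_sizeUpTo
      · simp [val_lo, blockGen]
      · simp only [val_lo, blockGen]; omega
    have e2 : α.sizes.index (hi (blockGen α.sizes k j)) = k := by
      apply index_eq_of_sizeUpTo
      · simp only [val_hi, blockGen]; omega
      · simp only [val_hi, blockGen]; omega
    rw [e1, e2] at h1; omega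

theorem blockGen_mem_setJ (k : Fin α.sizes.length) (j : Fin (α.sizes.blocksFun k - 1)) :
    blockGen α.sizes k j ∈ α.setJ :=
  α.mem_setJ_iff_exists.2 ⟨k, j, rfl⟩

theorem blockGen_mem_setI {k : Fin α.sizes.length} {j : Fin (α.sizes.blocksFun k - 1)} :
    blockGen α.sizes k j ∈ α.setI ↔ j ∈ descGens _ (α.comp k).blocks := by
  have hlen : α.parts.length = α.sizes.length := by simp [parts]
  have hsum : ∀ m, ((α.parts.take m).map List.sum).sum = α.sizes.sizeUpTo m := by
    intro m
    rw [List.map_take, map_sum_parts]; rfl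
  have hget : ∀ (m : Fin α.sizes.length) (hm : (m : ℕ) < α.parts.length),
      α.parts[(m : ℕ)] = (α.comp m).blocks := by
    intro m hm
    simp [parts]
  change _ ∈ descents (nearProd α.parts) ↔ _ ∈ descents _
  rw [mem_descents_nearProd]
  have h2 := α.sizes.sizeUpTo_succ' k
  have hj := j.2
  constructor
  · rintro ⟨m, hm, e, he, h⟩
    have hm' : m < α.sizes.length := by omega
    have hg := hget ⟨m, hm'⟩ hm
    rw [hg] at he
    have hb := mem_descents_bound (fun _ => (α.comp ⟨m, hm'⟩).blocks_pos) he
    rw [Composition.blocks_sum] at hb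
    rw [hsum] at h
    have h1 := α.sizes.sizeUpTo_succ' ⟨m, hm'⟩
    simp only [blockGen] at h
    have hlt : α.sizes.sizeUpTo k + j < n := (lo (blockGen α.sizes k j)).2
    have e1 : α.sizes.index ⟨α.sizes.sizeUpTo k + j, hlt⟩ = k :=
      index_eq_of_sizeUpTo _ (by simp) (by simp only; omega)
    have e2 : α.sizes.index ⟨α.sizes.sizeUpTo k + j, hlt⟩ = ⟨m, hm'⟩ :=
      index_eq_of_sizeUpTo _ (by simp only; omega) (by simp only at h1 ⊢; omega)
    -- The position lies in the k-th and in the m-th block, so the two blocks coincide.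
    rw [e1] at e2
    subst e2
    obtain rfl : e = j + 1 := by simp only at h; omega
    exact he
  · intro h
    exact ⟨k, by rw [hlen]; exact k.2, j + 1, by rwa [hget], by
      rw [hsum]; simp only [blockGen]; omega⟩

end GenRibbon

end RibbonType

/-! ### Permutations that preserve the blocks of a composition -/

section Blocks

variable {n : ℕ} {K : Set (Fin (n - 1))} {w : Equiv.Perm (Fin n)}

/-- A descent of `w` at p violates the preservation of {0, …, p}, so it must belong to `K`. Removing
it shortens `w` and keeps the hypothesis. -/
theorem mem_parabolic_of_apply_le_iff
    (h : ∀ i ∉ K, ∀ x : Fin n, (w x : ℕ) ≤ i ↔ (x : ℕ) ≤ i) : w ∈ parabolic K := by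
  induction hk : length w using Nat.strong_induction_on generalizing w with
  | _ k ih =>
    by_cases hw : w = 1
    · rw [hw]; exact one_mem _
    · obtain ⟨p, hp⟩ := exists_descent hw
      have hpK : p ∈ K := by
        by_contra hc
        have h1 := (h p hc (lo p)).2 le_rfl
        have h2 := mt (h p hc (hi p)).1 (by rw [val_hi]; omega)
        have hp : (w (hi p) : ℕ) < w (lo p) := hp
        omega
      have h1 := length_mul_adj_of_gt hp
      have h2 := ih _ (by omega) (w := w * adj p) (fun i hi x => by
        rw [Equiv.Perm.mul_apply, h i hi,
          apply_le_iff_of_mem_parabolic (adj_mem_parabolic hpK) hi]) rfl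
      have h3 := mul_mem h2 (adj_mem_parabolic hpK)
      rwa [mul_adj_cancel] at h3

/-- The permutation that acts on each block of a composition by a given permutation. -/
def blockPerm (ν : Composition n) (σ : ∀ k : Fin ν.length, Equiv.Perm (Fin (ν.blocksFun k))) :
    Equiv.Perm (Fin n) :=
  ν.blocksFinEquiv.permCongr (Equiv.Perm.sigmaCongrRight σ)

variable {ν : Composition n}

theorem blockPerm_embedding (σ : ∀ k : Fin ν.length, Equiv.Perm (Fin (ν.blocksFun k)))
    (k : Fin ν.length) (j : Fin (ν.blocksFun k)) :
    blockPerm ν σ (ν.embedding k j) = ν.embedding k (σ k j) := by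
  have h : ν.blocksFinEquiv.symm (ν.embedding k j) = ⟨k, j⟩ :=
    ν.blocksFinEquiv.symm_apply_apply ⟨k, j⟩
  rw [blockPerm, Equiv.permCongr_apply, h]
  rfl

theorem exists_embedding (ν : Composition n) (x : Fin n) : ∃ k j, x = ν.embedding k j :=
  ⟨ν.index x, ν.invEmbedding x, (ν.embedding_comp_inv x).symm⟩

theorem blockPerm_inv_embedding (σ : ∀ k : Fin ν.length, Equiv.Perm (Fin (ν.blocksFun k)))
    (k : Fin ν.length) (j : Fin (ν.blocksFun k)) :
    (blockPerm ν σ)⁻¹ (ν.embedding k j) = ν.embedding k ((σ k)⁻¹ j) := by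
  rw [Equiv.Perm.inv_eq_iff_eq, blockPerm_embedding]
  simp

theorem eq_blockPerm_iff {σ : ∀ k : Fin ν.length, Equiv.Perm (Fin (ν.blocksFun k))} :
    w = blockPerm ν σ ↔ ∀ k j, w (ν.embedding k j) = ν.embedding k (σ k j) := by
  constructor
  · rintro rfl; exact blockPerm_embedding σ
  · intro h
    ext x
    obtain ⟨k, j, rfl⟩ := exists_embedding ν x
    rw [h, blockPerm_embedding]

theorem blockPerm_injective : Function.Injective (blockPerm ν) := by
  intro σ σ' h
  funext k
  ext j
  have h1 := blockPerm_embedding σ k j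
  rw [h, blockPerm_embedding] at h1
  rw [(ν.embedding k).injective h1]

theorem lo_blockGen (k : Fin ν.length) (j : Fin (ν.blocksFun k - 1)) :
    lo (blockGen ν k j) = ν.embedding k (lo j) := rfl

theorem hi_blockGen (k : Fin ν.length) (j : Fin (ν.blocksFun k - 1)) :
    hi (blockGen ν k j) = ν.embedding k (hi j) := rfl

theorem adj_blockGen_embedding (k : Fin ν.length) (j : Fin (ν.blocksFun k - 1))
    (x : Fin (ν.blocksFun k)) :
    adj (blockGen ν k j) (ν.embedding k x) = ν.embedding k (adj j x) := by
  rw [adj, adj, lo_blockGen, hi_blockGen]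
  exact (ν.embedding k).injective.swap_apply _ _ _

theorem adj_blockGen_mul_blockPerm (σ : ∀ k : Fin ν.length, Equiv.Perm (Fin (ν.blocksFun k)))
    (k : Fin ν.length) (j : Fin (ν.blocksFun k - 1)) :
    adj (blockGen ν k j) * blockPerm ν σ =
      blockPerm ν (Function.update σ k (adj j * σ k)) := by
  rw [eq_blockPerm_iff]
  intro m x
  rw [Equiv.Perm.mul_apply, blockPerm_embedding]
  by_cases hm : m = k
  · subst hm
    rw [adj_blockGen_embedding, Function.update_self]; rfl
  · rw [Function.update_of_ne hm]
    have h1 : ∀ y, ν.embedding m (σ m x) ≠ ν.embedding k y := by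
      intro y h
      have := congrArg ν.index h
      rw [ν.index_embedding, ν.index_embedding] at this
      exact hm this
    exact Equiv.swap_apply_of_ne_of_ne (h1 (lo j)) (h1 (hi j))

namespace GenRibbon

variable (α : GenRibbon n)

theorem blockPerm_mem_parabolic
    (σ : ∀ k : Fin α.sizes.length, Equiv.Perm (Fin (α.sizes.blocksFun k))) :
    blockPerm α.sizes σ ∈ parabolic α.setJ := by
  apply mem_parabolic_of_apply_le_iff
  intro i hi x
  rw [mem_setJ, not_not, mem_descGens_iff] at hi
  obtain ⟨m, -, -, hm⟩ := hi
  obtain ⟨k, j, rfl⟩ := exists_embedding α.sizes x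
  rw [blockPerm_embedding, Composition.coe_embedding, Composition.coe_embedding]
  have h1 := α.sizes.sizeUpTo_succ' k
  have h2 := j.2
  have h3 := (σ k j).2
  rcases Nat.lt_or_ge k m with hkm | hkm
  · have := α.sizes.monotone_sizeUpTo (Nat.succ_le_of_lt hkm)
    rw [Nat.succ_eq_add_one] at this
    omega
  · have := α.sizes.monotone_sizeUpTo hkm
    omega

/-- A generator in `J` exchanges two positions of one block. So `w` preserves block indices and
restricts to an injection, hence a permutation, of each block. -/
theorem exists_eq_blockPerm (hw : w ∈ parabolic α.setJ) :
    ∃ σ, w = blockPerm α.sizes σ := by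
  have hidx : ∀ x, α.sizes.index (w x) = α.sizes.index x := by
    induction hw using Subgroup.closure_induction with
    | one => intro x; rfl
    | mul a b _ _ ha hb => intro x; rw [Equiv.Perm.mul_apply, ha, hb]
    | inv a _ ha => intro x; rw [← ha (a⁻¹ x)]; simp
    | mem a ha =>
      obtain ⟨i, hi, rfl⟩ := ha
      have h1 := index_hi_of_notMem α.sizes (α.mem_setJ.1 hi)
      intro x
      by_cases hx : x = lo i
      · rw [hx, adj_lo, h1]
      · by_cases hx' : x = HeckeTableaux.hi i
        · rw [hx', adj_hi, h1]
        · rw [adj, Equiv.swap_apply_of_ne_of_ne hx hx']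
  have hex : ∀ k (j : Fin (α.sizes.blocksFun k)), ∃ j', α.sizes.embedding k j' =
      w (α.sizes.embedding k j) := by
    intro k j
    refine α.sizes.mem_range_embedding_iff'.2 ?_
    rw [hidx, α.sizes.index_embedding]
  choose g hg using hex
  have hginj : ∀ k, Function.Injective (g k) := by
    intro k j j' h
    have h1 := hg k j
    rw [h, hg k j'] at h1
    exact ((α.sizes.embedding k).injective (w.injective h1)).symm
  refine ⟨fun k => Equiv.ofBijective (g k) (Finite.injective_iff_bijective.1 (hginj k)), ?_⟩
  rw [eq_blockPerm_iff]
  exact fun k j => (hg k j).symm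

theorem descIn_blockPerm
    {σ : ∀ k : Fin α.sizes.length, Equiv.Perm (Fin (α.sizes.blocksFun k))} :
    DescIn α.setI α.setJ (blockPerm α.sizes σ) ↔
      ∀ k, DescIn (descGens _ (α.comp k).blocks) Set.univ (σ k) := by
  constructor
  · intro h k j _
    have h1 := h _ (α.blockGen_mem_setJ k j)
    rw [blockGen_mem_setI, lo_blockGen, hi_blockGen, blockPerm_embedding, blockPerm_embedding,
      OrderEmbedding.lt_iff_lt] at h1
    exact h1
  · intro h i hi
    obtain ⟨k, j, rfl⟩ := α.mem_setJ_iff_exists.1 hi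
    rw [blockGen_mem_setI, lo_blockGen, hi_blockGen, blockPerm_embedding, blockPerm_embedding,
      OrderEmbedding.lt_iff_lt]
    exact h k j trivial

end GenRibbon

end Blocks

/-! ### Induced modules -/

section Induction

open PiTensorProduct

theorem prod_ofFn_eq_of_ne {M : Type*} [Monoid M] {k : ℕ} (f : Fin k → M) (i : Fin k)
    (h : ∀ j, j ≠ i → f j = 1) : (List.ofFn f).prod = f i := by
  induction k with
  | zero => exact i.elim0
  | succ k ih =>
    rw [List.ofFn_succ, List.prod_cons]
    cases i using Fin.cases with
    | zero =>
      have : (List.ofFn fun j : Fin k => f j.succ) = List.replicate k 1 := by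
        rw [List.eq_replicate_iff]
        refine ⟨by simp, fun b hb => ?_⟩
        obtain ⟨j, rfl⟩ := List.mem_ofFn.1 hb
        exact h _ (Fin.succ_ne_zero j)
      rw [this]; simp
    | succ i =>
      rw [h 0 (Fin.succ_ne_zero i).symm, one_mul]
      exact ih (fun j => f j.succ) i fun j hj => h _ fun e => hj (Fin.succ_injective _ e)

variable (F : Type*) [Field F] {n : ℕ}

theorem parabolicHom_single (ν : Composition n) (k : Fin ν.length)
    (a : ZeroHecke F (ν.blocksFun k)) :
    parabolicHom F ν (singleAlgHom (R := F) (A := fun k => ZeroHecke F (ν.blocksFun k)) k a) =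
      blockHom F ν k a := by
  rw [singleAlgHom_apply, parabolicHom, liftAlgHom_apply, lift.tprod,
    MultilinearMap.compLinearMap_apply, MultilinearMap.mkPiAlgebraFin_apply]
  rw [prod_ofFn_eq_of_ne _ k]
  · simp
  · intro j hj
    simp [Pi.mulSingle_eq_of_ne hj]

theorem blockHom_genBar (ν : Composition n) (k : Fin ν.length) (j : Fin (ν.blocksFun k - 1)) :
    blockHom F ν k (genBar F j) = genBar F (blockGen ν k j) := by
  rw [genBar, map_sub, map_one, blockHom, liftHecke_gen]; rfl

theorem tensorRep_single {ι : Type*} [DecidableEq ι] {A M : ι → Type*} [∀ i, Ring (A i)]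
    [∀ i, Algebra F (A i)] [∀ i, AddCommGroup (M i)] [∀ i, Module F (M i)]
    (ρ : ∀ i, A i →ₐ[F] Module.End F (M i)) (i : ι) (a : A i) (x : ∀ i, M i) :
    tensorRep F ρ (singleAlgHom i a) (tprod F x) =
      tprod F (Function.update x i (ρ i a (x i))) := by
  have h : tensorRep F ρ (singleAlgHom i a) =
      PiTensorProduct.map fun k => ρ k (Pi.mulSingle i a k) := lift.tprod _
  rw [h, map_tprod]
  congr 1
  funext k
  by_cases hk : k = i
  · subst hk; simp
  · simp [Pi.mulSingle_eq_of_ne hk, Function.update_of_ne hk]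

namespace GenRibbon

variable (α : GenRibbon n)

/-- The representation of `H_{n_1}(0) ⊗ ⋯ ⊗ H_{n_k}(0)` on `P_{α¹} ⊗ ⋯ ⊗ P_{αᵏ}`. -/
abbrev rep := tensorRep F fun k => tabRep F (ribbon (α.comp k))

/-- The basis of `P_{α¹} ⊗ ⋯ ⊗ P_{αᵏ}` of families of standard tableaux. -/
def tensorBasis : Module.Basis (∀ k, StdTableau (ribbon (α.comp k))) F
    (⨂[F] k, TabSpan F (ribbon (α.comp k))) :=
  Basis.piTensorProduct fun k => tabBasis F (ribbon (α.comp k))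

theorem tensorBasis_apply (τ : ∀ k, StdTableau (ribbon (α.comp k))) :
    α.tensorBasis F τ = tprod F fun k => tabOf F (ribbon (α.comp k)) (τ k).entry := by
  rw [tensorBasis, Basis.piTensorProduct_apply]
  congr 1
  funext k
  rw [tabBasis_apply, tabOf_entry]

/-- The linear map that places the components of a family of tableaux next to each other. -/
def juxtapose : (⨂[F] k, TabSpan F (ribbon (α.comp k))) →ₗ[F] TabSpan F α.diagram :=
  (α.tensorBasis F).constr F fun τ =>
    tabOf F α.diagram (blockPerm α.sizes fun k => (τ k).entry)

/-- The zero convention is compatible with juxtaposition: one nonstandard component makes the tensor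
zero and the block permutation nonstandard. The action formula can therefore be compared without
deciding whether the result is standard. -/
theorem juxtapose_tprod (σ : ∀ k : Fin α.sizes.length, Equiv.Perm (Fin (α.sizes.blocksFun k))) :
    α.juxtapose F (tprod F fun k => tabOf F (ribbon (α.comp k)) (σ k)) =
      tabOf F α.diagram (blockPerm α.sizes σ) := by
  by_cases h : ∀ k, DescIn (descGens _ (α.comp k).blocks) Set.univ (σ k)
  · have := tensorBasis_apply F α fun k => (hasType_ribbon (α.comp k)).tableau (σ k) (h k)
    change _ = tprod F fun k => tabOf F (ribbon (α.comp k)) (σ k) at this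
    rw [← this, juxtapose, Module.Basis.constr_basis]
    rfl
  · rw [α.hasType_diagram.tabOf_eq_zero F (mt α.descIn_blockPerm.1 h)]
    push Not at h
    obtain ⟨k, hk⟩ := h
    have h0 : (tprod F fun k => tabOf F (ribbon (α.comp k)) (σ k)) = 0 :=
      MultilinearMap.map_coord_zero (PiTensorProduct.tprod F) (m := fun k => tabOf F (ribbon (α.comp k)) (σ k)) k
        ((hasType_ribbon (α.comp k)).tabOf_eq_zero F hk)
    rw [h0, map_zero]

theorem juxtapose_rep_single_genBar (k : Fin α.sizes.length) (j : Fin (α.sizes.blocksFun k - 1))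
    (x : ⨂[F] k, TabSpan F (ribbon (α.comp k))) :
    α.juxtapose F (α.rep F (singleAlgHom k (genBar F j)) x) =
      genBar F (blockGen α.sizes k j) • α.juxtapose F x := by
  have hx : x ∈ Submodule.span F (Set.range (α.tensorBasis F)) := by
    rw [Module.Basis.span_eq]; trivial
  induction hx using Submodule.span_induction with
  | zero => simp
  | add x y _ _ hx hy => rw [map_add, map_add, hx, hy, map_add, smul_add]
  | smul c x _ hx => rw [map_smul, map_smul, hx, map_smul, smul_comm]
  | mem x hx =>
    obtain ⟨τ, rfl⟩ := hx
    have hτ : ∀ k, DescIn (descGens _ (α.comp k).blocks) Set.univ (τ k).entry :=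
      fun k => (hasType_ribbon _).descIn (τ k)
    have hd := α.descIn_blockPerm.2 hτ
    rw [tensorBasis_apply, rep, tensorRep_single, juxtapose_tprod F α fun k => (τ k).entry,
      α.hasType_diagram.genBar_smul_tabOf F hd, tabRep_genBar, ← genBar_smul,
      (hasType_ribbon _).genBar_smul_tabOf F (hτ k), lo_blockGen, hi_blockGen,
      blockPerm_inv_embedding, blockPerm_inv_embedding]
    by_cases h : (τ k).entry⁻¹ (hi j) < (τ k).entry⁻¹ (lo j)
    · rw [if_pos h, if_pos ((OrderEmbedding.lt_iff_lt _).2 h),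
        (PiTensorProduct.tprod F).map_update_neg, Function.update_eq_self, map_neg,
        juxtapose_tprod F α fun k => (τ k).entry]
    · rw [if_neg h, if_neg (mt (OrderEmbedding.lt_iff_lt _).1 h), adj_blockGen_mul_blockPerm,
        ← juxtapose_tprod]
      congr 2
      funext m
      by_cases hm : m = k
      · subst hm; simp
      · simp [Function.update_of_ne hm]

/-- The elements `a` for which this holds form a subalgebra. It contains the generators of each
tensor factor, hence each factor, and pure tensors are products of elements of single factors. -/
theorem juxtapose_rep (a : ⨂[F] k : Fin α.sizes.length, ZeroHecke F (α.sizes.blocksFun k))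
    (x : ⨂[F] k, TabSpan F (ribbon (α.comp k))) :
    α.juxtapose F (α.rep F a x) = parabolicHom F α.sizes a • α.juxtapose F x := by
  let S : Subalgebra F (⨂[F] k : Fin α.sizes.length, ZeroHecke F (α.sizes.blocksFun k)) :=
    { carrier := {a | ∀ x, α.juxtapose F (α.rep F a x) =
        parabolicHom F α.sizes a • α.juxtapose F x}
      mul_mem' := fun {a b} ha hb x => by
        rw [map_mul, map_mul, Module.End.mul_apply, ha, hb, mul_smul]
      add_mem' := fun {a b} ha hb x => by
        rw [map_add, map_add, LinearMap.add_apply, map_add, ha, hb, add_smul]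
      algebraMap_mem' := fun c x => by
        rw [AlgHom.commutes, AlgHom.commutes, algebraMap_smul, Module.algebraMap_end_apply,
          map_smul] }
  have hsingle : ∀ (k : Fin α.sizes.length) (b : ZeroHecke F (α.sizes.blocksFun k)),
      singleAlgHom (R := F) (A := fun k => ZeroHecke F (α.sizes.blocksFun k)) k b ∈ S := by
    intro k b
    have hb : b ∈ Algebra.adjoin F (Set.range (gen F)) := by rw [adjoin_gen]; trivial
    have hle : Algebra.adjoin F (Set.range (gen F)) ≤ S.comap
        (singleAlgHom (R := F) (A := fun k => ZeroHecke F (α.sizes.blocksFun k)) k) := by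
      rw [Algebra.adjoin_le_iff]
      rintro _ ⟨j, rfl⟩
      rw [gen_eq]
      refine add_mem (one_mem _) ?_
      intro x
      change _ = parabolicHom F α.sizes (singleAlgHom (R := F)
        (A := fun k => ZeroHecke F (α.sizes.blocksFun k)) k (genBar F j)) • _
      rw [parabolicHom_single, blockHom_genBar]
      exact α.juxtapose_rep_single_genBar F k j x
    exact hle hb
  have htop : ∀ a, a ∈ S := by
    intro a
    induction a using PiTensorProduct.induction_on with
    | smul_tprod c f =>
      refine S.smul_mem ?_ c
      exact Submonoid.pi_mem_of_mulSingle_mem (H := S.toSubmonoid.comap (tprodMonoidHom F)) f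
        fun k => hsingle k (f k)
    | add x y hx hy => exact add_mem hx hy
  exact htop a x

end GenRibbon

end Induction

/-! ### Universal property of induced modules -/

namespace Induced

variable {F A B N P : Type*} [Field F] [Ring A] [Algebra F A] [Ring B] [Algebra F B]
  [AddCommGroup N] [Module F N] [AddCommGroup P] [Module F P] [Module B P] [IsScalarTower F B P]
  (φ : A →ₐ[F] B) (ρ : A →ₐ[F] Module.End F N)

/-- The class of `b ⊗ x` in an induced module. -/
def mk : B →ₗ[F] N →ₗ[F] Induced φ ρ :=
  (TensorProduct.mk F B N).compr₂ ((balanced φ ρ).mkQ.restrictScalars F)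

theorem mk_mul (b : B) (a : A) (x : N) : mk φ ρ (b * φ a) x = mk φ ρ b (ρ a x) := by
  rw [← sub_eq_zero]
  exact (Submodule.Quotient.mk_eq_zero _).2 (Submodule.subset_span ⟨b, a, x, rfl⟩)

variable {φ ρ}

theorem eq_top_of_mk_mem {ι : Type*} {e : ι → B} (he : Submodule.span F (Set.range e) = ⊤)
    {p : Submodule F (Induced φ ρ)} (hp : ∀ i x, mk φ ρ (e i) x ∈ p) : p = ⊤ := by
  have h2 : ∀ b x, mk φ ρ b x ∈ p := by
    intro b x
    have hb : b ∈ Submodule.span F (Set.range e) := by rw [he]; trivial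
    induction hb using Submodule.span_induction with
    | zero => rw [LinearMap.map_zero₂]; exact p.zero_mem
    | add x y _ _ hx hy => rw [LinearMap.map_add₂]; exact p.add_mem hx hy
    | smul c x _ hx => rw [LinearMap.map_smul₂]; exact p.smul_mem c hx
    | mem b hb => obtain ⟨i, rfl⟩ := hb; exact hp i x
  rw [eq_top_iff]
  intro z _
  obtain ⟨t, rfl⟩ := Submodule.mkQ_surjective _ z
  induction t using TensorProduct.induction_on with
  | zero => rw [map_zero]; exact p.zero_mem
  | add x y hx hy => rw [map_add]; exact p.add_mem (hx trivial) (hy trivial)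
  | tmul b x => exact h2 b x

/-- The homomorphism of `B`-modules on an induced module that extends an `A`-linear map. -/
def lift (f : N →ₗ[F] P) (hf : ∀ a x, f (ρ a x) = φ a • f x) : Induced φ ρ →ₗ[B] P :=
  (balanced φ ρ).liftQ
    (TensorProduct.AlgebraTensorModule.lift (LinearMap.toSpanSingleton B (N →ₗ[F] P) f)) (by
    rw [balanced, Submodule.span_le]
    rintro _ ⟨b, a, x, rfl⟩
    rw [SetLike.mem_coe, LinearMap.mem_ker, map_sub, sub_eq_zero]
    change (b * φ a) • f x = b • f (ρ a x)
    rw [hf, mul_smul])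

theorem lift_mk (f : N →ₗ[F] P) (hf : ∀ a x, f (ρ a x) = φ a • f x) (b : B) (x : N) :
    lift f hf (mk φ ρ b x) = b • f x := rfl

end Induced

/-! ### The induced module of a generalized ribbon -/

namespace GenRibbon

variable (F : Type*) [Field F] {n : ℕ} (α : GenRibbon n)

open PiTensorProduct

/-- The homomorphism from the induced module that sends `b ⊗ x` to `b x`. -/
def fromInduced : inducedTab F α →ₗ[ZeroHecke F n] TabSpan F α.diagram :=
  Induced.lift (α.juxtapose F) (α.juxtapose_rep F)

/-- The class of `b ⊗ x` in the induced module. -/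
def inducedMk :=
  Induced.mk (parabolicHom F α.sizes) (α.rep F)

theorem fromInduced_inducedMk (b : ZeroHecke F n)
    (x : ⨂[F] k, TabSpan F (ribbon (α.comp k))) :
    α.fromInduced F (α.inducedMk F b x) = b • α.juxtapose F x := 
  Induced.lift_mk _ _ b x

theorem inducedMk_mul (b : ZeroHecke F n)
    (a : ⨂[F] k : Fin α.sizes.length, ZeroHecke F (α.sizes.blocksFun k))
    (x : ⨂[F] k, TabSpan F (ribbon (α.comp k))) :
    α.inducedMk F (b * parabolicHom F α.sizes a) x = α.inducedMk F b (α.rep F a x) :=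
  Induced.mk_mul _ _ b a x

theorem genBarPerm_mem_range {v : Equiv.Perm (Fin n)} (hv : v ∈ parabolic α.setJ) :
    ∃ a, parabolicHom F α.sizes a = genBarPerm F v := by
  have : genBarPerm F v ∈ (parabolicHom F α.sizes).range := by
    refine list_prod_mem fun x hx => ?_
    obtain ⟨i, hi, rfl⟩ := List.mem_map.1 hx
    obtain ⟨k, j, rfl⟩ := α.mem_setJ_iff_exists.1 (mem_of_mem_reducedWord hv i hi)
    exact ⟨_, (parabolicHom_single F α.sizes k (genBar F j)).trans (blockHom_genBar F _ k j)⟩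
  exact this

/-- The minimal representatives of the left cosets of the parabolic subgroup of `J`. -/
def MinRep (J : Set (Fin (n - 1))) : Type := {u : Equiv.Perm (Fin n) // ∀ i ∈ J, u (lo i) < u (hi i)}

/-- The spanning family `π̄_u ⊗ τ`, with minimal coset representatives `u`, of the induced module. -/
def inducedFamily (p : MinRep α.setJ × ∀ k, StdTableau (ribbon (α.comp k))) : inducedTab F α :=
  α.inducedMk F (genBarPerm F p.1.1) (α.tensorBasis F p.2)

/-- For w = u v one has π̄_w = π̄_u π̄_v. The factor π̄_v lies in the parabolic subalgebra and moves
across the tensor sign, so only minimal representatives `u` are needed. -/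
theorem span_inducedFamily : Submodule.span F (Set.range (α.inducedFamily F)) = ⊤ := by
  have h1 : ∀ (u : MinRep α.setJ) x,
      α.inducedMk F (genBarPerm F u.1) x ∈ Submodule.span F (Set.range (α.inducedFamily F)) := by
    intro u x
    have hx : x ∈ Submodule.span F (Set.range (α.tensorBasis F)) := by
      rw [Module.Basis.span_eq]; trivial
    induction hx using Submodule.span_induction with
    | zero => rw [map_zero]; exact Submodule.zero_mem _
    | add x y _ _ hx hy => rw [map_add]; exact Submodule.add_mem _ hx hy
    | smul c x _ hx => rw [LinearMap.map_smul]; exact Submodule.smul_mem _ c hx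
    | mem x hx =>
      obtain ⟨τ, rfl⟩ := hx
      exact Submodule.subset_span ⟨(u, τ), rfl⟩
  refine Induced.eq_top_of_mk_mem (span_genBarPerm F) fun w x => ?_
  obtain ⟨u, v, hu, hv, rfl⟩ := exists_mul_of_ascents α.setJ w
  obtain ⟨a, ha⟩ := α.genBarPerm_mem_range F hv
  rw [← genBarPerm_mul_of_ascents F hu hv, ← ha]
  change α.inducedMk F _ x ∈ _
  rw [inducedMk_mul]
  exact h1 ⟨u, hu⟩ _

/-- Since `u` is increasing on the orbits of the parabolic subgroup, u v and `v` have the same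
descents in `J`. -/
theorem descIn_mul_blockPerm {u : Equiv.Perm (Fin n)} (hu : ∀ i ∈ α.setJ, u (lo i) < u (hi i))
    {v : Equiv.Perm (Fin n)} (hv : v ∈ parabolic α.setJ) (hd : DescIn α.setI α.setJ v) :
    DescIn α.setI α.setJ (u * v) := by
  intro i hi
  rw [← hd i hi, Equiv.Perm.mul_apply, Equiv.Perm.mul_apply]
  refine ⟨fun h => ?_, mul_apply_gt_of_ascents hu hv⟩
  refine (apply_lt_or_gt v i).resolve_left fun h1 => ?_
  exact absurd (mul_apply_lt_of_ascents hu hv hi h1) (not_lt.2 h.le)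

/-- The tableau of the element `u v`, where `v` is given by a family of tableaux. -/
def shuffle (p : MinRep α.setJ × ∀ k, StdTableau (ribbon (α.comp k))) : StdTableau α.diagram :=
  α.hasType_diagram.tableau (p.1.1 * blockPerm α.sizes fun k => (p.2 k).entry)
    (α.descIn_mul_blockPerm p.1.2 (α.blockPerm_mem_parabolic _)
      (α.descIn_blockPerm.2 fun k => (hasType_ribbon _).descIn (p.2 k)))

theorem shuffle_injective : Function.Injective α.shuffle := by
  rintro ⟨⟨u, hu⟩, τ⟩ ⟨⟨u', hu'⟩, τ'⟩ h
  have h1 : u * _ = u' * _ := congrArg StdTableau.entry h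
  obtain ⟨rfl, h2⟩ := eq_of_mul_eq_mul_of_ascents hu hu' (α.blockPerm_mem_parabolic _)
    (α.blockPerm_mem_parabolic _) h1
  have h3 := blockPerm_injective h2
  have h4 : τ = τ' := funext fun k => StdTableau.ext' (congrFun h3 k)
  rw [h4]

theorem fromInduced_inducedFamily (p : MinRep α.setJ × ∀ k, StdTableau (ribbon (α.comp k))) :
    α.fromInduced F (α.inducedFamily F p) = tabBasis F α.diagram (α.shuffle p) := by
  rw [inducedFamily, fromInduced_inducedMk, tensorBasis_apply,
    juxtapose_tprod F α fun k => (p.2 k).entry, tabBasis_apply, ← tabOf_entry F (α.shuffle p)]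
  exact α.hasType_diagram.genBarPerm_smul_tabOf F p.1.2 (α.blockPerm_mem_parabolic _)
    (α.descIn_blockPerm.2 fun k => (hasType_ribbon _).descIn (p.2 k))
    (α.hasType_diagram.descIn (α.shuffle p))

/-- The spanning family π̄_u ⊗ τ goes to distinct basis tableaux, because the factorization u v is
unique. So injectivity requires no prior knowledge of the dimension of the induced module. -/
theorem fromInduced_injective : Function.Injective (α.fromInduced F) := by
  refine injective_of_linearIndependent ((α.fromInduced F).restrictScalars F)
    (α.span_inducedFamily F) ?_
  have : (fun p => (α.fromInduced F).restrictScalars F (α.inducedFamily F p)) =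
      fun p => tabBasis F α.diagram (α.shuffle p) :=
    funext fun p => α.fromInduced_inducedFamily F p
  rw [this]
  exact (tabBasis F α.diagram).linearIndependent.comp _ α.shuffle_injective

theorem fromInduced_surjective : Function.Surjective (α.fromInduced F) := by
  rw [← LinearMap.range_eq_top, eq_top_iff]
  have h0 : tabOf F α.diagram (longest α.setI) ∈ LinearMap.range (α.fromInduced F) := by
    -- The generator w_0(I) lies in the parabolic subgroup of `J`, so it is a juxtaposition of
    -- permutations of the blocks and is reached from 1 ⊗ N.
    obtain ⟨σ, hσ⟩ := α.exists_eq_blockPerm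
      (parabolic_mono α.setI_subset_setJ (longest_mem α.setI))
    refine ⟨α.inducedMk F 1 (tprod F fun k => tabOf F (ribbon (α.comp k)) (σ k)), ?_⟩
    rw [fromInduced_inducedMk, one_smul, juxtapose_tprod, hσ]
  intro x _
  induction x using α.hasType_diagram.tab_induction F with
  | h0 => exact Submodule.zero_mem _
  | hadd x y hx hy => exact Submodule.add_mem _ (hx trivial) (hy trivial)
  | hsmul c x hx => exact Submodule.smul_of_tower_mem _ c (hx trivial)
  | htab w hw =>
    rw [α.hasType_diagram.tabOf_eq_smul_longest F hw]
    exact Submodule.smul_of_tower_mem _ _ (Submodule.smul_mem _ _ h0)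

/-- The module of tableaux of a generalized ribbon is induced from the tensor product of the
modules of its components. -/
def equivInduced : TabSpan F α.diagram ≃ₗ[ZeroHecke F n] inducedTab F α :=
  (LinearEquiv.ofBijective (α.fromInduced F)
    ⟨α.fromInduced_injective F, α.fromInduced_surjective F⟩).symm

end GenRibbon

end HeckeTableaux

end

theorem mainTheorem2 (F : Type*) [Field F] (n : ℕ) :
    (∀ α : Composition n,
      Nonempty (TabSpan F (ribbon α) ≃ₗ[ZeroHecke F n] PI F (descGens n α.blocks)) ∧
      Module.Projective (ZeroHecke F n) (TabSpan F (ribbon α)) ∧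
      IsIndecomposable (ZeroHecke F n) (TabSpan F (ribbon α))) ∧
    (∀ α : GenRibbon n,
      (∀ (i : Fin (n - 1)) (τ : StdTableau α.diagram),
        (τ.rowOf (hi i) < τ.rowOf (lo i) → genBar F i • tab F τ = -tab F τ) ∧
        (τ.rowOf (lo i) = τ.rowOf (hi i) → genBar F i • tab F τ = 0) ∧
        (τ.rowOf (lo i) < τ.rowOf (hi i) →
          ∃ σ : StdTableau α.diagram, σ.entry = adj i * τ.entry ∧
            genBar F i • tab F τ = tab F σ)) ∧
      Nonempty (TabSpan F α.diagram ≃ₗ[ZeroHecke F n] PIJ F α.setI α.setJ) ∧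
      Nonempty (TabSpan F α.diagram ≃ₗ[ZeroHecke F n] inducedTab F α) ∧
      Nonempty (TabSpan F α.diagram ≃ₗ[ZeroHecke F n]
        ⨁ β : α.Glued, TabSpan F (ribbon β.1))) := by
  refine ⟨fun α => ?_, fun α => ?_⟩
  · have h := hasType_ribbon α
    refine ⟨⟨(h.equivPIJ F).trans (LinearEquiv.ofEq _ _ ?_)⟩, h.projective, h.isIndecomposable⟩
    rw [PIJ, PI, Set.compl_eq_univ_sdiff]
  · have h := α.hasType_diagram
    refine ⟨fun i τ => ⟨fun hi => ?_, fun hi => ?_, fun hi => ⟨τ.swapLT i hi, rfl, ?_⟩⟩,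
      ⟨h.equivPIJ F⟩, ⟨α.equivInduced F⟩,
      h.nonempty_equiv_directSum F (fun β => hasType_ribbon β.1)
        (fun β β' hβ => Subtype.ext (descGens_injective hβ)) α.descGens_inter_setJ α.exists_glued⟩
    · rw [genBar_smul, barOp_gt F i τ hi]
    · rw [genBar_smul, barOp_eq F i τ hi]
    · rw [genBar_smul, barOp_lt F i τ hi]
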